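/- **Pure system.** Pure types are the closed expressions $A,B ::= \mathbf 1 \mid A\times B\mid B\to A\mid A+B\mid \alpha\mid \mathrm{rec}\,\alpha.A$ (with $\alpha$ allowed on both sides of arrows). Terms are $M,N ::= x\mid \lambda x.M\mid MN\mid \mathrm{fix}\,x.M\mid\langle\rangle\mid\langle M,N\rangle\mid\pi_iM\mid \mathrm{in}_iM\mid \mathrm{case}\ M\ \{\mathrm{in}_1x\mapsto N_1\mid \mathrm{in}_2x\mapsto N_2\}\mid \mathrm{fold}\,M\mid\mathrm{unfold}\,M$, without type annotations, with the usual simple typing rules; in particular $\mathrm{fix}\,x.M:A$ if $x:A\vdash M:A$, and $\mathrm{fold}$, $\mathrm{unfold}$ go between $A[\mathrm{rec}\,\alpha.A/\alpha]$ and $\mathrm{rec}\,\alpha.A$. **Denotations.** Pure types denote pointed dcpos (in fact Scott domains): $\llbracket \mathbf 1\rrbracket =\{\bot\le\top\}$; $\llbracket A\times B\rrbracket $ is the cartesian product; $\llbracket B\to A\rrbracket $ is the pointwise ordered set of Scott-continuous maps; $\llbracket A+B\rrbracket $ is the disjoint union with a new least element; $\llbracket \mathrm{rec}\,\alpha.A\rrbracket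 $ is the bilimit of the finite unrollings of the type (starting from the one-point dcpo, along the canonical embedding-projection pairs), with the canonical inverse isomorphisms $\mathrm{fold}$, $\mathrm{unfold}$. A pure judgement $x_1:A_1,\dots,x_n:A_n\vdash M:A$ denotes the usual Scott-continuous map $\llbracket M\rrbracket :\llbracket A_1\rrbracket \times\dots\times\llbracket A_n\rrbracket \to\llbracket A\rrbracket $, with $\llbracket \langle\rangle\rrbracket =\top$ and $\mathrm{fix}$ denoting the least fixpoint $\bigvee_n f^n(\bot)$. **Formulae.** Iteration terms are $t::=k\mid 0\mid t+1$ over iteration variables $k$. Formulae of pure type are: $\mathsf{True},\mathsf{False},\varphi\wedge\psi,\varphi\vee\psi$ of any type; $\langle\rangle$ of type $\mathbf 1$; $[\pi_i]\varphi$ of type $A_1\times A_2$ and $[\mathrm{in}_i]\varphi$ of type $A_1+A_2$ for $\varphi$ of type $A_i$; $[\mathrm{fold}]\varphi$ of type $\mathrm{rec}\,\alpha.A$ for $\varphi$ of type $A[\mathrm{rec}\,\alpha.A/\alpha]$; fixpoint variables $X$ and bounded iterations $(\mu^tX)\varphi$, $(\nu^tX)\varphi$ with $X,\varphi$ of the same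 type; $(\exists k)\varphi$, $(\forall k)\varphi$; and $\psi\multimap \varphi$ of type $B\to A$ for $\psi,\varphi$ of types $B,A$ without free fixpoint variable. Positivity ($\mathrm{Pos}$) and negativity ($\mathrm{Neg}$) of $k$ in a formula are defined mutually. A variable not free in $\varphi$ is both. Both are preserved by $\wedge,\vee$ and modalities. $k\,\mathrm{Pos}\,(\psi\multimap \varphi)$ if $k\,\mathrm{Neg}\,\psi$ and $k\,\mathrm{Pos}\,\varphi$, and dually. $k\,\mathrm{Pos}\,(\exists\ell)\varphi$ and $k\,\mathrm{Pos}\,(\mu^tX)\varphi$ if $k\,\mathrm{Pos}\,\varphi$; $k\,\mathrm{Pos}\,(\nu^tX)\varphi$ if moreover $k$ is not in $t$. $k\,\mathrm{Neg}\,(\forall\ell)\varphi$ and $k\,\mathrm{Neg}\,(\nu^tX)\varphi$ if $k\,\mathrm{Neg}\,\varphi$; $k\,\mathrm{Neg}\,(\mu^tX)\varphi$ if moreover $k$ is not in $t$. The languages $\mathcal L^{+},\mathcal L^{-},\mathcal L^{\pm}$ (positive, negative, neutral) are each closed under all the formers but quantifiers and $\multimap $; $(\exists k)\varphi\in\mathcal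 L^+$ if $\varphi\in\mathcal L^+$ and $k\,\mathrm{Pos}\,\varphi$; $(\forall k)\varphi\in\mathcal L^-$ if $\varphi\in\mathcal L^-$ and $k\,\mathrm{Neg}\,\varphi$; and $\psi\multimap \varphi\in\mathcal L^{\sigma}$ if $\psi\in\mathcal L^{-\sigma}$ and $\varphi\in\mathcal L^\sigma$, where $-$ exchanges $+$ and $-$ and fixes $\pm$. Only formulae in one of these languages are considered. $\mathcal L^\wedge$ consists of the formulae built from $\mathsf{True},\mathsf{False},\langle\rangle,\wedge,$ modalities and $\multimap $ only. **Meaning of formulae.** Under a valuation of iteration variables in $\mathbb N$ and of fixpoint variables by sets, a formula of type $A$ denotes a subset of $\llbracket A\rrbracket $: connectives and quantifiers (over $\mathbb N$) are Boolean, $\llbracket \langle\rangle\rrbracket =\{\top\}$, $[\pi_i]\varphi$ and $[\mathrm{fold}]\varphi$ are the inverse images of $\llbracket \varphi\rrbracket $ under $\pi_i$ and $\mathrm{unfold}$, $[\mathrm{in}_i]\varphi$ is the direct image under the $i$-th injection, $(\mu^tX)\varphi$ and $(\nu^tX)\varphi$ are the $\llbracket t\rrbracket $-th iterates of $S\mapsto\llbracket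 \varphi\rrbracket (S/X)$ from $\emptyset$ and from $\llbracket A\rrbracket $, and $\llbracket \psi\multimap \varphi\rrbracket =\{f\mid f(\llbracket \psi\rrbracket )\subseteq\llbracket \varphi\rrbracket \}$. **Deduction.** A sequent $\psi\vdash\varphi$ consists of two formulae of the same type in a common language among $\mathcal L^+,\mathcal L^-,\mathcal L^\pm$. Derivable sequents, and a consistency predicate $\mathsf C$ on closed formulae, are generated by the following rules (with all conclusions sequents; $\triangle$ is any modality). * Identity; cut; $\wedge,\mathsf{True},\vee,\mathsf{False}$ left and right rules with one formula on each side; $\psi\wedge(\varphi\vee\theta)\vdash(\psi\wedge\varphi)\vee(\psi\wedge\theta)$. * Modalities: $\psi\vdash\varphi$ implies $[\triangle]\psi\vdash[\triangle]\varphi$; $[\triangle]\varphi_1\wedge[\triangle]\varphi_2\vdash[\triangle](\varphi_1\wedge\varphi_2)$; $[\triangle](\varphi_1\vee\varphi_2)\vdash[\triangle]\varphi_1\vee[\triangle]\varphi_2$; $[\triangle]\mathsf{False}\vdash\mathsf{False}$; $\mathsf{True}\vdash[\triangle]\mathsf{True}$ if $\triangle$ is not an injection; $(\forall k)[\triangle]\varphi\vdash[\triangle](\forall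 k)\varphi$; $[\triangle](\exists k)\varphi\vdash(\exists k)[\triangle]\varphi$; $[\mathrm{in}_1]\varphi\wedge[\mathrm{in}_2]\psi\vdash\mathsf{False}$. * Quantifiers: $\psi\vdash\varphi[t/k]$ implies $\psi\vdash(\exists k)\varphi$; $\theta\wedge\varphi\vdash\psi$ implies $\theta\wedge(\exists k)\varphi\vdash\psi$ ($k$ not free in $\theta,\psi$); $\varphi[t/k]\vdash\psi$ implies $(\forall k)\varphi\vdash\psi$; $\psi\vdash\varphi\vee\theta$ implies $\psi\vdash(\forall k)\varphi\vee\theta$ ($k$ not free in $\psi,\theta$); $(\exists\ell)(\exists k)\varphi\vdash(\exists k)\varphi[k/\ell]$; $(\forall k)\varphi[k/\ell]\vdash(\forall\ell)(\forall k)\varphi$; for $\theta\in\{\mu,\nu\}$ and $k$ not in $t$, $(\theta^tX)(\exists k)\varphi\vdash(\exists k)(\theta^tX)\varphi$ and $(\forall k)(\theta^tX)\varphi\vdash(\theta^tX)(\forall k)\varphi$. * Iteration: $(\mu^0X)\varphi\vdash\mathsf{False}$; $\mathsf{True}\vdash(\nu^0X)\varphi$; $\varphi[(\mu^tX)\varphi/X]\vdash(\mu^{t+1}X)\varphi$;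 $(\nu^{t+1}X)\varphi\vdash\varphi[(\nu^tX)\varphi/X]$; $(\mu^tX)\varphi\vdash\psi$ implies $(\mu^{t+1}X)\varphi\vdash\varphi[\psi/X]$; $\psi\vdash(\nu^tX)\varphi$ implies $\varphi[\psi/X]\vdash(\nu^{t+1}X)\varphi$; $\psi\vdash\varphi$ implies $(\theta^tX)\psi\vdash(\theta^tX)\varphi$. * Implication: $\psi'\vdash\psi$ and $\varphi\vdash\varphi'$ imply $\psi\multimap \varphi\vdash\psi'\multimap \varphi'$; $((\forall k)\psi)\multimap \varphi\vdash(\exists k)(\psi\multimap \varphi)$ ($k$ not free in $\varphi$); $\psi\multimap (\exists k)\varphi\vdash(\exists k)(\psi\multimap \varphi)$ ($\psi\in\mathcal L^\pm$, $k$ not free in $\psi$); $(\forall k)(\psi\multimap \varphi)\vdash((\exists k)\psi)\multimap \varphi$ ($k$ not free in $\varphi$); $(\forall k)(\psi\multimap \varphi)\vdash\psi\multimap (\forall k)\varphi$ ($k$ not free in $\psi$); $(\psi\multimap \varphi_1)\wedge(\psi\multimap \varphi_2)\vdash\psi\multimap (\varphi_1\wedge\varphi_2)$; $\mathsf{True}\vdash\psi\multimap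 \mathsf{True}$; $(\psi_1\multimap \varphi)\wedge(\psi_2\multimap \varphi)\vdash(\psi_1\vee\psi_2)\multimap \varphi$; $\mathsf{True}\vdash\mathsf{False}\multimap \varphi$; and for $\delta\in\mathcal L^\wedge$, $\delta\multimap (\varphi_1\vee\varphi_2)\vdash(\delta\multimap \varphi_1)\vee(\delta\multimap \varphi_2)$, and $\delta\multimap \mathsf{False}\vdash\mathsf{False}$ if $\mathsf C(\delta)$. * Consistency: $\mathsf C(\mathsf{True})$; $\mathsf C(\langle\rangle)$; $\mathsf C(\varphi)$ implies $\mathsf C([\mathrm{fold}]\varphi)$ and $\mathsf C([\mathrm{in}_i]\varphi)$; $\mathsf C(\varphi),\mathsf C(\psi)$ imply $\mathsf C([\pi_1]\varphi\wedge[\pi_2]\psi)$; $\mathsf C(\psi)$ and $\psi\vdash\varphi\in\mathcal L^\wedge$ imply $\mathsf C(\varphi)$; and, for a finite set $I$, if $\mathsf C(\psi_i),\mathsf C(\varphi_i)$ for all $i\in I$, and for all $J\subseteq I$ either $\bigwedge_J\psi_j\vdash\mathsf{False}$ or $\mathsf C(\bigwedge_J\varphi_j)$, then $\mathsf C(\bigwedge_I(\psi_i\multimap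 \varphi_i))$. **Refinement types.** $T,U::=A\mid\{A\mid\varphi\}\mid T\times U\mid U\to T$, with $A$ a pure type and $\varphi$ a formula of type $A$ without free fixpoint variable; $|T|$ is the underlying pure type. For each valuation of iteration variables, $\llbracket A\rrbracket $ is the whole domain, $\llbracket \{A\mid\varphi\}\rrbracket =\llbracket \varphi\rrbracket $, $\llbracket T\times U\rrbracket $ is the cartesian product of sets, and $\llbracket U\to T\rrbracket =\{f\mid f(\llbracket U\rrbracket )\subseteq\llbracket T\rrbracket \}$. Contexts are $\Gamma=x_1:U_1,\dots,x_n:U_n$. Subtyping is the least reflexive and transitive relation, covariant in $\times$ and in the codomain of $\to$ and contravariant in its domain, such that $T\le|T|$; $A\le\{A\mid\mathsf{True}\}$; $\{A\mid\psi\}\le\{A\mid\varphi\}$ if $\psi\vdash\varphi$ is derivable; $\{A\times B\mid[\pi_1]\varphi\wedge[\pi_2]\psi\}$ and $\{A\mid\varphi\}\times\{B\mid\psi\}$ are subtypes of each other, as are $\{B\to A\mid\psi\multimap \varphi\}$ and $\{B\mid\psi\}\to\{A\mid\varphi\}$; and a pure type $A\times B$ (resp. $B\to A$) is a subtype of the product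 (resp. arrow) of the pure types $A,B$. Derivable judgements $\Gamma\vdash M:T$ are generated by the following rules. * The usual rules for variables, abstraction, application, pairs and projections, with arbitrary refinement types; for the other term formers, their rules in the pure system, with the types displayed in the rule pure but with $\Gamma$ arbitrary. * $\langle\rangle:\{\mathbf 1\mid\langle\rangle\}$. If $M_i:\{A_i\mid\varphi\}$ and $M_{3-i}:A_{3-i}$ then $\langle M_1,M_2\rangle:\{A_1\times A_2\mid[\pi_i]\varphi\}$. If $M:\{A_1\times A_2\mid[\pi_i]\varphi\}$ then $\pi_iM:\{A_i\mid\varphi\}$. If $M$ has type $\{A[\mathrm{rec}\,\alpha.A/\alpha]\mid\varphi\}$ then $\mathrm{fold}\,M:\{\mathrm{rec}\,\alpha.A\mid[\mathrm{fold}]\varphi\}$, and conversely for $\mathrm{unfold}$. If $M:\{A_i\mid\varphi\}$ then $\mathrm{in}_iM:\{A_1+A_2\mid[\mathrm{in}_i]\varphi\}$. * If $\Gamma\vdash M:\{A_1+A_2\mid[\mathrm{in}_i]\varphi\}$, $\Gamma,x:\{A_i\mid\varphi\}\vdash N_i:T$, and $|\Gamma|,x:A_{3-i}\vdash N_{3-i}:|T|$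 in the pure system, then $\Gamma\vdash\mathrm{case}\ M\ \{\mathrm{in}_1x\mapsto N_1\mid\mathrm{in}_2x\mapsto N_2\}:T$. * If $\Gamma\vdash\mathrm{fix}\,x.M:\{A\mid\psi\}$ and $\Gamma,x:\{A\mid\psi\}\vdash M:\{A\mid\varphi\}$ then $\Gamma\vdash\mathrm{fix}\,x.M:\{A\mid\varphi\}$. * If $M:\{A\mid\varphi\}$ and $M:\{A\mid\psi\}$ then $M:\{A\mid\varphi\wedge\psi\}$. If $\Gamma,x:\{B\mid\psi_j\},\Delta\vdash M:T$ for $j=1,2$ then $\Gamma,x:\{B\mid\psi_1\vee\psi_2\},\Delta\vdash M:T$. If $|\Gamma|,x:B,|\Delta|\vdash M:|T|$ in the pure system then $\Gamma,x:\{B\mid\mathsf{False}\},\Delta\vdash M:T$. * If $\Gamma\vdash M:T$, $T\le T'$ and $\Gamma'\le\Gamma$ pointwise, then $\Gamma'\vdash M:T'$. **Theorem (Soundness of Typing).** Every derivable refinement typing judgement $x_1:U_1,\dots,x_n:U_n\vdash M:T$ is sound. That is, the pure judgement $x_1:|U_1|,\dots,x_n:|U_n|\vdash M:|T|$ is derivable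 and, for every valuation of the free iteration variables in $\mathbb N$ and all $u_1\in\llbracket U_1\rrbracket ,\dots,u_n\in\llbracket U_n\rrbracket $, one has $\llbracket M\rrbracket (u_1,\dots,u_n)\in\llbracket T\rrbracket $. Here $\llbracket M\rrbracket $ may be computed from any derivation of the pure judgement. -/

import Mathlib

namespace FPC

noncomputable section

/-! ### Cpos and Scott-continuous functions -/

/-- A cpo: a partial order with a least element and suprema of directed sets. -/
structure Cpo where
  carrier : Type
  [str : CompletePartialOrder carrier]

instance : CoeSort Cpo Type := ⟨Cpo.carrier⟩

instance (X : Cpo) : CompletePartialOrder X := X.str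

/-- A partial order with a least element in which non-empty directed sets have suprema is a cpo. -/
def Cpo.ofLUB (α : Type) [PartialOrder α] [OrderBot α]
    (h : ∀ d : Set α, d.Nonempty → DirectedOn (· ≤ ·) d → ∃ a, IsLUB d a) : Cpo where
  carrier := α
  str :=
    { sSup := fun d => @dite _ (∃ a, IsLUB d a) (Classical.dec _) (fun h => h.choose) (fun _ => ⊥)
      lubOfDirected := by
        intro d hd
        have hex : ∃ a, IsLUB d a := by
          rcases d.eq_empty_or_nonempty with rfl | hne
          · exact ⟨⊥, by simp⟩
          · exact h d hne hd
        change IsLUB d (@dite _ (∃ a, IsLUB d a) (Classical.dec _) _ _)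
        rw [dif_pos hex]
        exact hex.choose_spec }

/-- Scott-continuous functions. -/
@[ext]
structure Hom (X Y : Cpo) where
  toFun : X → Y
  cont : ScottContinuous toFun

instance (X Y : Cpo) : CoeFun (Hom X Y) (fun _ => X → Y) := ⟨Hom.toFun⟩

theorem Hom.mono {X Y : Cpo} (f : Hom X Y) : Monotone f := f.cont.monotone

/-- The pointwise order. -/
instance (X Y : Cpo) : PartialOrder (Hom X Y) :=
  PartialOrder.lift Hom.toFun (fun _ _ h => Hom.ext h)

instance (X Y : Cpo) : OrderBot (Hom X Y) where
  bot := ⟨fun _ => ⊥, ScottContinuous.const _⟩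
  bot_le _ := fun _ => bot_le

theorem scottContinuous_of_isLUB {X Y : Cpo} {ι : Sort*} (F : ι → X → Y)
    (hF : ∀ i, ScottContinuous (F i)) (g : X → Y)
    (hg : ∀ x, IsLUB (Set.range fun i => F i x) (g x)) : ScottContinuous g := by
  have hmono : Monotone g := by
    intro x y hxy
    refine (hg x).2 ?_
    rintro _ ⟨i, rfl⟩
    exact ((hF i).monotone hxy).trans ((hg y).1 ⟨i, rfl⟩)
  intro d hne hd a ha
  refine ⟨?_, ?_⟩
  · rintro _ ⟨x, hx, rfl⟩
    exact hmono (ha.1 hx)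
  · intro b hb
    refine (hg a).2 ?_
    rintro _ ⟨i, rfl⟩
    refine ((hF i) hne hd ha).2 ?_
    rintro _ ⟨x, hx, rfl⟩
    exact ((hg x).1 ⟨i, rfl⟩).trans (hb ⟨x, hx, rfl⟩)

/-- A function of two arguments that is Scott-continuous in each of them is Scott-continuous. -/
theorem scottContinuous_prod {X Y Z : Cpo} (f : X → Y → Z)
    (h₁ : ∀ y, ScottContinuous (fun x => f x y)) (h₂ : ∀ x, ScottContinuous (f x)) :
    ScottContinuous (fun z : X × Y => f z.1 z.2) := by
  have hmono : Monotone (fun z : X × Y => f z.1 z.2) := fun a b hab =>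
    ((h₁ a.2).monotone hab.1).trans ((h₂ b.1).monotone hab.2)
  intro d hne hd a ha
  rw [isLUB_prod] at ha
  refine ⟨?_, ?_⟩
  · rintro _ ⟨z, hz, rfl⟩
    exact hmono (Prod.le_def.2 ⟨ha.1.1 ⟨z, hz, rfl⟩, ha.2.1 ⟨z, hz, rfl⟩⟩)
  · intro b hb
    have hd₁ : DirectedOn (· ≤ ·) (Prod.fst '' d) := hd.fst
    have hd₂ : DirectedOn (· ≤ ·) (Prod.snd '' d) := hd.snd
    refine (h₁ a.2 (hne.image _) hd₁ ha.1).2 ?_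
    rintro _ ⟨_, ⟨z, hz, rfl⟩, rfl⟩
    refine (h₂ z.1 (hne.image _) hd₂ ha.2).2 ?_
    rintro _ ⟨_, ⟨w, hw, rfl⟩, rfl⟩
    obtain ⟨v, hv, hzv, hwv⟩ := hd z hz w hw
    exact (hmono (show (z.1, w.2) ≤ v from Prod.le_def.2 ⟨hzv.1, hwv.2⟩)).trans (hb ⟨v, hv, rfl⟩)

/-! ### Constructions on cpos -/

namespace Cpo

/-- The one-point cpo. -/
def one : Cpo := ⟨PUnit⟩

/-- The cpo `{⊥, ⊤}`. -/
def two : Cpo := ⟨Bool⟩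

/-- The Cartesian product with the componentwise order. -/
def prod (X Y : Cpo) : Cpo :=
  ofLUB (X × Y) (by
    intro d _ hd
    exact ⟨(sSup (Prod.fst '' d), sSup (Prod.snd '' d)),
      isLUB_prod.2 ⟨hd.fst.isLUB_sSup, hd.snd.isLUB_sSup⟩⟩)

/-- Directed suprema of Scott-continuous functions are computed pointwise. -/
theorem hom_lub {X Y : Cpo} (d : Set (Hom X Y)) (hd : DirectedOn (· ≤ ·) d) :
    ∃ a : Hom X Y, IsLUB d a ∧ ∀ x, IsLUB ((fun f : Hom X Y => f x) '' d) (a x) := by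
  have hdir : ∀ x : X, DirectedOn (· ≤ ·) ((fun f : Hom X Y => f x) '' d) := by
    rintro x _ ⟨f, hf, rfl⟩ _ ⟨g, hg, rfl⟩
    obtain ⟨k, hk, hfk, hgk⟩ := hd f hf g hg
    exact ⟨k x, ⟨k, hk, rfl⟩, hfk x, hgk x⟩
  have hlub := fun x => (hdir x).isLUB_sSup
  refine ⟨⟨fun x => sSup ((fun f : Hom X Y => f x) '' d), ?_⟩, ⟨?_, ?_⟩, hlub⟩
  · refine scottContinuous_of_isLUB (fun (f : d) => f.1.toFun) (fun f => f.1.cont) _ ?_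
    intro x
    have e : Set.range (fun f : d => f.1.toFun x) = (fun f : Hom X Y => f x) '' d := by
      ext
      simp
    rw [e]
    exact hlub x
  · intro f hf x
    exact (hlub x).1 ⟨f, hf, rfl⟩
  · intro g hg x
    refine (hlub x).2 ?_
    rintro _ ⟨f, hf, rfl⟩
    exact hg hf x

/-- The Scott-continuous functions with the pointwise order. -/
def exp (X Y : Cpo) : Cpo :=
  ofLUB (Hom X Y) (fun d _ hd => (hom_lub d hd).imp fun _ h => h.1)

/-- Directed sets that meet the image of an upward-closed order embedding. -/
theorem lub_of_embedding {X : Cpo} {Z : Type} [PartialOrder Z] (j : X → Z)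
    (hj : ∀ x y, j x ≤ j y ↔ x ≤ y) (hup : ∀ x z, j x ≤ z → ∃ y, z = j y)
    (d : Set Z) (hd : DirectedOn (· ≤ ·) d) (hx : ∃ x, j x ∈ d) :
    DirectedOn (· ≤ ·) {x | j x ∈ d} ∧ (∀ z ∈ d, ∃ y, j y ∈ d ∧ z ≤ j y) ∧
      IsLUB d (j (sSup {x | j x ∈ d})) := by
  obtain ⟨x₀, hx₀⟩ := hx
  have hs : DirectedOn (· ≤ ·) {x | j x ∈ d} := by
    intro x hx y hy
    obtain ⟨w, hw, h₁, h₂⟩ := hd _ hx _ hy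
    obtain ⟨v, rfl⟩ := hup _ _ h₁
    exact ⟨v, hw, (hj _ _).1 h₁, (hj _ _).1 h₂⟩
  have hcof : ∀ z ∈ d, ∃ y, j y ∈ d ∧ z ≤ j y := by
    intro z hz
    obtain ⟨w, hw, h₁, h₂⟩ := hd _ hz _ hx₀
    obtain ⟨v, rfl⟩ := hup _ _ h₂
    exact ⟨v, hw, h₁⟩
  refine ⟨hs, hcof, ?_, ?_⟩
  · intro z hz
    obtain ⟨y, hy, hzy⟩ := hcof z hz
    exact hzy.trans ((hj _ _).2 (hs.le_sSup hy))
  · intro b hb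
    obtain ⟨c, rfl⟩ := hup _ _ (hb hx₀)
    exact (hj _ _).2 (hs.sSup_le fun v hv => (hj _ _).1 (hb hv))

/-- The disjoint union of two cpos with a new least element. -/
abbrev WSum (X Y : Cpo) : Type := WithBot (X ⊕ Y)

/-- The two coprojections. -/
def WSum.inl {X Y : Cpo} (x : X) : WSum X Y := ((Sum.inl x : X ⊕ Y) : WithBot (X ⊕ Y))
def WSum.inr {X Y : Cpo} (y : Y) : WSum X Y := ((Sum.inr y : X ⊕ Y) : WithBot (X ⊕ Y))

theorem WSum.cases {X Y : Cpo} (z : WSum X Y) :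
    z = ⊥ ∨ (∃ x, z = WSum.inl x) ∨ ∃ y, z = WSum.inr y := by
  induction z using WithBot.recBotCoe with
  | bot => exact Or.inl rfl
  | coe z =>
    rcases z with x | y
    · exact Or.inr (Or.inl ⟨x, rfl⟩)
    · exact Or.inr (Or.inr ⟨y, rfl⟩)

theorem WSum.inl_le {X Y : Cpo} (x x' : X) :
    (WSum.inl x : WSum X Y) ≤ WSum.inl x' ↔ x ≤ x' := by simp [WSum.inl]

theorem WSum.inr_le {X Y : Cpo} (y y' : Y) :
    (WSum.inr y : WSum X Y) ≤ WSum.inr y' ↔ y ≤ y' := by simp [WSum.inr]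

theorem WSum.inl_up {X Y : Cpo} (x : X) (z : WSum X Y) (h : WSum.inl x ≤ z) :
    ∃ y, z = WSum.inl y := by
  rcases WSum.cases z with rfl | h' | ⟨y, rfl⟩
  · simp [WSum.inl] at h
  · exact h'
  · simp [WSum.inl, WSum.inr] at h

theorem WSum.inr_up {X Y : Cpo} (y : Y) (z : WSum X Y) (h : WSum.inr y ≤ z) :
    ∃ y, z = WSum.inr y := by
  rcases WSum.cases z with rfl | ⟨x, rfl⟩ | h'
  · simp [WSum.inr] at h
  · simp [WSum.inl, WSum.inr] at h
  · exact h'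

theorem WSum.trichotomy {X Y : Cpo} (d : Set (WSum X Y)) :
    (∃ x, WSum.inl x ∈ d) ∨ (∃ y, WSum.inr y ∈ d) ∨ ∀ z ∈ d, z = ⊥ := by
  by_contra! h
  obtain ⟨h₁, h₂, z, hz, hne⟩ := h
  rcases WSum.cases z with rfl | ⟨x, rfl⟩ | ⟨y, rfl⟩
  · exact hne rfl
  · exact h₁ x hz
  · exact h₂ y hz

/-- The weak coproduct: the disjoint union with a new least element. -/
def sum (X Y : Cpo) : Cpo :=
  ofLUB (WSum X Y) (by
    intro d _ hd
    rcases WSum.trichotomy d with h | h | h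
    · exact ⟨_, (lub_of_embedding WSum.inl WSum.inl_le WSum.inl_up d hd h).2.2⟩
    · exact ⟨_, (lub_of_embedding WSum.inr WSum.inr_le WSum.inr_up d hd h).2.2⟩
    · exact ⟨⊥, fun z hz => (h z hz).le, fun _ _ => bot_le⟩)

end Cpo

namespace Hom

variable {X Y Z W : Cpo}

def id (X : Cpo) : Hom X X := ⟨fun x => x, ScottContinuous.id⟩

def comp (g : Hom Y Z) (f : Hom X Y) : Hom X Z := ⟨fun x => g (f x), f.cont.comp g.cont⟩

def const (X : Cpo) (y : Y) : Hom X Y := ⟨fun _ => y, ScottContinuous.const _⟩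

def fst : Hom (Cpo.prod X Y) X := ⟨fun z => z.1, ScottContinuous.fst (α := X) (β := Y)⟩

def snd : Hom (Cpo.prod X Y) Y := ⟨fun z => z.2, ScottContinuous.snd (α := X) (β := Y)⟩

def pair (f : Hom Z X) (g : Hom Z Y) : Hom Z (Cpo.prod X Y) :=
  ⟨fun z => (f z, g z), ScottContinuous.prodMk f.cont g.cont⟩

/-- The map from a separately continuous function of two arguments. -/
def ofProd (f : X → Y → Z) (h₁ : ∀ y, ScottContinuous (fun x => f x y))
    (h₂ : ∀ x, ScottContinuous (f x)) : Hom (Cpo.prod X Y) Z :=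
  ⟨fun z => f z.1 z.2, scottContinuous_prod f h₁ h₂⟩

theorem pair_cont_left (y : Y) : ScottContinuous (fun x : X => ((x, y) : Cpo.prod X Y)) :=
  (pair (id X) (const X y)).cont

theorem pair_cont_right (x : X) : ScottContinuous (fun y : Y => ((x, y) : Cpo.prod X Y)) :=
  (pair (const Y x) (id Y)).cont

theorem isLUB_apply {s : Set (Hom X Y)} {g : Hom X Y} (hd : DirectedOn (· ≤ ·) s)
    (h : IsLUB s g) (x : X) : IsLUB ((fun f : Hom X Y => f x) '' s) (g x) := by
  obtain ⟨a, ha, hx⟩ := Cpo.hom_lub s hd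
  rw [h.unique ha]
  exact hx x

/-- Evaluation. -/
def ev : Hom (Cpo.prod (Cpo.exp X Y) X) Y :=
  ofProd (X := Cpo.exp X Y) (fun (f : Hom X Y) x => f x)
    (fun x _ _ hd _ ha => isLUB_apply hd ha x) (fun f => f.cont)

def curry (f : Hom (Cpo.prod X Y) Z) : Hom X (Cpo.exp Y Z) where
  toFun x := (⟨fun y => f (x, y), (pair_cont_right x).comp f.cont⟩ : Hom Y Z)
  cont := by
    intro d hne hd a ha
    have h := fun y => ((pair_cont_left y).comp f.cont) hne hd ha
    refine ⟨?_, ?_⟩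
    · rintro _ ⟨x, hx, rfl⟩ y
      exact (h y).1 ⟨x, hx, rfl⟩
    · intro b hb y
      refine (h y).2 ?_
      rintro _ ⟨x, hx, rfl⟩
      exact hb ⟨x, hx, rfl⟩ y

/-- The least fixpoint combinator `f ↦ ⨆ n, fⁿ(⊥)`. -/
def fix (X : Cpo) : Hom (Cpo.exp X X) X where
  toFun (f : Hom X X) := ⨆ n : ℕ, f.toFun^[n] ⊥
  cont := by
    refine scottContinuous_of_isLUB (X := Cpo.exp X X)
      (fun (n : ℕ) (f : Hom X X) => f.toFun^[n] ⊥) ?_ _ ?_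
    · intro n
      induction n with
      | zero => exact ScottContinuous.const _
      | succ n ih =>
        have := (ev.comp (pair (Hom.id (Cpo.exp X X)) ⟨_, ih⟩)).cont
        simp only [Function.iterate_succ_apply']
        exact this
    · intro f
      have hm : Monotone fun n : ℕ => f.toFun^[n] ⊥ :=
        Monotone.monotone_iterate_of_le_map (Hom.mono f) bot_le
      exact hm.directed_le.directedOn_range.isLUB_sSup

def inl : Hom X (Cpo.sum X Y) where
  toFun x := Cpo.WSum.inl x
  cont := by
    intro d hne hd a ha
    refine ⟨?_, ?_⟩
    · rintro _ ⟨x, hx, rfl⟩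
      exact (Cpo.WSum.inl_le _ _).2 (ha.1 hx)
    · intro b hb
      obtain ⟨x, hx⟩ := hne
      obtain ⟨c, rfl⟩ := Cpo.WSum.inl_up x b (hb ⟨x, hx, rfl⟩)
      exact (Cpo.WSum.inl_le _ _).2 (ha.2 fun y hy => (Cpo.WSum.inl_le _ _).1 (hb ⟨y, hy, rfl⟩))

def inr : Hom Y (Cpo.sum X Y) where
  toFun x := Cpo.WSum.inr x
  cont := by
    intro d hne hd a ha
    refine ⟨?_, ?_⟩
    · rintro _ ⟨x, hx, rfl⟩
      exact (Cpo.WSum.inr_le _ _).2 (ha.1 hx)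
    · intro b hb
      obtain ⟨x, hx⟩ := hne
      obtain ⟨c, rfl⟩ := Cpo.WSum.inr_up x b (hb ⟨x, hx, rfl⟩)
      exact (Cpo.WSum.inr_le _ _).2 (ha.2 fun y hy => (Cpo.WSum.inr_le _ _).1 (hb ⟨y, hy, rfl⟩))

/-- The function underlying `[f, g] : X + Y → Z`, which maps `⊥` to `⊥`. -/
def copairFun (f : X → Z) (g : Y → Z) : Cpo.WSum X Y → Z
  | none => ⊥
  | some (.inl x) => f x
  | some (.inr y) => g y

theorem copairFun_mono (f : Hom X Z) (g : Hom Y Z) : Monotone (copairFun f g) := by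
  intro a b hab
  rcases Cpo.WSum.cases a with rfl | ⟨x, rfl⟩ | ⟨y, rfl⟩
  · exact bot_le
  · obtain ⟨x', rfl⟩ := Cpo.WSum.inl_up _ _ hab
    exact f.mono ((Cpo.WSum.inl_le _ _).1 hab)
  · obtain ⟨y', rfl⟩ := Cpo.WSum.inr_up _ _ hab
    exact g.mono ((Cpo.WSum.inr_le _ _).1 hab)

theorem copairFun_cont (f : Hom X Z) (g : Hom Y Z) :
    ScottContinuous (copairFun f g) := by
  have hm := copairFun_mono f g
  intro d hne hd a ha
  refine ⟨?_, ?_⟩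
  · rintro _ ⟨z, hz, rfl⟩
    exact hm (ha.1 hz)
  · intro b hb
    rcases Cpo.WSum.trichotomy d with h | h | h
    · obtain ⟨hs, -, hl⟩ := Cpo.lub_of_embedding _ Cpo.WSum.inl_le Cpo.WSum.inl_up d hd h
      rw [ha.unique hl]
      refine (f.cont (d := {x | Cpo.WSum.inl x ∈ d}) h hs hs.isLUB_sSup).2 ?_
      rintro _ ⟨x, hx, rfl⟩
      exact hb ⟨_, hx, rfl⟩
    · obtain ⟨hs, -, hl⟩ := Cpo.lub_of_embedding _ Cpo.WSum.inr_le Cpo.WSum.inr_up d hd h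
      rw [ha.unique hl]
      refine (g.cont (d := {x | Cpo.WSum.inr x ∈ d}) h hs hs.isLUB_sSup).2 ?_
      rintro _ ⟨x, hx, rfl⟩
      exact hb ⟨_, hx, rfl⟩
    · have : a = ⊥ := le_bot_iff.1 (ha.2 fun z hz => (h z hz).le)
      rw [this]
      exact bot_le

def copair (f : Hom X Z) (g : Hom Y Z) : Hom (Cpo.sum X Y) Z :=
  ⟨copairFun f g, copairFun_cont f g⟩

/-- Case analysis in a context `W`. -/
def case (m : Hom W (Cpo.sum X Y)) (f : Hom (Cpo.prod W X) Z) (g : Hom (Cpo.prod W Y) Z) :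
    Hom W Z where
  toFun w := copair (curry f w) (curry g w) (m w)
  cont := by
    have h : ScottContinuous (fun z : Cpo.prod W (Cpo.sum X Y) =>
        copair (curry f z.1) (curry g z.1) z.2) := by
      refine scottContinuous_prod (Y := Cpo.sum X Y)
        (fun w z => copair (curry f w) (curry g w) z) ?_ (fun w => (copair _ _).cont)
      intro z
      rcases Cpo.WSum.cases z with rfl | ⟨x, rfl⟩ | ⟨y, rfl⟩
      · exact ScottContinuous.const _
      · exact (pair_cont_left x).comp f.cont
      · exact (pair_cont_left y).comp g.cont
    exact (pair (id W) m).cont.comp h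

end Hom

/-! ### Embedding-projection pairs and bilimits -/

/-- Embedding-projection pairs. -/
structure EP (X Y : Cpo) where
  e : Hom X Y
  p : Hom Y X
  p_e : ∀ x, p (e x) = x
  e_p : ∀ y, e (p y) ≤ y

namespace EP

variable {X Y Z X' Y' : Cpo}

theorem e_bot (c : EP X Y) : c.e ⊥ = ⊥ :=
  le_bot_iff.1 ((c.e.mono bot_le).trans (c.e_p ⊥))

theorem p_bot (c : EP X Y) : c.p ⊥ = ⊥ :=
  le_bot_iff.1 ((c.p.mono bot_le).trans (c.p_e ⊥).le)

def id (X : Cpo) : EP X X := ⟨Hom.id X, Hom.id X, fun _ => rfl, fun _ => le_rfl⟩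

def comp (d : EP Y Z) (c : EP X Y) : EP X Z where
  e := d.e.comp c.e
  p := c.p.comp d.p
  p_e x := (congrArg c.p (d.p_e (c.e x))).trans (c.p_e x)
  e_p z := (d.e.mono (c.e_p (d.p z))).trans (d.e_p z)

/-- The one-point cpo embeds in every cpo. -/
def init (X : Cpo) : EP Cpo.one X :=
  ⟨Hom.const _ ⊥, Hom.const _ PUnit.unit, fun _ => rfl, fun _ => bot_le⟩

def prod (c : EP X Y) (c' : EP X' Y') : EP (Cpo.prod X X') (Cpo.prod Y Y') where
  e := Hom.pair (c.e.comp Hom.fst) (c'.e.comp Hom.snd)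
  p := Hom.pair (c.p.comp Hom.fst) (c'.p.comp Hom.snd)
  p_e x := Prod.ext (c.p_e x.1) (c'.p_e x.2)
  e_p y := ⟨c.e_p y.1, c'.e_p y.2⟩

/-- `f ↦ b ∘ f ∘ a`. -/
def expMap (a : Hom X' X) (b : Hom Y Y') : Hom (Cpo.exp X Y) (Cpo.exp X' Y') :=
  Hom.curry (b.comp (Hom.ev.comp (Hom.pair Hom.fst (a.comp Hom.snd))))

def exp (c : EP X Y) (c' : EP X' Y') : EP (Cpo.exp X X') (Cpo.exp Y Y') where
  e := expMap c.p c'.e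
  p := expMap c.e c'.p
  p_e f := Hom.ext (funext fun x =>
    (c'.p_e _).trans (congrArg (Hom.toFun f) (c.p_e x)))
  e_p f := fun y => (c'.e_p _).trans (Hom.mono f (c.e_p y))

/-- `f + g = [inl ∘ f, inr ∘ g]`. -/
def sumMap (f : Hom X Y) (g : Hom X' Y') : Hom (Cpo.sum X X') (Cpo.sum Y Y') :=
  Hom.copair (Hom.inl.comp f) (Hom.inr.comp g)

def sum (c : EP X Y) (c' : EP X' Y') : EP (Cpo.sum X X') (Cpo.sum Y Y') where
  e := sumMap c.e c'.e
  p := sumMap c.p c'.p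
  p_e x := by
    rcases Cpo.WSum.cases x with rfl | ⟨x, rfl⟩ | ⟨x, rfl⟩
    · rfl
    · exact congrArg Cpo.WSum.inl (c.p_e x)
    · exact congrArg Cpo.WSum.inr (c'.p_e x)
  e_p y := by
    rcases Cpo.WSum.cases y with rfl | ⟨x, rfl⟩ | ⟨x, rfl⟩
    · exact le_rfl
    · exact (Cpo.WSum.inl_le _ _).2 (c.e_p x)
    · exact (Cpo.WSum.inr_le _ _).2 (c'.e_p x)

end EP

/-- An `ω`-chain of embedding-projection pairs. -/
structure Chain where
  obj : ℕ → Cpo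
  ep : ∀ n, EP (obj n) (obj (n + 1))

namespace Chain

def shift (C : Chain) : Chain := ⟨fun n => C.obj (n + 1), fun n => C.ep (n + 1)⟩

/-- The coherent sequences, ordered pointwise. -/
abbrev Seq (C : Chain) : Type := {x : ∀ n, C.obj n // ∀ n, (C.ep n).p (x (n + 1)) = x n}

instance (C : Chain) : OrderBot C.Seq where
  bot := ⟨fun _ => ⊥, fun n => (C.ep n).p_bot⟩
  bot_le _ := fun _ => bot_le

theorem seq_lub (C : Chain) (d : Set C.Seq) (hne : d.Nonempty) (hd : DirectedOn (· ≤ ·) d) :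
    ∃ a : C.Seq, IsLUB d a ∧ ∀ n, IsLUB ((fun x : C.Seq => x.1 n) '' d) (a.1 n) := by
  have hdir : ∀ n, DirectedOn (· ≤ ·) ((fun x : C.Seq => x.1 n) '' d) := by
    rintro n _ ⟨f, hf, rfl⟩ _ ⟨g, hg, rfl⟩
    obtain ⟨k, hk, hfk, hgk⟩ := hd f hf g hg
    exact ⟨k.1 n, ⟨k, hk, rfl⟩, hfk n, hgk n⟩
  have hlub := fun n => (hdir n).isLUB_sSup
  refine ⟨⟨fun n => sSup ((fun x : C.Seq => x.1 n) '' d), fun n => ?_⟩, ⟨?_, ?_⟩, hlub⟩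
  · have h := (C.ep n).p.cont (hne.image _) (hdir (n + 1)) (hlub (n + 1))
    refine h.unique ?_
    have e : (C.ep n).p.toFun '' ((fun x : C.Seq => x.1 (n + 1)) '' d) =
        (fun x : C.Seq => x.1 n) '' d := by
      rw [Set.image_image]
      exact Set.image_congr fun x _ => x.2 n
    rw [e]
    exact hlub n
  · intro x hx n
    exact (hlub n).1 ⟨x, hx, rfl⟩
  · intro y hy n
    refine (hlub n).2 ?_
    rintro _ ⟨x, hx, rfl⟩
    exact hy hx n

/-- The limit of the projections of the chain, which is also the colimit of its embeddings. -/
def lim (C : Chain) : Cpo :=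
  Cpo.ofLUB C.Seq (fun d hne hd => (C.seq_lub d hne hd).imp fun _ h => h.1)

variable (C : Chain)

theorem isLUB_apply {s : Set C.Seq} {a : C.Seq} (hne : s.Nonempty)
    (hd : DirectedOn (· ≤ ·) s) (h : IsLUB s a) (n : ℕ) :
    IsLUB ((fun x : C.Seq => x.1 n) '' s) (a.1 n) := by
  obtain ⟨b, hb, hn⟩ := C.seq_lub s hne hd
  rw [h.unique hb]
  exact hn n

def proj (n : ℕ) : Hom C.lim (C.obj n) where
  toFun x := Subtype.val x n
  cont := fun _ hne hd _ ha => C.isLUB_apply hne hd ha n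

theorem proj_coh (n : ℕ) (x : C.lim) : (C.ep n).p (C.proj (n + 1) x) = C.proj n x :=
  Subtype.property x n

/-- Maps into the limit. -/
def lift {X : Cpo} (f : ∀ n, Hom X (C.obj n)) (hf : ∀ n x, (C.ep n).p (f (n + 1) x) = f n x) :
    Hom X C.lim where
  toFun x := (⟨fun n => f n x, fun n => hf n x⟩ : C.Seq)
  cont := by
    intro d hne hd a ha
    refine ⟨?_, ?_⟩
    · rintro _ ⟨x, hx, rfl⟩ n
      exact (f n).mono (ha.1 hx)
    · intro b hb n
      refine ((f n).cont hne hd ha).2 ?_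
      rintro _ ⟨x, hx, rfl⟩
      exact hb ⟨x, hx, rfl⟩ n

/-- The embeddings `C 0 → C m`. -/
def emb0 : ∀ m, Hom (C.obj 0) (C.obj m)
  | 0 => Hom.id _
  | m + 1 => (C.ep m).e.comp (emb0 m)

/-- The `n`-th component of the limiting cone, with its embedding. -/
def cone : ∀ (n : ℕ) (C : Chain), EP (C.obj n) C.lim
  | 0, C =>
    { e := C.lift C.emb0 (fun n x => (C.ep n).p_e _)
      p := C.proj 0
      p_e := fun _ => rfl
      e_p := fun y m => by
        induction m with
        | zero => exact le_rfl
        | succ m ih =>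
          refine ((C.ep m).e.mono ih).trans ?_
          exact (congrArg (C.ep m).e (C.proj_coh m y)).ge.trans ((C.ep m).e_p _) }
  | n + 1, C =>
    EP.comp
      { e := C.lift (fun m => Nat.casesOn m ((C.ep 0).p.comp (C.shift.proj 0))
            (fun m => C.shift.proj m))
          (fun m x => by
            cases m with
            | zero => rfl
            | succ m => exact C.shift.proj_coh m x)
        p := C.shift.lift (fun m => C.proj (m + 1)) (fun m x => C.proj_coh (m + 1) x)
        p_e := fun _ => rfl
        e_p := fun y m => by
          cases m with
          | zero => exact (C.proj_coh 0 y).le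
          | succ m => exact le_rfl }
      (cone n C.shift)

theorem cone_p (n : ℕ) (C : Chain) (x : C.lim) : (cone n C).p x = C.proj n x := by
  induction n generalizing C with
  | zero => rfl
  | succ n ih => exact ih C.shift _

theorem cone_comm_e (n : ℕ) (C : Chain) (x : C.obj n) :
    (cone (n + 1) C).e ((C.ep n).e x) = (cone n C).e x := by
  induction n generalizing C with
  | zero =>
    refine Subtype.ext (funext fun m => ?_)
    cases m with
    | zero => exact (C.ep 0).p_e x
    | succ m =>
      change C.shift.emb0 m ((C.ep 0).e x) = C.emb0 (m + 1) x
      induction m with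
      | zero => rfl
      | succ m ih => exact congrArg (C.ep (m + 1)).e ih
  | succ n ih =>
    have h := ih C.shift x
    exact congrArg (Hom.toFun (C.lift (fun m => Nat.casesOn m ((C.ep 0).p.comp (C.shift.proj 0))
            (fun m => C.shift.proj m)) _)) h

/-- Commuting families of embedding-projection pairs out of a chain. -/
structure Cocone (C : Chain) (X : Cpo) where
  ep : ∀ n, EP (C.obj n) X
  comm_e : ∀ n x, (ep (n + 1)).e ((C.ep n).e x) = (ep n).e x
  comm_p : ∀ n y, (C.ep n).p ((ep (n + 1)).p y) = (ep n).p y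

/-- The cocone with vertex the limit. -/
def limCocone (C : Chain) : C.Cocone C.lim where
  ep n := cone n C
  comm_e n x := cone_comm_e n C x
  comm_p n y := by
    rw [cone_p, cone_p]
    exact C.proj_coh n y

variable {C} {X Y : Cpo}

theorem Cocone.mono (c : C.Cocone X) (c' : C.Cocone Y) (x : X) :
    Monotone fun n => (c'.ep n).e ((c.ep n).p x) := by
  refine monotone_nat_of_le_succ fun n => ?_
  rw [← c.comm_p n x, ← c'.comm_e n]
  exact (c'.ep (n + 1)).e.mono ((C.ep n).e_p _)

/-- The canonical map `x ↦ ⨆ n, e'ₙ(pₙ(x))` between the vertices of two cocones. -/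
def Cocone.map (c : C.Cocone X) (c' : C.Cocone Y) : Hom X Y where
  toFun x := ⨆ n, (c'.ep n).e ((c.ep n).p x)
  cont := scottContinuous_of_isLUB (fun n => ((c'.ep n).e.comp (c.ep n).p).toFun)
    (fun _ => Hom.cont _) _
    (fun x => (Cocone.mono c c' x).directed_le.directedOn_range.isLUB_sSup)

end Chain

/-! ### Pure types -/

/-- Type expressions with `n` free type variables (de Bruijn indices); `mu A` is the recursive type
which binds variable `0` of `A`. -/
inductive Ty : ℕ → Type
  | var {n : ℕ} (i : Fin n) : Ty n
  | unit {n : ℕ} : Ty n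
  | prod {n : ℕ} (A B : Ty n) : Ty n
  | arrow {n : ℕ} (A B : Ty n) : Ty n
  | sum {n : ℕ} (A B : Ty n) : Ty n
  | mu {n : ℕ} (A : Ty (n + 1)) : Ty n

namespace Ty

def ren : {n m : ℕ} → (Fin n → Fin m) → Ty n → Ty m
  | _, _, ρ, var i => var (ρ i)
  | _, _, _, unit => unit
  | _, _, ρ, prod A B => prod (A.ren ρ) (B.ren ρ)
  | _, _, ρ, arrow A B => arrow (A.ren ρ) (B.ren ρ)
  | _, _, ρ, sum A B => sum (A.ren ρ) (B.ren ρ)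
  | _, _, ρ, mu A => mu (A.ren (Fin.cases 0 fun i => (ρ i).succ))

def subst : {n m : ℕ} → (Fin n → Ty m) → Ty n → Ty m
  | _, _, σ, var i => σ i
  | _, _, _, unit => unit
  | _, _, σ, prod A B => prod (A.subst σ) (B.subst σ)
  | _, _, σ, arrow A B => arrow (A.subst σ) (B.subst σ)
  | _, _, σ, sum A B => sum (A.subst σ) (B.subst σ)
  | _, _, σ, mu A => mu (A.subst (Fin.cases (var 0) fun i => (σ i).ren Fin.succ))

/-- The unrolling `A[mu A / 0]` of `mu A`. -/
def unroll {n : ℕ} (A : Ty (n + 1)) : Ty n := A.subst (Fin.cases (mu A) var)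

end Ty

/-- Pure types are closed type expressions. -/
abbrev PTy : Type := Ty 0

/-! ### Interpretation of pure types

Recursive types are interpreted by the bilimit of their finite unrollings. Free type variables, which
do not occur in pure types, are interpreted by the one-point cpo. -/

/-- One layer of the interpretation: recursive types are interpreted by unrolling them once and
using `prev`. -/
def step (prev : ∀ {n : ℕ}, Ty n → Cpo) : {n : ℕ} → Ty n → Cpo
  | _, .var _ => Cpo.one
  | _, .unit => Cpo.two
  | _, .prod A B => Cpo.prod (step prev A) (step prev B)
  | _, .arrow A B => Cpo.exp (step prev A) (step prev B)
  | _, .sum A B => Cpo.sum (step prev A) (step prev B)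
  | _, .mu A => prev A.unroll

/-- The `k`-th approximant of a type, in which recursive types are unrolled fewer than `k` times
before being cut to the one-point cpo. -/
def approx : ℕ → ∀ {n : ℕ}, Ty n → Cpo
  | 0, _, _ => Cpo.one
  | k + 1, _, A => step (approx k) A

def stepEP {prev prev' : ∀ {n : ℕ}, Ty n → Cpo}
    (h : ∀ {n : ℕ} (A : Ty n), EP (prev A) (prev' A)) :
    {n : ℕ} → (A : Ty n) → EP (step prev A) (step prev' A)
  | _, .var _ => EP.id Cpo.one
  | _, .unit => EP.id Cpo.two
  | _, .prod A B => EP.prod (stepEP h A) (stepEP h B)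
  | _, .arrow A B => EP.exp (stepEP h A) (stepEP h B)
  | _, .sum A B => EP.sum (stepEP h A) (stepEP h B)
  | _, .mu A => h A.unroll

/-- The embedding-projection pairs between consecutive approximants. -/
def approxEP : (k : ℕ) → ∀ {n : ℕ} (A : Ty n), EP (approx k A) (approx (k + 1) A)
  | 0, _, _ => EP.init _
  | k + 1, _, A => stepEP (approxEP k) A

def approxChain {n : ℕ} (A : Ty n) : Chain := ⟨fun k => approx k A, fun k => approxEP k A⟩

/-- The interpretation of types. -/
def Dom : {n : ℕ} → Ty n → Cpo
  | _, .var _ => Cpo.one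
  | _, .unit => Cpo.two
  | _, .prod A B => Cpo.prod (Dom A) (Dom B)
  | _, .arrow A B => Cpo.exp (Dom A) (Dom B)
  | _, .sum A B => Cpo.sum (Dom A) (Dom B)
  | _, .mu A => (approxChain (.mu A)).lim

/-- The approximants embed in the interpretation. -/
def approxDom (k : ℕ) : {n : ℕ} → (A : Ty n) → EP (approx (k + 1) A) (Dom A)
  | _, .var _ => EP.id Cpo.one
  | _, .unit => EP.id Cpo.two
  | _, .prod A B => EP.prod (approxDom k A) (approxDom k B)
  | _, .arrow A B => EP.exp (approxDom k A) (approxDom k B)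
  | _, .sum A B => EP.sum (approxDom k A) (approxDom k B)
  | _, .mu A => (approxChain (.mu A)).limCocone.ep (k + 1)

theorem approxDom_comm (k : ℕ) : {n : ℕ} → (A : Ty n) →
    (∀ x, (approxDom (k + 1) A).e ((approxEP (k + 1) A).e x) = (approxDom k A).e x) ∧
    (∀ y, (approxEP (k + 1) A).p ((approxDom (k + 1) A).p y) = (approxDom k A).p y)
  | _, .var _ => ⟨fun _ => rfl, fun _ => rfl⟩
  | _, .unit => ⟨fun _ => rfl, fun _ => rfl⟩
  | _, .prod A B =>
    have hA := approxDom_comm k A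
    have hB := approxDom_comm k B
    ⟨fun x => Prod.ext (hA.1 x.1) (hB.1 x.2), fun x => Prod.ext (hA.2 x.1) (hB.2 x.2)⟩
  | _, .arrow A B =>
    have hA := approxDom_comm k A
    have hB := approxDom_comm k B
    ⟨fun f => Hom.ext (funext fun x => (hB.1 _).trans
        (congrArg (fun z => (approxDom k B).e (Hom.toFun f z)) (hA.2 x))),
      fun f => Hom.ext (funext fun x => (hB.2 _).trans
        (congrArg (fun z => (approxDom k B).p (Hom.toFun f z)) (hA.1 x)))⟩
  | _, .sum A B =>
    have hA := approxDom_comm k A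
    have hB := approxDom_comm k B
    ⟨fun x => by
      rcases Cpo.WSum.cases x with rfl | ⟨x, rfl⟩ | ⟨x, rfl⟩
      · rfl
      · exact congrArg Cpo.WSum.inl (hA.1 x)
      · exact congrArg Cpo.WSum.inr (hB.1 x),
    fun x => by
      rcases Cpo.WSum.cases x with rfl | ⟨x, rfl⟩ | ⟨x, rfl⟩
      · rfl
      · exact congrArg Cpo.WSum.inl (hA.2 x)
      · exact congrArg Cpo.WSum.inr (hB.2 x)⟩
  | _, .mu A =>
    ⟨(approxChain (.mu A)).limCocone.comm_e (k + 1), (approxChain (.mu A)).limCocone.comm_p (k + 1)⟩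

/-- The cocone from the approximants of a type to its interpretation. -/
def domCocone {n : ℕ} (A : Ty n) : (approxChain A).Cocone (Dom A) where
  ep
    | 0 => EP.init _
    | k + 1 => approxDom k A
  comm_e
    | 0, _ => EP.e_bot (approxDom 0 A)
    | k + 1, x => (approxDom_comm k A).1 x
  comm_p
    | 0, _ => rfl
    | k + 1, y => (approxDom_comm k A).2 y

/-- The cocone from the approximants of the unrolling of `mu A` to the interpretation of `mu A`:
the `k`-th approximant of the former is the `(k+1)`-st approximant of the latter. -/
def unrollCocone {n : ℕ} (A : Ty (n + 1)) : (approxChain A.unroll).Cocone (Dom (.mu A)) where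
  ep k := approxDom k (.mu A)
  comm_e k x := (approxDom_comm k (.mu A)).1 x
  comm_p k y := (approxDom_comm k (.mu A)).2 y

/-- The canonical isomorphism between a recursive type and its unrolling, and its inverse. -/
def unfoldHom {n : ℕ} (A : Ty (n + 1)) : Hom (Dom (.mu A)) (Dom A.unroll) :=
  (unrollCocone A).map (domCocone A.unroll)

def foldHom {n : ℕ} (A : Ty (n + 1)) : Hom (Dom A.unroll) (Dom (.mu A)) :=
  (domCocone A.unroll).map (unrollCocone A)

namespace Chain.Cocone

variable {C : Chain} {X Y : Cpo}

/-- The cocone is colimiting. -/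
def IsColim (c : C.Cocone X) : Prop := ∀ x, IsLUB (Set.range fun n => (c.ep n).e ((c.ep n).p x)) x

theorem p_e_eq (c : C.Cocone X) (c' : C.Cocone Y) {m k : ℕ} (h : m ≤ k) (z : C.obj k) :
    (c'.ep m).p ((c'.ep k).e z) = (c.ep m).p ((c.ep k).e z) := by
  induction h using Nat.decreasingInduction with
  | self => rw [(c.ep k).p_e, (c'.ep k).p_e]
  | of_succ m _ ih => rw [← c.comm_p, ← c'.comm_p, ih]

theorem p_map (c : C.Cocone X) (c' : C.Cocone Y) (m : ℕ) (x : X) :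
    (c'.ep m).p (c.map c' x) = (c.ep m).p x := by
  have hd := (mono c c' x).directed_le.directedOn_range
  refine le_antisymm ?_ ?_
  · refine ((c'.ep m).p.cont (Set.range_nonempty _) hd hd.isLUB_sSup).2 ?_
    rintro _ ⟨_, ⟨n, rfl⟩, rfl⟩
    refine ((c'.ep m).p.mono (mono c c' x (le_max_right m n))).trans ?_
    change (c'.ep m).p ((c'.ep (max m n)).e _) ≤ _
    rw [p_e_eq c c' (le_max_left m n)]
    exact (c.ep m).p.mono ((c.ep _).e_p x)
  · rw [← (c'.ep m).p_e ((c.ep m).p x)]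
    exact (c'.ep m).p.mono (hd.isLUB_sSup.1 ⟨m, rfl⟩)

theorem map_map (c : C.Cocone X) (c' : C.Cocone Y) (hc : c.IsColim) (x : X) :
    c'.map c (c.map c' x) = x := by
  have hd := (mono c' c (c.map c' x)).directed_le.directedOn_range
  refine hd.isLUB_sSup.unique ?_
  have := hc x
  simp only [← p_map c c'] at this
  exact this

end Chain.Cocone

theorem Chain.limCocone_isColim (C : Chain) : C.limCocone.IsColim := by
  intro x
  refine ⟨?_, ?_⟩
  · rintro _ ⟨n, rfl⟩
    exact (C.limCocone.ep n).e_p x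
  · intro b hb n
    have := (C.limCocone.ep n).p.mono (hb ⟨n, rfl⟩)
    rw [(C.limCocone.ep n).p_e] at this
    have h : C.proj n x ≤ C.proj n b := by simpa [limCocone, cone_p] using this
    exact h

theorem unrollCocone_isColim {n : ℕ} (A : Ty (n + 1)) : (unrollCocone A).IsColim := by
  intro x
  have h := (approxChain (.mu A)).limCocone_isColim x
  refine ⟨?_, ?_⟩
  · rintro _ ⟨k, rfl⟩
    exact h.1 ⟨k + 1, rfl⟩
  · intro b hb
    refine h.2 ?_
    rintro _ ⟨k, rfl⟩
    exact (Chain.Cocone.mono _ _ x (Nat.le_succ k)).trans (hb ⟨k, rfl⟩)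

theorem domCocone_isColim : {n : ℕ} → (A : Ty n) → (domCocone A).IsColim
  | _, .var _ => fun x => ⟨by rintro _ ⟨k, rfl⟩; exact le_rfl, fun b hb => hb ⟨1, rfl⟩⟩
  | _, .unit => fun x => ⟨by
      rintro _ ⟨k, rfl⟩
      exact ((domCocone .unit).ep k).e_p x, fun b hb => hb ⟨1, rfl⟩⟩
  | _, .prod A B => fun x => ⟨by
      rintro _ ⟨k, rfl⟩
      exact ((domCocone (.prod A B)).ep k).e_p x, fun b hb => by
      refine ⟨(domCocone_isColim A x.1).2 ?_, (domCocone_isColim B x.2).2 ?_⟩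
      · rintro _ ⟨k, rfl⟩
        cases k with
        | zero => exact bot_le
        | succ k => exact (hb ⟨k + 1, rfl⟩).1
      · rintro _ ⟨k, rfl⟩
        cases k with
        | zero => exact bot_le
        | succ k => exact (hb ⟨k + 1, rfl⟩).2⟩
  | _, .arrow A B => fun f => ⟨by
      rintro _ ⟨k, rfl⟩
      exact ((domCocone (.arrow A B)).ep k).e_p f, fun b hb x => by
      have hd := (Chain.Cocone.mono (domCocone A) (domCocone A) x).directed_le.directedOn_range
      refine (Hom.cont f (Set.range_nonempty _) hd (domCocone_isColim A x)).2 ?_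
      rintro _ ⟨_, ⟨j, rfl⟩, rfl⟩
      refine (domCocone_isColim B _).2 ?_
      rintro _ ⟨k, rfl⟩
      refine le_trans ?_ (hb ⟨max j k + 1, rfl⟩ x)
      have h₁ := Chain.Cocone.mono (domCocone A) (domCocone A) x
        ((le_max_left j k).trans (Nat.le_succ _))
      have h₂ := Chain.Cocone.mono (domCocone B) (domCocone B)
        (Hom.toFun f (((domCocone A).ep j).e (((domCocone A).ep j).p x)))
        ((le_max_right j k).trans (Nat.le_succ _))
      refine h₂.trans ?_
      exact ((domCocone B).ep _).e.mono (((domCocone B).ep _).p.mono (Hom.mono f h₁))⟩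
  | _, .sum A B => fun x => ⟨by
      rintro _ ⟨k, rfl⟩
      exact ((domCocone (.sum A B)).ep k).e_p x, fun b hb => by
      rcases Cpo.WSum.cases x with rfl | ⟨x, rfl⟩ | ⟨x, rfl⟩
      · exact bot_le
      · obtain ⟨c, rfl⟩ := Cpo.WSum.inl_up _ _ (hb ⟨1, rfl⟩)
        refine (Cpo.WSum.inl_le _ _).2 ((domCocone_isColim A x).2 ?_)
        rintro _ ⟨k, rfl⟩
        cases k with
        | zero => exact bot_le
        | succ k => exact (Cpo.WSum.inl_le _ _).1 (hb ⟨k + 1, rfl⟩)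
      · obtain ⟨c, rfl⟩ := Cpo.WSum.inr_up _ _ (hb ⟨1, rfl⟩)
        refine (Cpo.WSum.inr_le _ _).2 ((domCocone_isColim B x).2 ?_)
        rintro _ ⟨k, rfl⟩
        cases k with
        | zero => exact bot_le
        | succ k => exact (Cpo.WSum.inr_le _ _).1 (hb ⟨k + 1, rfl⟩)⟩
  | _, .mu A => fun x => by
      have h := (approxChain (.mu A)).limCocone_isColim x
      refine ⟨?_, ?_⟩
      · rintro _ ⟨k, rfl⟩
        exact ((domCocone (.mu A)).ep k).e_p x
      · intro b hb
        refine h.2 ?_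
        rintro _ ⟨k, rfl⟩
        exact (Chain.Cocone.mono _ _ x (Nat.le_succ k)).trans (hb ⟨k + 1, rfl⟩)

theorem fold_unfold {n : ℕ} (A : Ty (n + 1)) (x : Dom (.mu A)) : foldHom A (unfoldHom A x) = x :=
  Chain.Cocone.map_map _ _ (unrollCocone_isColim A) x

theorem unfold_fold {n : ℕ} (A : Ty (n + 1)) (x : Dom A.unroll) : unfoldHom A (foldHom A x) = x :=
  Chain.Cocone.map_map _ _ (domCocone_isColim A.unroll) x

/-! ### Terms of the pure system -/

/-- Terms modulo `α`-equivalence (de Bruijn indices). `case M N₁ N₂` binds one variable in each of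
`N₁` and `N₂`. -/
inductive Tm : Type
  | star : Tm
  | pair (M N : Tm) : Tm
  | proj₁ (M : Tm) : Tm
  | proj₂ (M : Tm) : Tm
  | var (i : ℕ) : Tm
  | lam (M : Tm) : Tm
  | app (M N : Tm) : Tm
  | fix (M : Tm) : Tm
  | fold (M : Tm) : Tm
  | unfold (M : Tm) : Tm
  | inj₁ (M : Tm) : Tm
  | inj₂ (M : Tm) : Tm
  | case (M N₁ N₂ : Tm) : Tm

/-- `Lookup Γ i a`: the `i`-th entry of `Γ` is `a`. -/
inductive Lookup {α : Type} : List α → ℕ → α → Type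
  | zero {Γ : List α} {a : α} : Lookup (a :: Γ) 0 a
  | succ {Γ : List α} {a b : α} {i : ℕ} : Lookup Γ i a → Lookup (b :: Γ) (i + 1) a

/-- Derivations of pure typing judgements `Γ ⊢ M : A`. The head of `Γ` is the type of variable `0`,
which is the most recently bound one. -/
inductive PTyping : List PTy → Tm → PTy → Type
  | var {Γ : List PTy} {i : ℕ} {A : PTy} : Lookup Γ i A → PTyping Γ (.var i) A
  | lam {Γ : List PTy} {M : Tm} {A B : PTy} :
      PTyping (B :: Γ) M A → PTyping Γ (.lam M) (.arrow B A)
  | app {Γ : List PTy} {M N : Tm} {A B : PTy} :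
      PTyping Γ M (.arrow B A) → PTyping Γ N B → PTyping Γ (.app M N) A
  | pair {Γ : List PTy} {M N : Tm} {A B : PTy} :
      PTyping Γ M A → PTyping Γ N B → PTyping Γ (.pair M N) (.prod A B)
  | proj₁ {Γ : List PTy} {M : Tm} {A B : PTy} :
      PTyping Γ M (.prod A B) → PTyping Γ (.proj₁ M) A
  | proj₂ {Γ : List PTy} {M : Tm} {A B : PTy} :
      PTyping Γ M (.prod A B) → PTyping Γ (.proj₂ M) B
  | star {Γ : List PTy} : PTyping Γ .star .unit
  | fix {Γ : List PTy} {M : Tm} {A : PTy} : PTyping (A :: Γ) M A → PTyping Γ (.fix M) A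
  | fold {Γ : List PTy} {M : Tm} {A : Ty 1} :
      PTyping Γ M A.unroll → PTyping Γ (.fold M) (.mu A)
  | unfold {Γ : List PTy} {M : Tm} {A : Ty 1} :
      PTyping Γ M (.mu A) → PTyping Γ (.unfold M) A.unroll
  | inj₁ {Γ : List PTy} {M : Tm} {A B : PTy} :
      PTyping Γ M A → PTyping Γ (.inj₁ M) (.sum A B)
  | inj₂ {Γ : List PTy} {M : Tm} {A B : PTy} :
      PTyping Γ M B → PTyping Γ (.inj₂ M) (.sum A B)
  | case {Γ : List PTy} {M N₁ N₂ : Tm} {A B C : PTy} :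
      PTyping Γ M (.sum A B) → PTyping (A :: Γ) N₁ C → PTyping (B :: Γ) N₂ C →
      PTyping Γ (.case M N₁ N₂) C

/-- The interpretation of a pure context is the product of the interpretations of its types. -/
def CtxDom : List PTy → Cpo
  | [] => Cpo.one
  | A :: Γ => Cpo.prod (CtxDom Γ) (Dom A)

def Lookup.sem : {Γ : List PTy} → {i : ℕ} → {A : PTy} → Lookup Γ i A → Hom (CtxDom Γ) (Dom A)
  | _, _, _, .zero => Hom.snd
  | _, _, _, .succ x => x.sem.comp Hom.fst

/-- The interpretation of typed terms as Scott-continuous functions. -/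
def PTyping.sem : {Γ : List PTy} → {M : Tm} → {A : PTy} → PTyping Γ M A → Hom (CtxDom Γ) (Dom A)
  | _, _, _, .var x => x.sem
  | _, _, _, .lam d => Hom.curry d.sem
  | _, _, _, .app d d' => Hom.ev.comp (Hom.pair d.sem d'.sem)
  | _, _, _, .pair d d' => Hom.pair d.sem d'.sem
  | _, _, _, .proj₁ d => Hom.fst.comp d.sem
  | _, _, _, .proj₂ d => Hom.snd.comp d.sem
  | _, _, _, .star => Hom.const _ (⊤ : Bool)
  | _, _, _, .fix (A := A) d => (Hom.fix (Dom A)).comp (Hom.curry d.sem)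
  | _, _, _, .fold (A := A) d => (foldHom A).comp d.sem
  | _, _, _, .unfold (A := A) d => (unfoldHom A).comp d.sem
  | _, _, _, .inj₁ d => Hom.inl.comp d.sem
  | _, _, _, .inj₂ d => Hom.inr.comp d.sem
  | _, _, _, .case d d₁ d₂ => Hom.case d.sem d₁.sem d₂.sem

/-! ### Formulae -/

/-- Iteration terms over the iteration variables `0, 1, …` (de Bruijn indices). -/
inductive ITm : Type
  | var (k : ℕ) : ITm
  | zero : ITm
  | succ (t : ITm) : ITm

namespace ITm

def subst (σ : ℕ → ITm) : ITm → ITm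
  | var k => σ k
  | zero => zero
  | succ t => succ (t.subst σ)

/-- Occurrence of an iteration variable. -/
def Free (k : ℕ) : ITm → Prop
  | var j => j = k
  | zero => False
  | succ t => t.Free k

def sem (ρ : ℕ → ℕ) : ITm → ℕ
  | var k => ρ k
  | zero => 0
  | succ t => t.sem ρ + 1

/-- Substitutions under a quantifier. -/
def up (σ : ℕ → ITm) : ℕ → ITm
  | 0 => var 0
  | k + 1 => (σ k).subst fun j => var (j + 1)

/-- The substitution of `t` for variable `0`. -/
def inst (t : ITm) : ℕ → ITm
  | 0 => t
  | k + 1 => var k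

end ITm

/-- Modalities, from formulae of the first type to formulae of the second. -/
inductive Modality : PTy → PTy → Type
  | proj₁ {A B : PTy} : Modality A (.prod A B)
  | proj₂ {A B : PTy} : Modality B (.prod A B)
  | inj₁ {A B : PTy} : Modality A (.sum A B)
  | inj₂ {A B : PTy} : Modality B (.sum A B)
  | fold {A : Ty 1} : Modality A.unroll (.mu A)

/-- The two kinds of bounded iteration. -/
inductive IterKind : Type
  | mu : IterKind
  | nu : IterKind

/-- Typed fixpoint variables of a fixpoint context. -/
inductive FVar : List PTy → PTy → Type
  | zero {Φ : List PTy} {A : PTy} : FVar (A :: Φ) A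
  | succ {Φ : List PTy} {A B : PTy} : FVar Φ A → FVar (B :: Φ) A

/-- Definition by cases on the fixpoint variables of an extended context. -/
def FVar.extend {P : PTy → Type} {Φ : List PTy} {A : PTy} (z : P A) (s : ∀ B, FVar Φ B → P B) :
    ∀ B, FVar (A :: Φ) B → P B
  | _, .zero => z
  | _, .succ X => s _ X

/-- Raw formulae of a pure type in a fixpoint context; the polarity constraints are imposed by
`InL` below. `ex` and `all` bind iteration variable `0`; `iter b t φ` is the iteration
`(μᵗ X) φ` or `(νᵗ X) φ`, with `X` the first variable of the extended context. The components of a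
realizability implication have no free fixpoint variable. -/
inductive Form : List PTy → PTy → Type
  | top {Φ : List PTy} {A : PTy} : Form Φ A
  | bot {Φ : List PTy} {A : PTy} : Form Φ A
  | and {Φ : List PTy} {A : PTy} (φ ψ : Form Φ A) : Form Φ A
  | or {Φ : List PTy} {A : PTy} (φ ψ : Form Φ A) : Form Φ A
  | star {Φ : List PTy} : Form Φ .unit
  | mod {Φ : List PTy} {A B : PTy} (m : Modality A B) (φ : Form Φ A) : Form Φ B
  | var {Φ : List PTy} {A : PTy} (X : FVar Φ A) : Form Φ A
  | iter {Φ : List PTy} {A : PTy} (b : IterKind) (t : ITm) (φ : Form (A :: Φ) A) : Form Φ A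
  | ex {Φ : List PTy} {A : PTy} (φ : Form Φ A) : Form Φ A
  | all {Φ : List PTy} {A : PTy} (φ : Form Φ A) : Form Φ A
  | imp {Φ : List PTy} {A B : PTy} (ψ : Form [] B) (φ : Form [] A) : Form Φ (.arrow B A)

namespace Form

/-- Substitution of iteration terms for iteration variables. -/
def substI : {Φ : List PTy} → {A : PTy} → (ℕ → ITm) → Form Φ A → Form Φ A
  | _, _, _, top => top
  | _, _, _, bot => bot
  | _, _, σ, and φ ψ => and (φ.substI σ) (ψ.substI σ)
  | _, _, σ, or φ ψ => or (φ.substI σ) (ψ.substI σ)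
  | _, _, _, star => star
  | _, _, σ, mod m φ => mod m (φ.substI σ)
  | _, _, _, var X => var X
  | _, _, σ, iter b t φ => iter b (t.subst σ) (φ.substI σ)
  | _, _, σ, ex φ => ex (φ.substI (ITm.up σ))
  | _, _, σ, all φ => all (φ.substI (ITm.up σ))
  | _, _, σ, imp ψ φ => imp (ψ.substI σ) (φ.substI σ)

/-- Weakening by a fresh iteration variable `0`. -/
def lift {Φ : List PTy} {A : PTy} (φ : Form Φ A) : Form Φ A :=
  φ.substI fun k => ITm.var (k + 1)

/-- `φ[t/k]`, where `k` is iteration variable `0`. -/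
def inst {Φ : List PTy} {A : PTy} (φ : Form Φ A) (t : ITm) : Form Φ A := φ.substI t.inst

/-- Renaming of fixpoint variables. -/
def renF : {Φ Ψ : List PTy} → {A : PTy} → (∀ B, FVar Φ B → FVar Ψ B) → Form Φ A → Form Ψ A
  | _, _, _, _, top => top
  | _, _, _, _, bot => bot
  | _, _, _, r, and φ ψ => and (φ.renF r) (ψ.renF r)
  | _, _, _, r, or φ ψ => or (φ.renF r) (ψ.renF r)
  | _, _, _, _, star => star
  | _, _, _, r, mod m φ => mod m (φ.renF r)
  | _, _, _, r, var X => var (r _ X)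
  | _, _, _, r, iter b t φ => iter b t (φ.renF (FVar.extend .zero fun _ X => .succ (r _ X)))
  | _, _, _, r, ex φ => ex (φ.renF r)
  | _, _, _, r, all φ => all (φ.renF r)
  | _, _, _, _, imp ψ φ => imp ψ φ

/-- Capture-avoiding substitution of formulae for fixpoint variables. -/
def substF : {Φ Ψ : List PTy} → {A : PTy} → (∀ B, FVar Φ B → Form Ψ B) → Form Φ A → Form Ψ A
  | _, _, _, _, top => top
  | _, _, _, _, bot => bot
  | _, _, _, s, and φ ψ => and (φ.substF s) (ψ.substF s)
  | _, _, _, s, or φ ψ => or (φ.substF s) (ψ.substF s)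
  | _, _, _, _, star => star
  | _, _, _, s, mod m φ => mod m (φ.substF s)
  | _, _, _, s, var X => s _ X
  | _, _, _, s, iter b t φ =>
      iter b t (φ.substF (FVar.extend (var .zero) fun _ X => (s _ X).renF fun _ => .succ))
  | _, _, _, s, ex φ => ex (φ.substF fun _ X => (s _ X).lift)
  | _, _, _, s, all φ => all (φ.substF fun _ X => (s _ X).lift)
  | _, _, _, _, imp ψ φ => imp ψ φ

/-- `φ[ψ/X]`, where `X` is the first fixpoint variable. -/
def instF {Φ : List PTy} {A B : PTy} (φ : Form (B :: Φ) A) (ψ : Form Φ B) : Form Φ A :=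
  φ.substF (FVar.extend ψ fun _ X => var X)

/-- Free occurrence of an iteration variable. -/
def Free : {Φ : List PTy} → {A : PTy} → ℕ → Form Φ A → Prop
  | _, _, _, top => False
  | _, _, _, bot => False
  | _, _, k, and φ ψ => φ.Free k ∨ ψ.Free k
  | _, _, k, or φ ψ => φ.Free k ∨ ψ.Free k
  | _, _, _, star => False
  | _, _, k, mod _ φ => φ.Free k
  | _, _, _, var _ => False
  | _, _, k, iter _ t φ => t.Free k ∨ φ.Free k
  | _, _, k, ex φ => φ.Free (k + 1)
  | _, _, k, all φ => φ.Free (k + 1)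
  | _, _, k, imp ψ φ => ψ.Free k ∨ φ.Free k

/-- Finite conjunctions. -/
def conj {Φ : List PTy} {A : PTy} : List (Form Φ A) → Form Φ A
  | [] => top
  | φ :: l => and φ (conj l)

end Form

mutual

/-- The iteration variable `k` is positive in `φ`. -/
inductive Pos : {Φ : List PTy} → {A : PTy} → ℕ → Form Φ A → Prop
  | notFree {Φ : List PTy} {A : PTy} {k : ℕ} {φ : Form Φ A} : ¬ φ.Free k → Pos k φ
  | and {Φ : List PTy} {A : PTy} {k : ℕ} {φ ψ : Form Φ A} :
      Pos k φ → Pos k ψ → Pos k (φ.and ψ)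
  | or {Φ : List PTy} {A : PTy} {k : ℕ} {φ ψ : Form Φ A} :
      Pos k φ → Pos k ψ → Pos k (φ.or ψ)
  | mod {Φ : List PTy} {A B : PTy} {k : ℕ} {m : Modality A B} {φ : Form Φ A} :
      Pos k φ → Pos k (φ.mod m)
  | imp {Φ : List PTy} {A B : PTy} {k : ℕ} {ψ : Form [] B} {φ : Form [] A} :
      Neg k ψ → Pos k φ → Pos k (Form.imp (Φ := Φ) ψ φ)
  | ex {Φ : List PTy} {A : PTy} {k : ℕ} {φ : Form Φ A} : Pos (k + 1) φ → Pos k φ.ex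
  | mu {Φ : List PTy} {A : PTy} {k : ℕ} {t : ITm} {φ : Form (A :: Φ) A} :
      Pos k φ → Pos k (Form.iter .mu t φ)
  | nu {Φ : List PTy} {A : PTy} {k : ℕ} {t : ITm} {φ : Form (A :: Φ) A} :
      Pos k φ → ¬ t.Free k → Pos k (Form.iter .nu t φ)

/-- The iteration variable `k` is negative in `φ`. -/
inductive Neg : {Φ : List PTy} → {A : PTy} → ℕ → Form Φ A → Prop
  | notFree {Φ : List PTy} {A : PTy} {k : ℕ} {φ : Form Φ A} : ¬ φ.Free k → Neg k φ
  | and {Φ : List PTy} {A : PTy} {k : ℕ} {φ ψ : Form Φ A} :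
      Neg k φ → Neg k ψ → Neg k (φ.and ψ)
  | or {Φ : List PTy} {A : PTy} {k : ℕ} {φ ψ : Form Φ A} :
      Neg k φ → Neg k ψ → Neg k (φ.or ψ)
  | mod {Φ : List PTy} {A B : PTy} {k : ℕ} {m : Modality A B} {φ : Form Φ A} :
      Neg k φ → Neg k (φ.mod m)
  | imp {Φ : List PTy} {A B : PTy} {k : ℕ} {ψ : Form [] B} {φ : Form [] A} :
      Pos k ψ → Neg k φ → Neg k (Form.imp (Φ := Φ) ψ φ)
  | all {Φ : List PTy} {A : PTy} {k : ℕ} {φ : Form Φ A} : Neg (k + 1) φ → Neg k φ.all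
  | nu {Φ : List PTy} {A : PTy} {k : ℕ} {t : ITm} {φ : Form (A :: Φ) A} :
      Neg k φ → Neg k (Form.iter .nu t φ)
  | mu {Φ : List PTy} {A : PTy} {k : ℕ} {t : ITm} {φ : Form (A :: Φ) A} :
      Neg k φ → ¬ t.Free k → Neg k (Form.iter .mu t φ)

end

/-- Polarities: neutral, positive, negative. -/
inductive Sign : Type
  | neutral : Sign
  | pos : Sign
  | neg : Sign

def Sign.opp : Sign → Sign
  | neutral => neutral
  | pos => neg
  | neg => pos

/-- `InL s φ`: the formula `φ` belongs to the language of polarity `s`. -/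
inductive InL : {Φ : List PTy} → {A : PTy} → Sign → Form Φ A → Prop
  | top {Φ : List PTy} {A : PTy} {s : Sign} : InL s (Form.top (Φ := Φ) (A := A))
  | bot {Φ : List PTy} {A : PTy} {s : Sign} : InL s (Form.bot (Φ := Φ) (A := A))
  | and {Φ : List PTy} {A : PTy} {s : Sign} {φ ψ : Form Φ A} :
      InL s φ → InL s ψ → InL s (φ.and ψ)
  | or {Φ : List PTy} {A : PTy} {s : Sign} {φ ψ : Form Φ A} :
      InL s φ → InL s ψ → InL s (φ.or ψ)
  | star {Φ : List PTy} {s : Sign} : InL s (Form.star (Φ := Φ))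
  | mod {Φ : List PTy} {A B : PTy} {s : Sign} {m : Modality A B} {φ : Form Φ A} :
      InL s φ → InL s (φ.mod m)
  | var {Φ : List PTy} {A : PTy} {s : Sign} {X : FVar Φ A} : InL s (Form.var X)
  | iter {Φ : List PTy} {A : PTy} {s : Sign} {b : IterKind} {t : ITm} {φ : Form (A :: Φ) A} :
      InL s φ → InL s (Form.iter b t φ)
  | ex {Φ : List PTy} {A : PTy} {φ : Form Φ A} : InL .pos φ → Pos 0 φ → InL .pos φ.ex
  | all {Φ : List PTy} {A : PTy} {φ : Form Φ A} : InL .neg φ → Neg 0 φ → InL .neg φ.all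
  | imp {Φ : List PTy} {A B : PTy} {s : Sign} {ψ : Form [] B} {φ : Form [] A} :
      InL s.opp ψ → InL s φ → InL s (Form.imp (Φ := Φ) ψ φ)

/-- The fragment with neither iteration, nor fixpoint and iteration variables, nor quantifiers, nor
binary disjunction (but with `⊥`). -/
inductive InMeet : {A : PTy} → Form [] A → Prop
  | top {A : PTy} : InMeet (Form.top (A := A))
  | bot {A : PTy} : InMeet (Form.bot (A := A))
  | and {A : PTy} {φ ψ : Form [] A} : InMeet φ → InMeet ψ → InMeet (φ.and ψ)
  | star : InMeet Form.star
  | mod {A B : PTy} {m : Modality A B} {φ : Form [] A} : InMeet φ → InMeet (φ.mod m)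
  | imp {A B : PTy} {ψ : Form [] B} {φ : Form [] A} : InMeet ψ → InMeet φ → InMeet (Form.imp ψ φ)

/-! ### Deduction -/

/-- `ψ ⊢ φ` is a sequent when `ψ` and `φ` belong to the language of a same polarity. -/
def IsSequent {Φ : List PTy} {A : PTy} (ψ φ : Form Φ A) : Prop := ∃ s, InL s ψ ∧ InL s φ

def Modality.IsInj : {A B : PTy} → Modality A B → Prop
  | _, _, .inj₁ => True
  | _, _, .inj₂ => True
  | _, _, _ => False

mutual

/-- Derivable sequents `ψ ⊢ φ`. -/
inductive Ded : {Φ : List PTy} → {A : PTy} → Form Φ A → Form Φ A → Prop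
  -- propositional rules
  | refl {Φ : List PTy} {A : PTy} {φ : Form Φ A} : IsSequent φ φ → Ded φ φ
  | cut {Φ : List PTy} {A : PTy} {ψ θ φ : Form Φ A} :
      IsSequent ψ φ → Ded ψ θ → Ded θ φ → Ded ψ φ
  | distr {Φ : List PTy} {A : PTy} {ψ φ θ : Form Φ A} :
      IsSequent (ψ.and (φ.or θ)) ((ψ.and φ).or (ψ.and θ)) →
      Ded (ψ.and (φ.or θ)) ((ψ.and φ).or (ψ.and θ))
  | andR {Φ : List PTy} {A : PTy} {ψ φ₁ φ₂ : Form Φ A} :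
      IsSequent ψ (φ₁.and φ₂) → Ded ψ φ₁ → Ded ψ φ₂ → Ded ψ (φ₁.and φ₂)
  | andL₁ {Φ : List PTy} {A : PTy} {ψ₁ ψ₂ φ : Form Φ A} :
      IsSequent (ψ₁.and ψ₂) φ → Ded ψ₁ φ → Ded (ψ₁.and ψ₂) φ
  | andL₂ {Φ : List PTy} {A : PTy} {ψ₁ ψ₂ φ : Form Φ A} :
      IsSequent (ψ₁.and ψ₂) φ → Ded ψ₂ φ → Ded (ψ₁.and ψ₂) φ
  | topR {Φ : List PTy} {A : PTy} {ψ : Form Φ A} : IsSequent ψ .top → Ded ψ .top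
  | orR₁ {Φ : List PTy} {A : PTy} {ψ φ₁ φ₂ : Form Φ A} :
      IsSequent ψ (φ₁.or φ₂) → Ded ψ φ₁ → Ded ψ (φ₁.or φ₂)
  | orR₂ {Φ : List PTy} {A : PTy} {ψ φ₁ φ₂ : Form Φ A} :
      IsSequent ψ (φ₁.or φ₂) → Ded ψ φ₂ → Ded ψ (φ₁.or φ₂)
  | orL {Φ : List PTy} {A : PTy} {ψ₁ ψ₂ φ : Form Φ A} :
      IsSequent (ψ₁.or ψ₂) φ → Ded ψ₁ φ → Ded ψ₂ φ → Ded (ψ₁.or ψ₂) φ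
  | botL {Φ : List PTy} {A : PTy} {φ : Form Φ A} : IsSequent .bot φ → Ded .bot φ
  -- modal rules
  | inj {Φ : List PTy} {A B : PTy} {φ : Form Φ A} {ψ : Form Φ B} :
      IsSequent ((φ.mod .inj₁).and (ψ.mod .inj₂)) .bot →
      Ded ((φ.mod .inj₁).and (ψ.mod .inj₂)) .bot
  | modMono {Φ : List PTy} {A B : PTy} {m : Modality A B} {ψ φ : Form Φ A} :
      IsSequent (ψ.mod m) (φ.mod m) → Ded ψ φ → Ded (ψ.mod m) (φ.mod m)
  | modAnd {Φ : List PTy} {A B : PTy} {m : Modality A B} {φ₁ φ₂ : Form Φ A} :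
      IsSequent ((φ₁.mod m).and (φ₂.mod m)) ((φ₁.and φ₂).mod m) →
      Ded ((φ₁.mod m).and (φ₂.mod m)) ((φ₁.and φ₂).mod m)
  | modTop {Φ : List PTy} {A B : PTy} {m : Modality A B} :
      IsSequent (Φ := Φ) .top (Form.top.mod m) → ¬ m.IsInj → Ded (Φ := Φ) .top (Form.top.mod m)
  | modAll {Φ : List PTy} {A B : PTy} {m : Modality A B} {φ : Form Φ A} :
      IsSequent (φ.mod m).all (φ.all.mod m) → Ded (φ.mod m).all (φ.all.mod m)
  | modOr {Φ : List PTy} {A B : PTy} {m : Modality A B} {φ₁ φ₂ : Form Φ A} :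
      IsSequent ((φ₁.or φ₂).mod m) ((φ₁.mod m).or (φ₂.mod m)) →
      Ded ((φ₁.or φ₂).mod m) ((φ₁.mod m).or (φ₂.mod m))
  | modBot {Φ : List PTy} {A B : PTy} {m : Modality A B} :
      IsSequent (Φ := Φ) (Form.bot.mod m) .bot → Ded (Φ := Φ) (Form.bot.mod m) .bot
  | modEx {Φ : List PTy} {A B : PTy} {m : Modality A B} {φ : Form Φ A} :
      IsSequent (φ.ex.mod m) (φ.mod m).ex → Ded (φ.ex.mod m) (φ.mod m).ex
  -- quantifier rules
  | exR {Φ : List PTy} {A : PTy} {ψ φ : Form Φ A} {t : ITm} :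
      IsSequent ψ φ.ex → Ded ψ (φ.inst t) → Ded ψ φ.ex
  | exL {Φ : List PTy} {A : PTy} {θ φ ψ : Form Φ A} :
      IsSequent (θ.and φ.ex) ψ → Ded (θ.lift.and φ) ψ.lift → Ded (θ.and φ.ex) ψ
  | exM {Φ : List PTy} {A : PTy} {φ : Form Φ A} :
      IsSequent φ.ex.ex (φ.inst (.var 0)).ex → Ded φ.ex.ex (φ.inst (.var 0)).ex
  | allL {Φ : List PTy} {A : PTy} {φ ψ : Form Φ A} {t : ITm} :
      IsSequent φ.all ψ → Ded (φ.inst t) ψ → Ded φ.all ψ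
  | allR {Φ : List PTy} {A : PTy} {ψ φ θ : Form Φ A} :
      IsSequent ψ (φ.all.or θ) → Ded ψ.lift (φ.or θ.lift) → Ded ψ (φ.all.or θ)
  | allM {Φ : List PTy} {A : PTy} {φ : Form Φ A} :
      IsSequent (φ.inst (.var 0)).all φ.all.all → Ded (φ.inst (.var 0)).all φ.all.all
  | iterEx {Φ : List PTy} {A : PTy} {b : IterKind} {t : ITm} {φ : Form (A :: Φ) A} :
      IsSequent (Form.iter b t φ.ex) (Form.iter b (t.subst fun k => .var (k + 1)) φ).ex →
      Ded (Form.iter b t φ.ex) (Form.iter b (t.subst fun k => .var (k + 1)) φ).ex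
  | allIter {Φ : List PTy} {A : PTy} {b : IterKind} {t : ITm} {φ : Form (A :: Φ) A} :
      IsSequent (Form.iter b (t.subst fun k => .var (k + 1)) φ).all (Form.iter b t φ.all) →
      Ded (Form.iter b (t.subst fun k => .var (k + 1)) φ).all (Form.iter b t φ.all)
  -- bounded iteration
  | muZero {Φ : List PTy} {A : PTy} {φ : Form (A :: Φ) A} :
      IsSequent (Form.iter .mu .zero φ) .bot → Ded (Form.iter .mu .zero φ) .bot
  | muSuccL {Φ : List PTy} {A : PTy} {t : ITm} {φ : Form (A :: Φ) A} {ψ : Form Φ A} :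
      IsSequent (Form.iter .mu t.succ φ) (φ.instF ψ) → Ded (Form.iter .mu t φ) ψ →
      Ded (Form.iter .mu t.succ φ) (φ.instF ψ)
  | muSuccR {Φ : List PTy} {A : PTy} {t : ITm} {φ : Form (A :: Φ) A} :
      IsSequent (φ.instF (Form.iter .mu t φ)) (Form.iter .mu t.succ φ) →
      Ded (φ.instF (Form.iter .mu t φ)) (Form.iter .mu t.succ φ)
  | nuZero {Φ : List PTy} {A : PTy} {φ : Form (A :: Φ) A} :
      IsSequent .top (Form.iter .nu .zero φ) → Ded .top (Form.iter .nu .zero φ)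
  | nuSuccR {Φ : List PTy} {A : PTy} {t : ITm} {φ : Form (A :: Φ) A} {ψ : Form Φ A} :
      IsSequent (φ.instF ψ) (Form.iter .nu t.succ φ) → Ded ψ (Form.iter .nu t φ) →
      Ded (φ.instF ψ) (Form.iter .nu t.succ φ)
  | nuSuccL {Φ : List PTy} {A : PTy} {t : ITm} {φ : Form (A :: Φ) A} :
      IsSequent (Form.iter .nu t.succ φ) (φ.instF (Form.iter .nu t φ)) →
      Ded (Form.iter .nu t.succ φ) (φ.instF (Form.iter .nu t φ))
  | iterMono {Φ : List PTy} {A : PTy} {b : IterKind} {t : ITm} {ψ φ : Form (A :: Φ) A} :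
      IsSequent (Form.iter b t ψ) (Form.iter b t φ) → Ded ψ φ →
      Ded (Form.iter b t ψ) (Form.iter b t φ)
  -- realizability implication
  | impMono {Φ : List PTy} {A B : PTy} {ψ ψ' : Form [] B} {φ φ' : Form [] A} :
      IsSequent (Form.imp (Φ := Φ) ψ φ) (Form.imp ψ' φ') → Ded ψ' ψ → Ded φ φ' →
      Ded (Form.imp (Φ := Φ) ψ φ) (Form.imp ψ' φ')
  | wf {Φ : List PTy} {A B : PTy} {ψ : Form [] B} {φ : Form [] A} :
      IsSequent (Form.imp (Φ := Φ) ψ.all φ) (Form.imp ψ φ.lift).ex →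
      Ded (Form.imp (Φ := Φ) ψ.all φ) (Form.imp ψ φ.lift).ex
  | cc {Φ : List PTy} {A B : PTy} {ψ : Form [] B} {φ : Form [] A} :
      IsSequent (Form.imp (Φ := Φ) ψ φ.ex) (Form.imp ψ.lift φ).ex → InL .neutral ψ →
      Ded (Form.imp (Φ := Φ) ψ φ.ex) (Form.imp ψ.lift φ).ex
  | exImp {Φ : List PTy} {A B : PTy} {ψ : Form [] B} {φ : Form [] A} :
      IsSequent (Form.imp (Φ := Φ) ψ φ.lift).all (Form.imp ψ.ex φ) →
      Ded (Form.imp (Φ := Φ) ψ φ.lift).all (Form.imp ψ.ex φ)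
  | impAll {Φ : List PTy} {A B : PTy} {ψ : Form [] B} {φ : Form [] A} :
      IsSequent (Form.imp (Φ := Φ) ψ.lift φ).all (Form.imp ψ φ.all) →
      Ded (Form.imp (Φ := Φ) ψ.lift φ).all (Form.imp ψ φ.all)
  | impAnd {Φ : List PTy} {A B : PTy} {ψ : Form [] B} {φ₁ φ₂ : Form [] A} :
      IsSequent ((Form.imp (Φ := Φ) ψ φ₁).and (Form.imp ψ φ₂)) (Form.imp ψ (φ₁.and φ₂)) →
      Ded ((Form.imp (Φ := Φ) ψ φ₁).and (Form.imp ψ φ₂)) (Form.imp ψ (φ₁.and φ₂))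
  | impTop {Φ : List PTy} {A B : PTy} {ψ : Form [] B} :
      IsSequent .top (Form.imp (Φ := Φ) (A := A) ψ .top) →
      Ded .top (Form.imp (Φ := Φ) (A := A) ψ .top)
  | orImp {Φ : List PTy} {A B : PTy} {ψ₁ ψ₂ : Form [] B} {φ : Form [] A} :
      IsSequent ((Form.imp (Φ := Φ) ψ₁ φ).and (Form.imp ψ₂ φ)) (Form.imp (ψ₁.or ψ₂) φ) →
      Ded ((Form.imp (Φ := Φ) ψ₁ φ).and (Form.imp ψ₂ φ)) (Form.imp (ψ₁.or ψ₂) φ)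
  | botImp {Φ : List PTy} {A B : PTy} {φ : Form [] A} :
      IsSequent .top (Form.imp (Φ := Φ) (B := B) .bot φ) →
      Ded .top (Form.imp (Φ := Φ) (B := B) .bot φ)
  | impOr {Φ : List PTy} {A B : PTy} {δ : Form [] B} {φ₁ φ₂ : Form [] A} :
      IsSequent (Form.imp (Φ := Φ) δ (φ₁.or φ₂)) ((Form.imp δ φ₁).or (Form.imp δ φ₂)) →
      InMeet δ → Ded (Form.imp (Φ := Φ) δ (φ₁.or φ₂)) ((Form.imp δ φ₁).or (Form.imp δ φ₂))
  | impBot {Φ : List PTy} {A B : PTy} {δ : Form [] B} :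
      IsSequent (Form.imp (Φ := Φ) (A := A) δ .bot) .bot → Con δ → InMeet δ →
      Ded (Form.imp (Φ := Φ) (A := A) δ .bot) .bot

/-- The consistency predicate. In the last rule, the finite family `(ψᵢ, φᵢ)` is a list and
its subfamilies are sublists; `inc` selects the subfamilies `J` for which `⋀_J ψⱼ ⊢ ⊥` is used. -/
inductive Con : {A : PTy} → Form [] A → Prop
  | star : Con Form.star
  | fold {A : Ty 1} {φ : Form [] A.unroll} : Con φ → Con (φ.mod .fold)
  | pair {A B : PTy} {φ : Form [] A} {ψ : Form [] B} :
      Con φ → Con ψ → Con ((φ.mod .proj₁).and (ψ.mod .proj₂))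
  | inj₁ {A B : PTy} {φ : Form [] A} : Con φ → Con (φ.mod (.inj₁ (B := B)))
  | inj₂ {A B : PTy} {φ : Form [] B} : Con φ → Con (φ.mod (.inj₂ (A := A)))
  | top {A : PTy} : Con (Form.top (A := A))
  | ded {A : PTy} {ψ φ : Form [] A} : Con ψ → Ded ψ φ → InMeet φ → Con φ
  | imp {A B : PTy} (l : List (Form [] B × Form [] A))
      (inc : List (Form [] B × Form [] A) → Prop) :
      (∀ i ∈ l, Con i.1) → (∀ i ∈ l, Con i.2) →
      (∀ J, J.Sublist l → inc J → Ded (Form.conj (J.map Prod.fst)) .bot) →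
      (∀ J, J.Sublist l → ¬ inc J → Con (Form.conj (J.map Prod.snd))) →
      Con (Form.conj (l.map fun i => Form.imp i.1 i.2))

end

/-! ### Semantics of formulae -/

def Modality.sem : {A B : PTy} → Modality A B → Set (Dom A) → Set (Dom B)
  | _, _, .proj₁ (A := A) (B := B), S => {x | Hom.fst (X := Dom A) (Y := Dom B) x ∈ S}
  | _, _, .proj₂ (A := A) (B := B), S => {x | Hom.snd (X := Dom A) (Y := Dom B) x ∈ S}
  | _, _, .inj₁ (A := A) (B := B), S => Hom.inl (X := Dom A) (Y := Dom B) '' S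
  | _, _, .inj₂ (A := A) (B := B), S => Hom.inr (X := Dom A) (Y := Dom B) '' S
  | _, _, .fold (A := A), S => {x | unfoldHom A x ∈ S}

/-- The semantic realizability implication. -/
def semImp {A B : PTy} (S : Set (Dom B)) (T : Set (Dom A)) : Set (Dom (.arrow B A)) :=
  {f | ∀ x ∈ S, Hom.toFun f x ∈ T}

/-- Valuations of the variables of a fixpoint context. -/
abbrev FVal (Φ : List PTy) : Type := ∀ A, FVar Φ A → Set (Dom A)

def FVal.nil : FVal [] := fun _ X => nomatch X

def FVal.cons {Φ : List PTy} {A : PTy} (S : Set (Dom A)) (v : FVal Φ) : FVal (A :: Φ) :=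
  FVar.extend S v

/-- Valuations of iteration variables are extended under a quantifier. -/
def ivalCons (n : ℕ) (ρ : ℕ → ℕ) : ℕ → ℕ
  | 0 => n
  | k + 1 => ρ k

/-- The interpretation of formulae. -/
def Form.sem : {Φ : List PTy} → {A : PTy} → (ℕ → ℕ) → FVal Φ → Form Φ A → Set (Dom A)
  | _, _, _, _, .top => Set.univ
  | _, _, _, _, .bot => ∅
  | _, _, ρ, v, .and φ ψ => φ.sem ρ v ∩ ψ.sem ρ v
  | _, _, ρ, v, .or φ ψ => φ.sem ρ v ∪ ψ.sem ρ v
  | _, _, _, _, .star => {(⊤ : Bool)}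
  | _, _, ρ, v, .mod m φ => m.sem (φ.sem ρ v)
  | _, _, _, v, .var X => v _ X
  | _, _, ρ, v, .iter .mu t φ => (fun S => φ.sem ρ (v.cons S))^[t.sem ρ] ∅
  | _, _, ρ, v, .iter .nu t φ => (fun S => φ.sem ρ (v.cons S))^[t.sem ρ] Set.univ
  | _, _, ρ, v, .ex φ => ⋃ n : ℕ, φ.sem (ivalCons n ρ) v
  | _, _, ρ, v, .all φ => ⋂ n : ℕ, φ.sem (ivalCons n ρ) v
  | _, _, ρ, _, .imp ψ φ => semImp (ψ.sem ρ FVal.nil) (φ.sem ρ FVal.nil)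

/-! ### Refinement types -/

/-- `IsFormula φ`: the raw formula `φ` is positive, negative or neutral. -/
def IsFormula {A : PTy} (φ : Form [] A) : Prop := ∃ s, InL s φ

/-- Refinement types with underlying pure type `A`. -/
inductive RT : PTy → Type
  | pure (A : PTy) : RT A
  | reft {A : PTy} (φ : Form [] A) (hφ : IsFormula φ) : RT A
  | prod {A B : PTy} (T : RT A) (U : RT B) : RT (.prod A B)
  | arrow {A B : PTy} (U : RT B) (T : RT A) : RT (.arrow B A)

/-- Contexts of refinement types. -/
abbrev RCtx : Type := List (Σ A, RT A)

/-- The underlying pure context. -/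
def RCtx.under (Γ : RCtx) : List PTy := Γ.map Sigma.fst

/-- Subtyping. -/
inductive Sub : {A : PTy} → RT A → RT A → Prop
  | refl {A : PTy} {T : RT A} : Sub T T
  | trans {A : PTy} {T U V : RT A} : Sub T U → Sub U V → Sub T V
  | under {A : PTy} {T : RT A} : Sub T (.pure A)
  | top {A : PTy} (h : IsFormula (A := A) .top) : Sub (.pure A) (.reft .top h)
  | ded {A : PTy} {ψ φ : Form [] A} (hψ : IsFormula ψ) (hφ : IsFormula φ) :
      Ded ψ φ → Sub (.reft ψ hψ) (.reft φ hφ)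
  | prod {A B : PTy} {T T' : RT A} {U U' : RT B} :
      Sub T T' → Sub U U' → Sub (.prod T U) (.prod T' U')
  | arrow {A B : PTy} {T T' : RT A} {U U' : RT B} :
      Sub U' U → Sub T T' → Sub (.arrow U T) (.arrow U' T')
  | pureProd {A B : PTy} : Sub (.pure (.prod A B)) (.prod (.pure A) (.pure B))
  | pureArrow {A B : PTy} : Sub (.pure (.arrow B A)) (.arrow (.pure B) (.pure A))
  | reftProd {A B : PTy} {φ : Form [] A} {ψ : Form [] B} (hφ : IsFormula φ) (hψ : IsFormula ψ)
      (h : IsFormula ((φ.mod .proj₁).and (ψ.mod .proj₂))) :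
      Sub (.reft _ h) (.prod (.reft φ hφ) (.reft ψ hψ))
  | prodReft {A B : PTy} {φ : Form [] A} {ψ : Form [] B} (hφ : IsFormula φ) (hψ : IsFormula ψ)
      (h : IsFormula ((φ.mod .proj₁).and (ψ.mod .proj₂))) :
      Sub (.prod (.reft φ hφ) (.reft ψ hψ)) (.reft _ h)
  | reftArrow {A B : PTy} {ψ : Form [] B} {φ : Form [] A} (hψ : IsFormula ψ) (hφ : IsFormula φ)
      (h : IsFormula (Form.imp ψ φ)) :
      Sub (.reft _ h) (.arrow (.reft ψ hψ) (.reft φ hφ))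
  | arrowReft {A B : PTy} {ψ : Form [] B} {φ : Form [] A} (hψ : IsFormula ψ) (hφ : IsFormula φ)
      (h : IsFormula (Form.imp ψ φ)) :
      Sub (.arrow (.reft ψ hψ) (.reft φ hφ)) (.reft _ h)

/-- Pointwise subtyping of contexts. -/
inductive CtxSub : RCtx → RCtx → Prop
  | nil : CtxSub [] []
  | cons {Γ Γ' : RCtx} {A : PTy} {T T' : RT A} :
      Sub T T' → CtxSub Γ Γ' → CtxSub (⟨A, T⟩ :: Γ) (⟨A, T'⟩ :: Γ')

/-- Derivable refinement typing judgements `Γ ⊢ M : T`. -/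
inductive Typing : RCtx → Tm → {A : PTy} → RT A → Prop
  -- basic rules
  | var {Γ : RCtx} {i : ℕ} {A : PTy} {T : RT A} : Lookup Γ i ⟨A, T⟩ → Typing Γ (.var i) T
  | lam {Γ : RCtx} {M : Tm} {A B : PTy} {U : RT B} {T : RT A} :
      Typing (⟨B, U⟩ :: Γ) M T → Typing Γ (.lam M) (.arrow U T)
  | app {Γ : RCtx} {M N : Tm} {A B : PTy} {U : RT B} {T : RT A} :
      Typing Γ M (.arrow U T) → Typing Γ N U → Typing Γ (.app M N) T
  | pair {Γ : RCtx} {M N : Tm} {A B : PTy} {T : RT A} {U : RT B} :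
      Typing Γ M T → Typing Γ N U → Typing Γ (.pair M N) (.prod T U)
  | proj₁ {Γ : RCtx} {M : Tm} {A B : PTy} {T : RT A} {U : RT B} :
      Typing Γ M (.prod T U) → Typing Γ (.proj₁ M) T
  | proj₂ {Γ : RCtx} {M : Tm} {A B : PTy} {T : RT A} {U : RT B} :
      Typing Γ M (.prod T U) → Typing Γ (.proj₂ M) U
  -- rules for pure types
  | star {Γ : RCtx} : Typing Γ .star (.pure .unit)
  | fix {Γ : RCtx} {M : Tm} {A : PTy} :
      Typing (⟨A, .pure A⟩ :: Γ) M (.pure A) → Typing Γ (.fix M) (.pure A)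
  | fold {Γ : RCtx} {M : Tm} {A : Ty 1} :
      Typing Γ M (.pure A.unroll) → Typing Γ (.fold M) (.pure (.mu A))
  | unfold {Γ : RCtx} {M : Tm} {A : Ty 1} :
      Typing Γ M (.pure (.mu A)) → Typing Γ (.unfold M) (.pure A.unroll)
  | inj₁ {Γ : RCtx} {M : Tm} {A B : PTy} :
      Typing Γ M (.pure A) → Typing Γ (.inj₁ M) (.pure (.sum A B))
  | inj₂ {Γ : RCtx} {M : Tm} {A B : PTy} :
      Typing Γ M (.pure B) → Typing Γ (.inj₂ M) (.pure (.sum A B))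
  | case {Γ : RCtx} {M N₁ N₂ : Tm} {A B C : PTy} :
      Typing Γ M (.pure (.sum A B)) → Typing (⟨A, .pure A⟩ :: Γ) N₁ (.pure C) →
      Typing (⟨B, .pure B⟩ :: Γ) N₂ (.pure C) → Typing Γ (.case M N₁ N₂) (.pure C)
  -- rules for refinements
  | starReft {Γ : RCtx} (h : IsFormula .star) : Typing Γ .star (.reft .star h)
  | pairReft₁ {Γ : RCtx} {M N : Tm} {A B : PTy} {φ : Form [] A} (h : IsFormula φ)
      (h' : IsFormula (φ.mod (.proj₁ (B := B)))) :
      Typing Γ M (.reft φ h) → Typing Γ N (.pure B) → Typing Γ (.pair M N) (.reft _ h')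
  | pairReft₂ {Γ : RCtx} {M N : Tm} {A B : PTy} {φ : Form [] B} (h : IsFormula φ)
      (h' : IsFormula (φ.mod (.proj₂ (A := A)))) :
      Typing Γ M (.pure A) → Typing Γ N (.reft φ h) → Typing Γ (.pair M N) (.reft _ h')
  | projReft₁ {Γ : RCtx} {M : Tm} {A B : PTy} {φ : Form [] A} (h : IsFormula φ)
      (h' : IsFormula (φ.mod (.proj₁ (B := B)))) :
      Typing Γ M (.reft _ h') → Typing Γ (.proj₁ M) (.reft φ h)
  | projReft₂ {Γ : RCtx} {M : Tm} {A B : PTy} {φ : Form [] B} (h : IsFormula φ)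
      (h' : IsFormula (φ.mod (.proj₂ (A := A)))) :
      Typing Γ M (.reft _ h') → Typing Γ (.proj₂ M) (.reft φ h)
  | foldReft {Γ : RCtx} {M : Tm} {A : Ty 1} {φ : Form [] A.unroll} (h : IsFormula φ)
      (h' : IsFormula (φ.mod .fold)) :
      Typing Γ M (.reft φ h) → Typing Γ (.fold M) (.reft _ h')
  | unfoldReft {Γ : RCtx} {M : Tm} {A : Ty 1} {φ : Form [] A.unroll} (h : IsFormula φ)
      (h' : IsFormula (φ.mod .fold)) :
      Typing Γ M (.reft _ h') → Typing Γ (.unfold M) (.reft φ h)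
  | injReft₁ {Γ : RCtx} {M : Tm} {A B : PTy} {φ : Form [] A} (h : IsFormula φ)
      (h' : IsFormula (φ.mod (.inj₁ (B := B)))) :
      Typing Γ M (.reft φ h) → Typing Γ (.inj₁ M) (.reft _ h')
  | injReft₂ {Γ : RCtx} {M : Tm} {A B : PTy} {φ : Form [] B} (h : IsFormula φ)
      (h' : IsFormula (φ.mod (.inj₂ (A := A)))) :
      Typing Γ M (.reft φ h) → Typing Γ (.inj₂ M) (.reft _ h')
  | caseReft₁ {Γ : RCtx} {M N₁ N₂ : Tm} {A B C : PTy} {T : RT C} {φ : Form [] A}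
      (h : IsFormula φ) (h' : IsFormula (φ.mod (.inj₁ (B := B)))) :
      Typing Γ M (.reft _ h') → Typing (⟨A, .reft φ h⟩ :: Γ) N₁ T →
      Nonempty (PTyping (B :: Γ.under) N₂ C) → Typing Γ (.case M N₁ N₂) T
  | caseReft₂ {Γ : RCtx} {M N₁ N₂ : Tm} {A B C : PTy} {T : RT C} {φ : Form [] B}
      (h : IsFormula φ) (h' : IsFormula (φ.mod (.inj₂ (A := A)))) :
      Typing Γ M (.reft _ h') → Nonempty (PTyping (A :: Γ.under) N₁ C) →
      Typing (⟨B, .reft φ h⟩ :: Γ) N₂ T → Typing Γ (.case M N₁ N₂) T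
  | fixReft {Γ : RCtx} {M : Tm} {A : PTy} {ψ φ : Form [] A} (hψ : IsFormula ψ)
      (hφ : IsFormula φ) :
      Typing Γ (.fix M) (.reft ψ hψ) → Typing (⟨A, .reft ψ hψ⟩ :: Γ) M (.reft φ hφ) →
      Typing Γ (.fix M) (.reft φ hφ)
  -- logical rules
  | and {Γ : RCtx} {M : Tm} {A : PTy} {φ ψ : Form [] A} (hφ : IsFormula φ) (hψ : IsFormula ψ)
      (h : IsFormula (φ.and ψ)) :
      Typing Γ M (.reft φ hφ) → Typing Γ M (.reft ψ hψ) → Typing Γ M (.reft _ h)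
  | or {Γ Δ : RCtx} {M : Tm} {A B : PTy} {T : RT A} {ψ₁ ψ₂ : Form [] B} (h₁ : IsFormula ψ₁)
      (h₂ : IsFormula ψ₂) (h : IsFormula (ψ₁.or ψ₂)) :
      Typing (Δ ++ ⟨B, .reft ψ₁ h₁⟩ :: Γ) M T → Typing (Δ ++ ⟨B, .reft ψ₂ h₂⟩ :: Γ) M T →
      Typing (Δ ++ ⟨B, .reft _ h⟩ :: Γ) M T
  | bot {Γ Δ : RCtx} {M : Tm} {A B : PTy} {T : RT A} (h : IsFormula (A := B) .bot) :
      Nonempty (PTyping (RCtx.under (Δ ++ ⟨B, .reft .bot h⟩ :: Γ)) M A) →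
      Typing (Δ ++ ⟨B, .reft .bot h⟩ :: Γ) M T
  | sub {Γ Γ' : RCtx} {M : Tm} {A : PTy} {T T' : RT A} :
      CtxSub Γ' Γ → Typing Γ M T → Sub T T' → Typing Γ' M T'

/-- The interpretation of refinement types, under a valuation `ρ` of iteration variables. -/
def RT.sem (ρ : ℕ → ℕ) : {A : PTy} → RT A → Set (Dom A)
  | _, .pure _ => Set.univ
  | _, .reft φ _ => φ.sem ρ FVal.nil
  | _, .prod T U => Modality.sem .proj₁ (T.sem ρ) ∩ Modality.sem .proj₂ (U.sem ρ)
  | _, .arrow U T => semImp (U.sem ρ) (T.sem ρ)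

/-- The tuples `(u₁, …, uₙ)` with `uᵢ ∈ ⟦Uᵢ⟧` for all `i`. -/
def RCtx.sem (ρ : ℕ → ℕ) : (Γ : RCtx) → Set (CtxDom Γ.under)
  | [] => Set.univ
  | ⟨_, T⟩ :: Γ => {u | u.1 ∈ RCtx.sem ρ Γ ∧ u.2 ∈ T.sem ρ}

/-- Sound judgements: the underlying pure judgement is derivable, and the interpretation of the
term maps tuples of elements of the interpreted context types to elements of the interpreted type.
As terms carry no type annotations, the latter is required of every pure typing derivation. -/
def Sound (Γ : RCtx) (M : Tm) {A : PTy} (T : RT A) : Prop :=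
  Nonempty (PTyping Γ.under M A) ∧
    ∀ (d : PTyping Γ.under M A) (ρ : ℕ → ℕ), ∀ u ∈ RCtx.sem ρ Γ, d.sem u ∈ T.sem ρ

end

end FPC

namespace FPC

noncomputable section

-- Finite approximation and the topology of the domains.

section

/-! ### Truncations -/

-- The proof is an induction on the typing derivation. Two points in it are not formal: derivable
-- sequents must be valid, since subtyping appeals to them, and the denotation of a term must not
-- depend on the chosen pure derivation, since terms are not annotated.
--
-- Validity of sequents is topological. Every domain is a bilimit of finite posets, so each element
-- is the supremum of its truncations `trunc k`, each of finite range. Call a set compact open if it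
-- is upward closed and membership survives some truncation; Scott open sets are unions, and compact
-- saturated sets intersections, of these. Neutral formulae denote compact open sets, positive ones
-- Scott open sets, negative ones compact saturated sets (`InL.sem_denotes`); implication exchanges
-- the last two in its premise.
--
-- The rule extracting a witness from a universally quantified premise of an implication is then
-- well-filteredness (`exists_subset_of_iInter_subset`). The one extracting a witness from an
-- existential conclusion is compactness (`CompactOpen.exists_of_semImp_iUnion`). The rules
-- exchanging quantifiers and iterations use the continuity of positive and negative formulae in
-- their fixpoint variables, together with monotonicity in iteration variables.
--
-- For disjunctive or absurd conclusions, a satisfiable formula of the meet fragment denotes a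
-- principal filter (`InMeet.eq_Ici`), so a function out of it is tested at one point. Consistent
-- formulae are satisfiable: for a conjunction of implications, a witness is a supremum of step
-- functions, which exists by bounded completeness (`exists_hom_of_bounded`). Sequents and
-- consistency are treated in one induction, `Ded.sound`.
--
-- Independence of the derivation (`PTyping.sem_eq`) comes from a logical relation between the
-- domains of arbitrary pairs of types, because two derivations may disagree on intermediate types.
-- It is defined on finite approximants, passes to the bilimits, and is equality between a type and
-- itself. It is what lets the rules with two premises about the same term, and the fixpoint rule,
-- combine their induction hypotheses.

theorem step_finite {prev : ∀ {n : ℕ}, Ty n → Cpo} (h : ∀ {n : ℕ} (A : Ty n), Finite (prev A)) :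
    {n : ℕ} → (A : Ty n) → Finite (step prev A)
  | _, .var _ => inferInstanceAs (Finite PUnit)
  | _, .unit => inferInstanceAs (Finite Bool)
  | _, .prod A B =>
    have := step_finite h A
    have := step_finite h B
    inferInstanceAs (Finite (step prev A × step prev B))
  | _, .arrow A B =>
    have := step_finite h A
    have := step_finite h B
    Finite.of_injective (β := step prev A → step prev B) (fun f => Hom.toFun f)
      (fun _ _ h => Hom.ext h)
  | _, .sum A B =>
    have := step_finite h A
    have := step_finite h B
    inferInstanceAs (Finite (Option (step prev A ⊕ step prev B)))
  | _, .mu A => h A.unroll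

theorem approx_finite : (k : ℕ) → ∀ {n : ℕ} (A : Ty n), Finite (approx k A)
  | 0, _, _ => inferInstanceAs (Finite PUnit)
  | k + 1, _, A => step_finite (approx_finite k) A

/-- The `k`-th truncation of an element, the largest element below it which comes from the
`(k+1)`-st approximant. -/
def trunc (k : ℕ) {n : ℕ} (A : Ty n) (x : Dom A) : Dom A :=
  (approxDom k A).e ((approxDom k A).p x)

variable {n : ℕ} {A B : Ty n}

theorem trunc_le (k : ℕ) (x : Dom A) : trunc k A x ≤ x := (approxDom k A).e_p x

theorem trunc_mono (k : ℕ) : Monotone (trunc k A) := fun _ _ h =>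
  (approxDom k A).e.mono ((approxDom k A).p.mono h)

theorem trunc_mono_level (x : Dom A) : Monotone fun k => trunc k A x := fun _ _ h =>
  Chain.Cocone.mono (domCocone A) (domCocone A) x (Nat.succ_le_succ h)

theorem trunc_isLUB (x : Dom A) : IsLUB (Set.range fun k => trunc k A x) x := by
  refine ⟨?_, fun b hb => (domCocone_isColim A x).2 ?_⟩
  · rintro _ ⟨k, rfl⟩
    exact trunc_le k x
  · rintro _ ⟨k, rfl⟩
    cases k with
    | zero => exact bot_le
    | succ k => exact hb ⟨k, rfl⟩

theorem finite_range_trunc (k : ℕ) {n : ℕ} (A : Ty n) : (Set.range (trunc k A)).Finite := by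
  have := approx_finite (k + 1) A
  refine (Set.finite_range (approxDom k A).e.toFun).subset ?_
  rintro _ ⟨x, rfl⟩
  exact ⟨_, rfl⟩

theorem trunc_arrow (k : ℕ) (f : Dom (.arrow A B)) (x : Dom A) :
    Hom.toFun (trunc k (.arrow A B) f) x = trunc k B (Hom.toFun f (trunc k A x)) := rfl

/-- The level moves by one because an approximant of `mu A` is the previous approximant of its
unrolling. Since `unfoldHom` commutes with projections, `x` and its truncation have unfoldings with
the same `k`-th truncation. -/
theorem trunc_unfold_le (k : ℕ) (A : Ty (n + 1)) (x : Dom (.mu A)) :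
    trunc k A.unroll (unfoldHom A x) ≤ unfoldHom A (trunc (k + 1) (.mu A) x) := by
  have h₁ : (approxDom k A.unroll).p (unfoldHom A x) = (approxDom (k + 1) (.mu A)).p x :=
    Chain.Cocone.p_map (unrollCocone A) (domCocone A.unroll) (k + 1) x
  have h₂ : (approxDom k A.unroll).p (unfoldHom A (trunc (k + 1) (.mu A) x)) =
      (approxDom (k + 1) (.mu A)).p (trunc (k + 1) (.mu A) x) :=
    Chain.Cocone.p_map (unrollCocone A) (domCocone A.unroll) (k + 1) _
  have h₃ : (approxDom (k + 1) (.mu A)).p (trunc (k + 1) (.mu A) x) =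
      (approxDom (k + 1) (.mu A)).p x := (approxDom (k + 1) (.mu A)).p_e _
  refine le_trans (le_of_eq ?_) (trunc_le k _)
  change (approxDom k A.unroll).e _ = (approxDom k A.unroll).e _
  rw [h₂, h₃]
  exact congrArg _ h₁

/-! ### Compact open, open and compact saturated sets -/

/-- Compact open sets: the inverse images of upward-closed sets along the projection to a finite
approximant. -/
def CompactOpen (S : Set (Dom A)) : Prop :=
  IsUpperSet S ∧ ∃ k, ∀ x ∈ S, trunc k A x ∈ S

/-- Unions of compact open sets. -/
def ScottOpen (S : Set (Dom A)) : Prop :=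
  ∀ x ∈ S, ∃ Q, CompactOpen Q ∧ x ∈ Q ∧ Q ⊆ S

/-- Intersections of compact open sets. -/
def CompactSat (S : Set (Dom A)) : Prop :=
  ∀ x ∉ S, ∃ Q, CompactOpen Q ∧ x ∉ Q ∧ S ⊆ Q

theorem CompactOpen.scottOpen {S : Set (Dom A)} (h : CompactOpen S) : ScottOpen S :=
  fun _ hx => ⟨S, h, hx, subset_rfl⟩

theorem CompactOpen.compactSat {S : Set (Dom A)} (h : CompactOpen S) : CompactSat S :=
  fun _ hx => ⟨S, h, hx, subset_rfl⟩

theorem ScottOpen.isUpperSet {S : Set (Dom A)} (h : ScottOpen S) : IsUpperSet S := by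
  intro x y hxy hx
  obtain ⟨Q, hQ, hxQ, hQS⟩ := h x hx
  exact hQS (hQ.1 hxy hxQ)

theorem CompactSat.isUpperSet {S : Set (Dom A)} (h : CompactSat S) : IsUpperSet S := by
  intro x y hxy hx
  by_contra hy
  obtain ⟨Q, hQ, hyQ, hSQ⟩ := h y hy
  exact hyQ (hQ.1 hxy (hSQ hx))

theorem trunc_mem_of_le {S : Set (Dom A)} (hS : IsUpperSet S) {k l : ℕ} (h : k ≤ l) {x : Dom A}
    (hx : trunc k A x ∈ S) : trunc l A x ∈ S := hS (trunc_mono_level x h) hx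

theorem ScottOpen.exists_trunc {S : Set (Dom A)} (h : ScottOpen S) {x : Dom A} (hx : x ∈ S) :
    ∃ k, trunc k A x ∈ S := by
  obtain ⟨Q, ⟨-, k, hk⟩, hxQ, hQS⟩ := h x hx
  exact ⟨k, hQS (hk x hxQ)⟩

theorem compactOpen_univ : CompactOpen (Set.univ : Set (Dom A)) :=
  ⟨isUpperSet_univ, 0, fun _ _ => trivial⟩

theorem compactOpen_empty : CompactOpen (∅ : Set (Dom A)) :=
  ⟨isUpperSet_empty, 0, fun _ h => h.elim⟩

theorem CompactOpen.inter {S T : Set (Dom A)} (hS : CompactOpen S) (hT : CompactOpen T) :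
    CompactOpen (S ∩ T) := by
  obtain ⟨hS, k, hk⟩ := hS
  obtain ⟨hT, l, hl⟩ := hT
  exact ⟨hS.inter hT, max k l, fun x hx => ⟨trunc_mem_of_le hS (le_max_left _ _) (hk x hx.1),
    trunc_mem_of_le hT (le_max_right _ _) (hl x hx.2)⟩⟩

theorem CompactOpen.union {S T : Set (Dom A)} (hS : CompactOpen S) (hT : CompactOpen T) :
    CompactOpen (S ∪ T) := by
  obtain ⟨hS, k, hk⟩ := hS
  obtain ⟨hT, l, hl⟩ := hT
  exact ⟨hS.union hT, max k l, fun x hx => hx.imp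
    (fun hx => trunc_mem_of_le hS (le_max_left _ _) (hk x hx))
    (fun hx => trunc_mem_of_le hT (le_max_right _ _) (hl x hx))⟩

theorem ScottOpen.inter {S T : Set (Dom A)} (hS : ScottOpen S) (hT : ScottOpen T) :
    ScottOpen (S ∩ T) := by
  rintro x ⟨hxS, hxT⟩
  obtain ⟨Q, hQ, hxQ, hQS⟩ := hS x hxS
  obtain ⟨R, hR, hxR, hRT⟩ := hT x hxT
  exact ⟨Q ∩ R, hQ.inter hR, ⟨hxQ, hxR⟩, Set.inter_subset_inter hQS hRT⟩

theorem ScottOpen.iUnion {ι : Sort*} {S : ι → Set (Dom A)} (h : ∀ i, ScottOpen (S i)) :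
    ScottOpen (⋃ i, S i) := by
  intro x hx
  obtain ⟨i, hi⟩ := Set.mem_iUnion.1 hx
  obtain ⟨Q, hQ, hxQ, hQS⟩ := h i x hi
  exact ⟨Q, hQ, hxQ, hQS.trans (Set.subset_iUnion S i)⟩

theorem ScottOpen.union {S T : Set (Dom A)} (hS : ScottOpen S) (hT : ScottOpen T) :
    ScottOpen (S ∪ T) := by
  rw [Set.union_eq_iUnion]
  exact ScottOpen.iUnion (by rintro (_ | _) <;> assumption)

theorem CompactSat.union {S T : Set (Dom A)} (hS : CompactSat S) (hT : CompactSat T) :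
    CompactSat (S ∪ T) := by
  intro x hx
  obtain ⟨Q, hQ, hxQ, hQS⟩ := hS x fun h => hx (Or.inl h)
  obtain ⟨R, hR, hxR, hRT⟩ := hT x fun h => hx (Or.inr h)
  exact ⟨Q ∪ R, hQ.union hR, fun h => h.elim hxQ hxR, Set.union_subset_union hQS hRT⟩

theorem CompactSat.iInter {ι : Sort*} {S : ι → Set (Dom A)} (h : ∀ i, CompactSat (S i)) :
    CompactSat (⋂ i, S i) := by
  intro x hx
  obtain ⟨i, hi⟩ : ∃ i, x ∉ S i := by simpa using hx
  obtain ⟨Q, hQ, hxQ, hQS⟩ := h i x hi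
  exact ⟨Q, hQ, hxQ, (Set.iInter_subset S i).trans hQS⟩

theorem CompactSat.inter {S T : Set (Dom A)} (hS : CompactSat S) (hT : CompactSat T) :
    CompactSat (S ∩ T) := by
  rw [Set.inter_eq_iInter]
  exact CompactSat.iInter (by rintro (_ | _) <;> assumption)

/-! ### Modalities -/

theorem Modality.sem_mono {A B : PTy} (m : Modality A B) : Monotone m.sem := by
  intro S T h
  cases m with
  | proj₁ => exact fun x hx => h hx
  | proj₂ => exact fun x hx => h hx
  | inj₁ => exact Set.image_mono h
  | inj₂ => exact Set.image_mono h
  | fold => exact fun x hx => h hx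

theorem inl_injective {X Y : Cpo} : Function.Injective (Hom.inl (X := X) (Y := Y)) := by
  intro x y h
  have h' : (some (Sum.inl x) : Option (X ⊕ Y)) = some (Sum.inl y) := h
  simpa using h'

theorem inr_injective {X Y : Cpo} : Function.Injective (Hom.inr (X := X) (Y := Y)) := by
  intro x y h
  have h' : (some (Sum.inr x) : Option (X ⊕ Y)) = some (Sum.inr y) := h
  simpa using h'

theorem inl_ne_inr {X Y : Cpo} (x : X) (y : Y) :
    Hom.inl (X := X) (Y := Y) x ≠ Hom.inr (X := X) (Y := Y) y := by
  intro h
  have h' : (some (Sum.inl x) : Option (X ⊕ Y)) = some (Sum.inr y) := h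
  simp at h'

theorem Modality.compactOpen {A B : PTy} (m : Modality A B) {S : Set (Dom A)}
    (h : CompactOpen S) : CompactOpen (m.sem S) := by
  obtain ⟨hS, k, hk⟩ := h
  cases m with
  | proj₁ => exact ⟨fun x y hxy hx => hS (Hom.fst.mono hxy) hx, k, fun x hx => hk _ hx⟩
  | proj₂ => exact ⟨fun x y hxy hx => hS (Hom.snd.mono hxy) hx, k, fun x hx => hk _ hx⟩
  | inj₁ =>
    refine ⟨?_, k, ?_⟩
    · rintro _ y hxy ⟨x, hx, rfl⟩
      obtain ⟨y, rfl⟩ := Cpo.WSum.inl_up _ _ hxy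
      exact ⟨y, hS ((Cpo.WSum.inl_le _ _).1 hxy) hx, rfl⟩
    · rintro _ ⟨x, hx, rfl⟩
      exact ⟨_, hk x hx, rfl⟩
  | inj₂ =>
    refine ⟨?_, k, ?_⟩
    · rintro _ y hxy ⟨x, hx, rfl⟩
      obtain ⟨y, rfl⟩ := Cpo.WSum.inr_up _ _ hxy
      exact ⟨y, hS ((Cpo.WSum.inr_le _ _).1 hxy) hx, rfl⟩
    · rintro _ ⟨x, hx, rfl⟩
      exact ⟨_, hk x hx, rfl⟩
  -- Unfolding consumes one level, so the inverse image is determined at level `k + 1`.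
  | fold =>
    exact ⟨fun x y hxy hx => hS ((unfoldHom _).mono hxy) hx, k + 1,
      fun x hx => hS (trunc_unfold_le k _ x) (hk _ hx)⟩

theorem Modality.sem_iUnion {A B : PTy} (m : Modality A B) {ι : Sort*} (S : ι → Set (Dom A)) :
    m.sem (⋃ i, S i) = ⋃ i, m.sem (S i) := by
  cases m with
  | inj₁ => exact Set.image_iUnion
  | inj₂ => exact Set.image_iUnion
  | _ => ext x; simp [Modality.sem]

/-- The index type must be non-empty for the injections, whose image of the whole domain is not the
whole domain; injectivity does the rest. -/
theorem Modality.sem_iInter {A B : PTy} (m : Modality A B) {ι : Sort*} [Nonempty ι]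
    (S : ι → Set (Dom A)) : m.sem (⋂ i, S i) = ⋂ i, m.sem (S i) := by
  cases m with
  | inj₁ => exact inl_injective.injOn.image_iInter_eq
  | inj₂ => exact inr_injective.injOn.image_iInter_eq
  | _ => ext x; simp [Modality.sem]

theorem Modality.scottOpen {A B : PTy} (m : Modality A B) {S : Set (Dom A)}
    (h : ScottOpen S) : ScottOpen (m.sem S) := by
  have e : S = ⋃ Q : {Q : Set (Dom A) // CompactOpen Q ∧ Q ⊆ S}, Q.1 := by
    refine subset_antisymm ?_ (Set.iUnion_subset fun Q => Q.2.2)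
    intro x hx
    obtain ⟨Q, hQ, hxQ, hQS⟩ := h x hx
    exact Set.mem_iUnion.2 ⟨⟨Q, hQ, hQS⟩, hxQ⟩
  rw [e, m.sem_iUnion]
  exact ScottOpen.iUnion fun Q => (m.compactOpen Q.2.1).scottOpen

theorem Modality.compactSat {A B : PTy} (m : Modality A B) {S : Set (Dom A)}
    (h : CompactSat S) : CompactSat (m.sem S) := by
  have e : S = ⋂ Q : {Q : Set (Dom A) // CompactOpen Q ∧ S ⊆ Q}, Q.1 := by
    refine subset_antisymm (Set.subset_iInter fun Q => Q.2.2) ?_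
    intro x hx
    by_contra hxS
    obtain ⟨Q, hQ, hxQ, hQS⟩ := h x hxS
    exact hxQ (Set.mem_iInter.1 hx ⟨Q, hQ, hQS⟩)
  have : Nonempty {Q : Set (Dom A) // CompactOpen Q ∧ S ⊆ Q} :=
    ⟨⟨_, compactOpen_univ, Set.subset_univ _⟩⟩
  rw [e, m.sem_iInter]
  exact CompactSat.iInter fun Q => (m.compactOpen Q.2.1).compactSat

/-! ### Well-filteredness -/

/-- A family of elements of the approximants which is coherent along the projections is the family
of projections of an element. -/
theorem exists_of_coherent (z : ∀ k, approx (k + 1) A)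
    (hz : ∀ k, (approxEP (k + 1) A).p (z (k + 1)) = z k) :
    ∃ x : Dom A, ∀ k, (approxDom k A).p x = z k := by
  -- The chain has the one-point approximant at index `0`, so the given family fills the indices
  -- from `1` on.
  let y : (approxChain A).lim :=
    (⟨fun k => Nat.casesOn k PUnit.unit z, fun k => by
      cases k with
      | zero => rfl
      | succ k => exact hz k⟩ : (approxChain A).Seq)
  refine ⟨(approxChain A).limCocone.map (domCocone A) y, fun k => ?_⟩
  refine (Chain.Cocone.p_map (approxChain A).limCocone (domCocone A) (k + 1) y).trans ?_
  exact Chain.cone_p (k + 1) (approxChain A) y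

/-- Each compact open superset of `S` inspects only one truncation, so it cannot separate `x` from a
point of `S` with that truncation. This is the closure property that puts limits of points into
compact saturated sets. -/
theorem CompactSat.mem_of_trunc {S : Set (Dom A)} (h : CompactSat S) {x : Dom A}
    (hx : ∀ k, ∃ y ∈ S, trunc k A y = trunc k A x) : x ∈ S := by
  by_contra hxS
  obtain ⟨Q, ⟨hQ, k, hk⟩, hxQ, hSQ⟩ := h x hxS
  obtain ⟨y, hy, e⟩ := hx k
  exact hxQ (hQ (trunc_le k x) (e ▸ hk y (hSQ hy)))

/-- An open set which contains the intersection of a descending sequence of compact saturated sets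
contains one of them. -/
theorem exists_subset_of_iInter_subset {S : ℕ → Set (Dom A)} (hS : ∀ i, CompactSat (S i))
    (hanti : Antitone S) {U : Set (Dom A)} (hU : ScottOpen U) (h : ⋂ i, S i ⊆ U) :
    ∃ i, S i ⊆ U := by
  by_contra! hne
  have hx : ∀ i, ∃ x ∈ S i, x ∉ U := fun i => Set.not_subset.1 (hne i)
  choose x hxS hxU using hx
  -- A limit of counterexamples is taken along a non-principal ultrafilter: each approximant is
  -- finite, so each projection of `x i` is constant on a set of the ultrafilter, and the constants
  -- are coherent.
  let F : Ultrafilter ℕ := Filter.hyperfilter ℕ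
  have hz : ∀ k, ∃ z, ∀ᶠ i in F, (approxDom k A).p (x i) = z := by
    intro k
    have := approx_finite (k + 1) A
    have h := (Ultrafilter.eventually_exists_iff (f := F)
      (P := fun (z : approx (k + 1) A) i => (approxDom k A).p (x i) = z)).1
      (Filter.Eventually.of_forall fun i => ⟨_, rfl⟩)
    exact h
  choose z hz using hz
  obtain ⟨y, hy⟩ := exists_of_coherent z fun k => by
    obtain ⟨i, h₁, h₂⟩ := ((hz k).and (hz (k + 1))).exists
    rw [← h₁, ← h₂]
    exact (approxDom_comm k A).2 (x i)
  have key : ∀ k, ∀ᶠ i in F, trunc k A (x i) = trunc k A y := fun k =>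
    (hz k).mono fun i hi => by
      unfold trunc
      rw [hi, hy]
  have hyU : y ∈ U := by
    refine h (Set.mem_iInter.2 fun i => (hS i).mem_of_trunc fun k => ?_)
    -- The ultrafilter contains all final segments, so the points agreeing with `y` at level `k` can
    -- be taken late enough to lie in `S i`.
    have hge : ∀ᶠ j in F, i ≤ j :=
      (Filter.hyperfilter_le_cofinite.trans_eq Nat.cofinite_eq_atTop) (Filter.eventually_ge_atTop i)
    obtain ⟨j, h₁, h₂⟩ := ((key k).and hge).exists
    exact ⟨x j, hanti h₂ (hxS j), h₁⟩
  obtain ⟨k, hk⟩ := hU.exists_trunc hyU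
  obtain ⟨i, hi⟩ := (key k).exists
  exact hxU i (hU.isUpperSet (trunc_le k _) (hi ▸ hk))

end

-- Compact elements, function spaces and bounded completeness.

section

variable {n : ℕ} {A B : Ty n}

/-! ### Compact elements -/

def truncHom (k : ℕ) {n : ℕ} (A : Ty n) : Hom (Dom A) (Dom A) :=
  (approxDom k A).e.comp (approxDom k A).p

/-- Directed suprema are attained after truncation. -/
theorem exists_trunc_eq {d : Set (Dom A)} (hne : d.Nonempty) (hd : DirectedOn (· ≤ ·) d)
    {a : Dom A} (ha : IsLUB d a) (k : ℕ) : ∃ x ∈ d, trunc k A x = trunc k A a := by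
  have hfin : (trunc k A '' d).Finite :=
    (finite_range_trunc k A).subset (Set.image_subset_range _ _)
  -- Only finitely many truncations occur; a maximal one is greatest by directedness, hence equals
  -- the truncation of the supremum.
  obtain ⟨_, ⟨x, hx, rfl⟩, hmax⟩ := hfin.exists_maximal (hne.image _)
  refine ⟨x, hx, le_antisymm (trunc_mono k (ha.1 hx)) ?_⟩
  refine ((truncHom k A).cont hne hd ha).2 ?_
  rintro _ ⟨y, hy, rfl⟩
  obtain ⟨w, hw, hxw, hyw⟩ := hd x hx y hy
  exact (trunc_mono k hyw).trans (hmax ⟨w, hw, rfl⟩ (trunc_mono k hxw))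

theorem trunc_trunc (k : ℕ) (x : Dom A) : trunc k A (trunc k A x) = trunc k A x :=
  congrArg (approxDom k A).e ((approxDom k A).p_e _)

/-- These sets surround `S` from outside and shrink as `k` grows; for a singleton they are basic
neighbourhoods of a point. -/
theorem compactOpen_trunc_le (k : ℕ) (S : Set (Dom A)) :
    CompactOpen {x | ∃ y ∈ S, trunc k A y ≤ x} := by
  refine ⟨fun x x' hx ⟨y, hy, h⟩ => ⟨y, hy, h.trans hx⟩, k, fun x ⟨y, hy, h⟩ => ⟨y, hy, ?_⟩⟩
  rw [← trunc_trunc]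
  exact trunc_mono k h

/-- The inner counterpart: truncations lie below their argument, so this set is contained in `S`. -/
theorem compactOpen_trunc_mem (k : ℕ) {S : Set (Dom A)} (hS : IsUpperSet S) :
    CompactOpen {x | trunc k A x ∈ S} :=
  ⟨fun _ _ hxy hx => hS (trunc_mono k hxy) hx, k, fun x hx => by
    rwa [Set.mem_ofPred_eq, trunc_trunc]⟩

/-- By continuity, a truncation of `f x` that is already in `S` is also a truncation of `f` at some
truncation of `x`; everything above the latter is mapped into `S`. -/
theorem ScottOpen.preimage {S : Set (Dom B)} (hS : ScottOpen S) (f : Hom (Dom A) (Dom B)) :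
    ScottOpen {x | f x ∈ S} := by
  intro x hx
  obtain ⟨m, hm⟩ := hS.exists_trunc hx
  have hd := (trunc_mono_level x).directed_le.directedOn_range
  obtain ⟨_, ⟨_, ⟨k, rfl⟩, rfl⟩, hk⟩ := exists_trunc_eq ((Set.range_nonempty _).image f.toFun)
    (hd.mono_comp f.mono) (f.cont (Set.range_nonempty _) hd (trunc_isLUB x)) m
  refine ⟨_, compactOpen_trunc_le k {x}, ⟨x, rfl, trunc_le k x⟩, ?_⟩
  rintro y ⟨_, rfl, hy⟩
  exact hS.isUpperSet ((trunc_le m _).trans (f.mono hy)) (hk ▸ hm)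

/-! ### Realizability implication -/

theorem semImp_mono {A B : PTy} {S S' : Set (Dom B)} {T T' : Set (Dom A)} (hS : S' ⊆ S)
    (hT : T ⊆ T') : semImp S T ⊆ semImp S' T' := fun _ hf x hx => hT (hf x (hS hx))

/-- A truncated function truncates both its argument and its result, so one level large enough for
both sets suffices. -/
theorem CompactOpen.semImp {A B : PTy} {S : Set (Dom B)} {T : Set (Dom A)} (hS : CompactOpen S)
    (hT : CompactOpen T) : CompactOpen (semImp S T) := by
  obtain ⟨hS, k, hk⟩ := hS
  obtain ⟨hT, l, hl⟩ := hT
  refine ⟨fun f g hfg hf x hx => hT (hfg x) (hf x hx), max k l, fun f hf x hx => ?_⟩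
  rw [trunc_arrow]
  refine trunc_mem_of_le hT (le_max_right k l) (hl _ (hf _ ?_))
  exact trunc_mem_of_le hS (le_max_left k l) (hk x hx)

/-- A function outside fails at one point. Shrinking `S` to a compact open neighbourhood of that
point and enlarging `T` to a compact open set missing its image gives a separating compact open
implication. -/
theorem CompactSat.semImp {A B : PTy} {S : Set (Dom B)} {T : Set (Dom A)} (hS : ScottOpen S)
    (hT : CompactSat T) : CompactSat (semImp S T) := by
  intro f hf
  obtain ⟨x, hx, hfx⟩ : ∃ x ∈ S, Hom.toFun f x ∉ T := by simpa [FPC.semImp] using hf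
  obtain ⟨R, hR, hxR, hRS⟩ := hS x hx
  obtain ⟨Q, hQ, hfQ, hTQ⟩ := hT _ hfx
  exact ⟨_, hR.semImp hQ, fun h => hfQ (h x hxR), semImp_mono hRS hTQ⟩

/-- A compact saturated set contained in an open set has a compact open neighbourhood contained in
that set. -/
theorem CompactSat.exists_compactOpen {S U : Set (Dom A)} (hS : CompactSat S) (hU : ScottOpen U)
    (h : S ⊆ U) : ∃ k, {x | ∃ y ∈ S, trunc k A y ≤ x} ⊆ U := by
  -- The outer approximations of `S` form a descending sequence of compact open sets, and their
  -- intersection lies in `S` because `S` is an intersection of compact open sets.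
  refine exists_subset_of_iInter_subset (S := fun k => {x | ∃ y ∈ S, trunc k A y ≤ x})
    (fun k => (compactOpen_trunc_le k S).compactSat) ?_ hU ?_
  · rintro k l hkl x ⟨y, hy, hyx⟩
    exact ⟨y, hy, (trunc_mono_level y hkl).trans hyx⟩
  · intro x hx
    refine h ?_
    by_contra hxS
    obtain ⟨Q, ⟨hQ, k, hk⟩, hxQ, hSQ⟩ := hS x hxS
    obtain ⟨y, hy, hyx⟩ := Set.mem_iInter.1 hx k
    exact hxQ (hQ hyx (hk y (hSQ hy)))

/-- The open set `f⁻¹(T)` contains an outer approximation of `S`, generated by finitely many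
truncated points. One level `M` keeps all their images in `T` after truncation, which yields a
compact open neighbourhood of `f`. -/
theorem ScottOpen.semImp {A B : PTy} {S : Set (Dom B)} {T : Set (Dom A)} (hS : CompactSat S)
    (hT : ScottOpen T) : ScottOpen (semImp S T) := by
  intro f hf
  obtain ⟨k, hk⟩ := hS.exists_compactOpen (hT.preimage f) hf
  have hfin : (trunc k B '' S).Finite :=
    (finite_range_trunc k B).subset (Set.image_subset_range _ _)
  have hm : ∀ y : Dom B, y ∈ trunc k B '' S → ∃ m, trunc m A (Hom.toFun f y) ∈ T := by
    rintro _ ⟨y, hy, rfl⟩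
    exact hT.exists_trunc (hk ⟨y, hy, le_rfl⟩)
  choose! m hm using hm
  obtain ⟨M, hM⟩ := (hfin.image m).bddAbove
  refine ⟨_, (compactOpen_trunc_le k S).semImp (compactOpen_trunc_mem M hT.isUpperSet), ?_, ?_⟩
  · rintro x ⟨y, hy, hyx⟩
    have h := trunc_mem_of_le hT.isUpperSet (hM ⟨_, ⟨y, hy, rfl⟩, rfl⟩) (hm _ ⟨y, hy, rfl⟩)
    exact hT.isUpperSet (trunc_mono M (Hom.mono f hyx)) h
  · exact semImp_mono (fun y hy => ⟨y, hy, trunc_le k y⟩)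
      fun x hx => hT.isUpperSet (trunc_le M x) hx

/-- Compactness of compact open sets, for sequences of open sets. -/
theorem CompactOpen.exists_of_semImp_iUnion {A B : PTy} {S : Set (Dom B)} (hS : CompactOpen S)
    {T : ℕ → Set (Dom A)} (hT : ∀ i, IsUpperSet (T i)) (hmono : Monotone T)
    {f : Dom (.arrow B A)} (hf : f ∈ FPC.semImp S (⋃ i, T i)) : ∃ i, f ∈ FPC.semImp S (T i) := by
  obtain ⟨hS, k, hk⟩ := hS
  have hfin : (trunc k B '' S).Finite :=
    (finite_range_trunc k B).subset (Set.image_subset_range _ _)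
  have hm : ∀ y : Dom B, y ∈ trunc k B '' S → ∃ i, Hom.toFun f y ∈ T i := by
    rintro _ ⟨y, hy, rfl⟩
    exact Set.mem_iUnion.1 (hf _ (hk y hy))
  choose! m hm using hm
  obtain ⟨M, hM⟩ := (hfin.image m).bddAbove
  -- Each point of `S` lies above one of the finitely many truncated points, whose indices `M`
  -- bounds.
  refine ⟨M, fun y hy => hT M (Hom.mono f (trunc_le k y)) ?_⟩
  exact hmono (hM ⟨_, ⟨y, hy, rfl⟩, rfl⟩) (hm _ ⟨y, hy, rfl⟩)

/-! ### Bounded completeness -/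

/-- Every bounded set has a supremum. -/
def BoundedComplete (X : Cpo) : Prop := ∀ s : Set X, BddAbove s → ∃ a, IsLUB s a

theorem boundedComplete_one : BoundedComplete Cpo.one := fun _ _ =>
  ⟨PUnit.unit, fun _ _ => le_rfl, fun _ _ => le_rfl⟩

theorem boundedComplete_two : BoundedComplete Cpo.two := fun s _ =>
  ⟨_, isLUB_sSup (α := Bool) s⟩

theorem BoundedComplete.prod {X Y : Cpo} (hX : BoundedComplete X) (hY : BoundedComplete Y) :
    BoundedComplete (Cpo.prod X Y) := by
  rintro s ⟨c, hc⟩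
  obtain ⟨a, ha⟩ := hX (Prod.fst '' (s : Set (X × Y))) ⟨c.1, by
    rintro _ ⟨x, hx, rfl⟩
    exact (hc hx).1⟩
  obtain ⟨b, hb⟩ := hY (Prod.snd '' (s : Set (X × Y))) ⟨c.2, by
    rintro _ ⟨x, hx, rfl⟩
    exact (hc hx).2⟩
  exact ⟨(a, b), isLUB_prod.2 ⟨ha, hb⟩⟩

theorem BoundedComplete.exp {X Y : Cpo} (hY : BoundedComplete Y) :
    BoundedComplete (Cpo.exp X Y) := by
  rintro s ⟨c, hc⟩
  have h : ∀ x, ∃ a, IsLUB (Set.range fun f : s => Hom.toFun f.1 x) a := fun x =>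
    hY _ ⟨Hom.toFun c x, by
      rintro _ ⟨f, rfl⟩
      exact hc f.2 x⟩
  choose g hg using h
  refine ⟨(⟨g, scottContinuous_of_isLUB _ (fun f : s => Hom.cont f.1) g hg⟩ : Hom X Y), ?_, ?_⟩
  · intro f hf x
    exact (hg x).1 ⟨⟨f, hf⟩, rfl⟩
  · intro b hb x
    refine (hg x).2 ?_
    rintro _ ⟨f, rfl⟩
    exact hb f.2 x

/-- This serves the two injections of a sum: a bounded set meeting one summand can contain, besides
elements of that summand, only the bottom element. -/
theorem BoundedComplete.exists_isLUB_of_embedding {X : Cpo} (hX : BoundedComplete X) {Z : Type}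
    [PartialOrder Z] (j : X → Z) (hj : ∀ x y, j x ≤ j y ↔ x ≤ y)
    (hup : ∀ x z, j x ≤ z → ∃ y, z = j y) {s : Set Z} (hs : BddAbove s) {x₀ : X} (hx₀ : j x₀ ∈ s)
    (hbot : ∀ z ∈ s, (∃ x, z = j x) ∨ ∀ x, z ≤ j x) : ∃ a, IsLUB s a := by
  obtain ⟨c, hc⟩ := hs
  obtain ⟨c, rfl⟩ := hup _ _ (hc hx₀)
  obtain ⟨a, ha⟩ := hX {x | j x ∈ s} ⟨c, fun x hx => (hj _ _).1 (hc hx)⟩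
  refine ⟨j a, fun z hz => ?_, fun b hb => ?_⟩
  · rcases hbot z hz with ⟨x, rfl⟩ | h
    · exact (hj _ _).2 (ha.1 hz)
    · exact h a
  · obtain ⟨b, rfl⟩ := hup _ _ (hb hx₀)
    exact (hj _ _).2 (ha.2 fun x hx => (hj _ _).1 (hb hx))

theorem BoundedComplete.sum {X Y : Cpo} (hX : BoundedComplete X) (hY : BoundedComplete Y) :
    BoundedComplete (Cpo.sum X Y) := by
  intro s hs
  change ∃ a : Cpo.WSum X Y, IsLUB (s : Set (Cpo.WSum X Y)) a
  have hs' : BddAbove (s : Set (Cpo.WSum X Y)) := hs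
  rcases Cpo.WSum.trichotomy (s : Set (Cpo.WSum X Y)) with ⟨x, hx⟩ | ⟨y, hy⟩ | h
  · refine hX.exists_isLUB_of_embedding Cpo.WSum.inl Cpo.WSum.inl_le Cpo.WSum.inl_up hs' hx ?_
    intro z hz
    obtain ⟨c, hc⟩ := hs'
    obtain ⟨c, rfl⟩ := Cpo.WSum.inl_up _ _ (hc hx)
    rcases Cpo.WSum.cases z with rfl | h | ⟨y, rfl⟩
    · exact Or.inr fun _ => bot_le
    · exact Or.inl h
    · obtain ⟨d, hd⟩ := Cpo.WSum.inr_up _ _ (hc hz)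
      exact absurd hd (inl_ne_inr c d)
  · refine hY.exists_isLUB_of_embedding Cpo.WSum.inr Cpo.WSum.inr_le Cpo.WSum.inr_up hs' hy ?_
    intro z hz
    obtain ⟨c, hc⟩ := hs'
    obtain ⟨c, rfl⟩ := Cpo.WSum.inr_up _ _ (hc hy)
    rcases Cpo.WSum.cases z with rfl | ⟨x, rfl⟩ | h
    · exact Or.inr fun _ => bot_le
    · obtain ⟨d, hd⟩ := Cpo.WSum.inl_up _ _ (hc hz)
      exact absurd hd.symm (inl_ne_inr d c)
    · exact Or.inl h
  · exact ⟨⊥, fun z hz => (h z hz).le, fun _ _ => bot_le⟩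

theorem step_boundedComplete {prev : ∀ {n : ℕ}, Ty n → Cpo}
    (h : ∀ {n : ℕ} (A : Ty n), BoundedComplete (prev A)) :
    {n : ℕ} → (A : Ty n) → BoundedComplete (step prev A)
  | _, .var _ => boundedComplete_one
  | _, .unit => boundedComplete_two
  | _, .prod A B => (step_boundedComplete h A).prod (step_boundedComplete h B)
  | _, .arrow _ B => (step_boundedComplete h B).exp
  | _, .sum A B => (step_boundedComplete h A).sum (step_boundedComplete h B)
  | _, .mu A => h A.unroll

theorem approx_boundedComplete : (k : ℕ) → ∀ {n : ℕ} (A : Ty n), BoundedComplete (approx k A)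
  | 0, _, _ => boundedComplete_one
  | k + 1, _, A => step_boundedComplete (approx_boundedComplete k) A

/-- Embeddings are left adjoint to projections, hence preserve the suprema formed in the
approximants. -/
theorem EP.e_le_iff {X Y : Cpo} (c : EP X Y) {x : X} {y : Y} : c.e x ≤ y ↔ x ≤ c.p y :=
  ⟨fun h => (c.p_e x).ge.trans (c.p.mono h), fun h => (c.e.mono h).trans (c.e_p y)⟩

/-- At each level the truncations have a supremum, embedded from the approximant. These suprema
increase with the level, and their directed supremum is the one sought. -/
theorem dom_boundedComplete {n : ℕ} (A : Ty n) : BoundedComplete (Dom A) := by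
  rintro s ⟨c, hc⟩
  have h : ∀ k, ∃ a : Dom A, IsLUB (trunc k A '' s) a := by
    intro k
    obtain ⟨z, hz⟩ := approx_boundedComplete (k + 1) A ((approxDom k A).p.toFun '' s)
      ⟨(approxDom k A).p c, by
        rintro _ ⟨x, hx, rfl⟩
        exact (approxDom k A).p.mono (hc hx)⟩
    refine ⟨(approxDom k A).e z, ?_, fun b hb => ?_⟩
    · rintro _ ⟨x, hx, rfl⟩
      exact (approxDom k A).e.mono (hz.1 ⟨x, hx, rfl⟩)
    · refine (approxDom k A).e_le_iff.2 (hz.2 ?_)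
      rintro _ ⟨x, hx, rfl⟩
      exact (approxDom k A).e_le_iff.1 (hb ⟨x, hx, rfl⟩)
  choose a ha using h
  have hmono : Monotone a := by
    intro k l hkl
    refine (ha k).2 ?_
    rintro _ ⟨x, hx, rfl⟩
    exact (trunc_mono_level x hkl).trans ((ha l).1 ⟨x, hx, rfl⟩)
  have hl := hmono.directed_le.directedOn_range.isLUB_sSup
  refine ⟨_, fun x hx => (trunc_isLUB x).2 ?_, fun b hb => hl.2 ?_⟩
  · rintro _ ⟨k, rfl⟩
    exact ((ha k).1 ⟨x, hx, rfl⟩).trans (hl.1 ⟨k, rfl⟩)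
  · rintro _ ⟨k, rfl⟩
    refine (ha k).2 ?_
    rintro _ ⟨x, hx, rfl⟩
    exact (trunc_le k x).trans (hb hx)

/-! ### Step functions -/

/-- The least function which maps `a` above `b`. -/
def stepFun (a : Dom A) (b : Dom B) (x : Dom A) : Dom B := open Classical in if a ≤ x then b else ⊥

/-- The hypothesis says that `a` is a compact element: it lies below its own `k`-th truncation. A
directed set with supremum above `a` attains that supremum at level `k`, so it has a member above
`a`. -/
theorem stepFun_cont {a : Dom A} (ha : CompactOpen (Set.Ici a)) (b : Dom B) :
    ScottContinuous (stepFun a b) := by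
  obtain ⟨-, k, hk⟩ := ha
  intro d hne hd c hc
  refine ⟨?_, fun y hy => ?_⟩
  · rintro _ ⟨x, hx, rfl⟩
    unfold stepFun
    split_ifs with h₁ h₂
    · exact le_rfl
    · exact absurd (h₁.trans (hc.1 hx)) h₂
    · exact bot_le
    · exact bot_le
  · unfold stepFun
    split_ifs with h
    · obtain ⟨x, hx, e⟩ := exists_trunc_eq hne hd hc k
      have hax : a ≤ x :=
        (hk a le_rfl).trans (((trunc_mono k h).trans_eq e.symm).trans (trunc_le k x))
      refine le_trans (le_of_eq ?_) (hy ⟨x, hx, rfl⟩)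
      rw [stepFun, if_pos hax]
    · exact bot_le

/-- A family of conditions `f(aᵢ) ≥ bᵢ` is satisfied by a continuous function as soon as the
`bᵢ` with `aᵢ ≤ x` are bounded for all `x`. -/
theorem exists_hom_of_bounded {ι : Type*} (a : ι → Dom A) (b : ι → Dom B)
    (ha : ∀ i, CompactOpen (Set.Ici (a i))) (h : ∀ x, ∃ c, ∀ i, a i ≤ x → b i ≤ c) :
    ∃ f : Hom (Dom A) (Dom B), (∀ i x, a i ≤ x → b i ≤ f x) ∧
      ∀ g : Hom (Dom A) (Dom B), (∀ i, b i ≤ g (a i)) → f ≤ g := by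
  -- The function is the pointwise supremum of the step functions. Bounded completeness supplies the
  -- values, and taking least upper bounds also gives minimality.
  have hb : ∀ x, ∃ c, IsLUB (Set.range fun i => stepFun (a i) (b i) x) c := by
    intro x
    obtain ⟨c, hc⟩ := h x
    refine dom_boundedComplete B _ ⟨c, ?_⟩
    rintro _ ⟨i, rfl⟩
    unfold stepFun
    dsimp only
    split_ifs with hi
    · exact hc i hi
    · exact bot_le
  choose f hf using hb
  refine ⟨⟨f, scottContinuous_of_isLUB _ (fun i => stepFun_cont (ha i) (b i)) f hf⟩, ?_, ?_⟩
  · intro i x hi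
    refine le_trans (le_of_eq ?_) ((hf x).1 ⟨i, rfl⟩)
    simp only [stepFun, if_pos hi]
  · intro g hg x
    refine (hf x).2 ?_
    rintro _ ⟨i, rfl⟩
    unfold stepFun
    dsimp only
    split_ifs with hi
    · exact (hg i).trans (g.mono hi)
    · exact bot_le

end

-- Formulae as monotone and continuous operators on sets.

section

/-! ### Substitution -/

theorem ITm.sem_subst (σ : ℕ → ITm) (ρ : ℕ → ℕ) (t : ITm) :
    (t.subst σ).sem ρ = t.sem fun k => (σ k).sem ρ := by
  induction t with
  | var k => rfl
  | zero => rfl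
  | succ t ih => exact congrArg (· + 1) ih

theorem ITm.sem_up (σ : ℕ → ITm) (ρ : ℕ → ℕ) (i : ℕ) :
    (fun k => (ITm.up σ k).sem (ivalCons i ρ)) = ivalCons i fun k => (σ k).sem ρ := by
  funext k
  cases k with
  | zero => rfl
  | succ k => exact ITm.sem_subst _ _ _

theorem ITm.sem_inst (t : ITm) (ρ : ℕ → ℕ) :
    (fun k => (t.inst k).sem ρ) = ivalCons (t.sem ρ) ρ := by
  funext k
  cases k <;> rfl

/-- The set from which an iteration starts. -/
def IterKind.start {α : Type*} : IterKind → Set α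
  | .mu => ∅
  | .nu => Set.univ

theorem Form.sem_iter {Φ : List PTy} {A : PTy} (ρ : ℕ → ℕ) (v : FVal Φ) (b : IterKind) (t : ITm)
    (φ : Form (A :: Φ) A) :
    (Form.iter b t φ).sem ρ v = (fun S => φ.sem ρ (v.cons S))^[t.sem ρ] b.start := by
  cases b <;> rfl

theorem Form.sem_substI {Φ : List PTy} {A : PTy} (φ : Form Φ A) (σ : ℕ → ITm) (ρ : ℕ → ℕ)
    (v : FVal Φ) : (φ.substI σ).sem ρ v = φ.sem (fun k => (σ k).sem ρ) v := by
  induction φ generalizing σ ρ with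
  | top | bot | star | var => rfl
  | and φ ψ ih₁ ih₂ => simp only [substI, sem, ih₁, ih₂]
  | or φ ψ ih₁ ih₂ => simp only [substI, sem, ih₁, ih₂]
  | mod m φ ih => simp only [substI, sem, ih]
  | iter b t φ ih => simp only [substI, sem_iter, ih, ITm.sem_subst]
  | ex φ ih => simp only [substI, sem, ih, ITm.sem_up]
  | all φ ih => simp only [substI, sem, ih, ITm.sem_up]
  | imp ψ φ ih₁ ih₂ => simp only [substI, sem, ih₁, ih₂]

theorem Form.sem_lift {Φ : List PTy} {A : PTy} (φ : Form Φ A) (i : ℕ) (ρ : ℕ → ℕ) (v : FVal Φ) :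
    φ.lift.sem (ivalCons i ρ) v = φ.sem ρ v := φ.sem_substI _ _ _

theorem Form.sem_inst {Φ : List PTy} {A : PTy} (φ : Form Φ A) (t : ITm) (ρ : ℕ → ℕ)
    (v : FVal Φ) : (φ.inst t).sem ρ v = φ.sem (ivalCons (t.sem ρ) ρ) v := by
  rw [inst, sem_substI, ITm.sem_inst]

theorem Form.sem_renF {Φ : List PTy} {A : PTy} (φ : Form Φ A) {Ψ : List PTy}
    (r : ∀ B, FVar Φ B → FVar Ψ B) (ρ : ℕ → ℕ) (v : FVal Ψ) :
    (φ.renF r).sem ρ v = φ.sem ρ fun B X => v B (r B X) := by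
  induction φ generalizing ρ Ψ with
  | top | bot | star | var | imp => rfl
  | and φ ψ ih₁ ih₂ => simp only [renF, sem, ih₁, ih₂]
  | or φ ψ ih₁ ih₂ => simp only [renF, sem, ih₁, ih₂]
  | mod m φ ih => simp only [renF, sem, ih]
  | iter b t φ ih =>
    simp only [renF, sem_iter, ih]
    congr 2
    funext S
    congr 1
    funext B X
    cases X <;> rfl
  | ex φ ih => simp only [renF, sem, ih]
  | all φ ih => simp only [renF, sem, ih]

theorem Form.sem_substF {Φ : List PTy} {A : PTy} (φ : Form Φ A) {Ψ : List PTy}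
    (s : ∀ B, FVar Φ B → Form Ψ B) (ρ : ℕ → ℕ) (v : FVal Ψ) :
    (φ.substF s).sem ρ v = φ.sem ρ fun B X => (s B X).sem ρ v := by
  induction φ generalizing ρ Ψ with
  | top | bot | star | var | imp => rfl
  | and φ ψ ih₁ ih₂ => simp only [substF, sem, ih₁, ih₂]
  | or φ ψ ih₁ ih₂ => simp only [substF, sem, ih₁, ih₂]
  | mod m φ ih => simp only [substF, sem, ih]
  | iter b t φ ih =>
    simp only [substF, sem_iter, ih]
    congr 2
    funext S
    congr 1
    funext B X
    cases X with
    | zero => rfl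
    | succ X => exact sem_renF _ _ _ _
  | ex φ ih => simp only [substF, sem, ih, sem_lift]
  | all φ ih => simp only [substF, sem, ih, sem_lift]

theorem Form.sem_instF {Φ : List PTy} {A B : PTy} (φ : Form (B :: Φ) A) (ψ : Form Φ B)
    (ρ : ℕ → ℕ) (v : FVal Φ) : (φ.instF ψ).sem ρ v = φ.sem ρ (v.cons (ψ.sem ρ v)) := by
  rw [instF, sem_substF]
  congr 1
  funext B X
  cases X <;> rfl

/-! ### Monotonicity -/

theorem iterate_le_iterate {α : Type*} [Preorder α] {f g : α → α} (hf : Monotone f)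
    (h : ∀ x, f x ≤ g x) (n : ℕ) (x : α) : f^[n] x ≤ g^[n] x := by
  induction n with
  | zero => exact le_rfl
  | succ n ih =>
    rw [Function.iterate_succ_apply', Function.iterate_succ_apply']
    exact (hf ih).trans (h _)

theorem FVal.cons_mono {Φ : List PTy} {A : PTy} {S S' : Set (Dom A)} {v v' : FVal Φ}
    (hS : S ≤ S') (hv : v ≤ v') : v.cons S ≤ v'.cons S' := by
  intro B X
  cases X with
  | zero => exact hS
  | succ X => exact hv _ X

/-- Implications contain no free fixpoint variable, so every fixpoint variable occurs only under
monotone formers. -/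
theorem Form.sem_mono {Φ : List PTy} {A : PTy} (φ : Form Φ A) (ρ : ℕ → ℕ) :
    Monotone fun v => φ.sem ρ v := by
  induction φ generalizing ρ with
  | top | bot | star | imp => exact fun _ _ _ => le_rfl
  | var X => exact fun _ _ h => h _ X
  | and φ ψ ih₁ ih₂ => exact fun _ _ h => Set.inter_subset_inter (ih₁ ρ h) (ih₂ ρ h)
  | or φ ψ ih₁ ih₂ => exact fun _ _ h => Set.union_subset_union (ih₁ ρ h) (ih₂ ρ h)
  | mod m φ ih => exact fun _ _ h => m.sem_mono (ih ρ h)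
  | iter b t φ ih =>
    intro v v' h
    simp only [sem_iter]
    exact iterate_le_iterate (fun _ _ hS => ih ρ (FVal.cons_mono hS le_rfl))
      (fun _ => ih ρ (FVal.cons_mono le_rfl h)) _ _
  | ex φ ih => exact fun _ _ h => Set.iUnion_mono fun i => ih _ h
  | all φ ih => exact fun _ _ h => Set.iInter_mono fun i => ih _ h

theorem Form.sem_cons_mono {Φ : List PTy} {A B : PTy} (φ : Form (B :: Φ) A) (ρ : ℕ → ℕ)
    (v : FVal Φ) : Monotone fun S => φ.sem ρ (v.cons S) :=
  fun _ _ h => φ.sem_mono ρ (FVal.cons_mono h le_rfl)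

-- Dependence on iteration variables.

theorem ITm.sem_congr {ρ ρ' : ℕ → ℕ} (t : ITm) (h : ∀ k, t.Free k → ρ k = ρ' k) :
    t.sem ρ = t.sem ρ' := by
  induction t with
  | var k => exact h k rfl
  | zero => rfl
  | succ t ih => exact congrArg (· + 1) (ih h)

theorem ITm.sem_mono (t : ITm) : Monotone fun ρ => t.sem ρ := by
  intro ρ ρ' h
  induction t with
  | var k => exact h k
  | zero => exact le_rfl
  | succ t ih => exact Nat.succ_le_succ ih

theorem Form.sem_congr {Φ : List PTy} {A : PTy} (φ : Form Φ A) {ρ ρ' : ℕ → ℕ}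
    (h : ∀ k, φ.Free k → ρ k = ρ' k) (v : FVal Φ) : φ.sem ρ v = φ.sem ρ' v := by
  induction φ generalizing ρ ρ' with
  | top | bot | star | var => rfl
  | and φ ψ ih₁ ih₂ =>
    simp only [sem, ih₁ (fun k hk => h k (Or.inl hk)), ih₂ (fun k hk => h k (Or.inr hk))]
  | or φ ψ ih₁ ih₂ =>
    simp only [sem, ih₁ (fun k hk => h k (Or.inl hk)), ih₂ (fun k hk => h k (Or.inr hk))]
  | mod m φ ih => simp only [sem, ih h]
  | iter b t φ ih =>
    simp only [sem_iter, ih (fun k hk => h k (Or.inr hk)),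
      t.sem_congr (fun k hk => h k (Or.inl hk))]
  | ex φ ih =>
    refine Set.iUnion_congr fun i => ih ?_ v
    rintro (_ | k) hk
    · rfl
    · exact h k hk
  | all φ ih =>
    refine Set.iInter_congr fun i => ih ?_ v
    rintro (_ | k) hk
    · rfl
    · exact h k hk
  | imp ψ φ ih₁ ih₂ =>
    simp only [sem, ih₁ (fun k hk => h k (Or.inl hk)), ih₂ (fun k hk => h k (Or.inr hk))]

/-- `ρ'` is obtained from `ρ` by increasing the value of `k`. -/
def IncreaseAt (k : ℕ) (ρ ρ' : ℕ → ℕ) : Prop := ρ ≤ ρ' ∧ ∀ j, j ≠ k → ρ j = ρ' j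

theorem IncreaseAt.cons {k : ℕ} {ρ ρ' : ℕ → ℕ} (h : IncreaseAt k ρ ρ') (i : ℕ) :
    IncreaseAt (k + 1) (ivalCons i ρ) (ivalCons i ρ') := by
  refine ⟨?_, ?_⟩
  · rintro (_ | j)
    · exact le_rfl
    · exact h.1 j
  · rintro (_ | j) hj
    · rfl
    · exact h.2 j fun e => hj (congrArg (· + 1) e)

theorem increaseAt_zero {i j : ℕ} (h : i ≤ j) (ρ : ℕ → ℕ) :
    IncreaseAt 0 (ivalCons i ρ) (ivalCons j ρ) := by
  refine ⟨?_, ?_⟩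
  · rintro (_ | k)
    · exact h
    · exact le_rfl
  · rintro (_ | k) hk
    · exact absurd rfl hk
    · rfl

theorem IncreaseAt.sem_eq {k : ℕ} {ρ ρ' : ℕ → ℕ} (h : IncreaseAt k ρ ρ') {Φ : List PTy} {A : PTy}
    {φ : Form Φ A} (hφ : ¬ φ.Free k) (v : FVal Φ) : φ.sem ρ v = φ.sem ρ' v :=
  φ.sem_congr (fun j hj => h.2 j fun e => hφ (e ▸ hj)) v

theorem IncreaseAt.sem_itm_eq {k : ℕ} {ρ ρ' : ℕ → ℕ} (h : IncreaseAt k ρ ρ') {t : ITm}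
    (ht : ¬ t.Free k) : t.sem ρ = t.sem ρ' :=
  t.sem_congr fun j hj => h.2 j fun e => ht (e ▸ hj)

/-- Formulae are monotone in their positive iteration variables and antitone in their negative
ones. -/
theorem Form.sem_increaseAt {Φ : List PTy} {A : PTy} (φ : Form Φ A) {k : ℕ} {ρ ρ' : ℕ → ℕ}
    (h : IncreaseAt k ρ ρ') (v : FVal Φ) :
    (Pos k φ → φ.sem ρ v ⊆ φ.sem ρ' v) ∧ (Neg k φ → φ.sem ρ' v ⊆ φ.sem ρ v) := by
  induction φ generalizing k ρ ρ' with
  | top | bot | star | var => exact ⟨fun _ => subset_rfl, fun _ => subset_rfl⟩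
  | and φ ψ ih₁ ih₂ =>
    refine ⟨fun hp => ?_, fun hn => ?_⟩
    · cases hp with
      | notFree hf => exact (h.sem_eq hf v).subset
      | and h₁ h₂ => exact Set.inter_subset_inter ((ih₁ h v).1 h₁) ((ih₂ h v).1 h₂)
    · cases hn with
      | notFree hf => exact (h.sem_eq hf v).superset
      | and h₁ h₂ => exact Set.inter_subset_inter ((ih₁ h v).2 h₁) ((ih₂ h v).2 h₂)
  | or φ ψ ih₁ ih₂ =>
    refine ⟨fun hp => ?_, fun hn => ?_⟩
    · cases hp with
      | notFree hf => exact (h.sem_eq hf v).subset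
      | or h₁ h₂ => exact Set.union_subset_union ((ih₁ h v).1 h₁) ((ih₂ h v).1 h₂)
    · cases hn with
      | notFree hf => exact (h.sem_eq hf v).superset
      | or h₁ h₂ => exact Set.union_subset_union ((ih₁ h v).2 h₁) ((ih₂ h v).2 h₂)
  | mod m φ ih =>
    refine ⟨fun hp => ?_, fun hn => ?_⟩
    · cases hp with
      | notFree hf => exact (h.sem_eq hf v).subset
      | mod h₁ => exact m.sem_mono ((ih h v).1 h₁)
    · cases hn with
      | notFree hf => exact (h.sem_eq hf v).superset
      | mod h₁ => exact m.sem_mono ((ih h v).2 h₁)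
  | iter b t φ ih =>
    refine ⟨fun hp => ?_, fun hn => ?_⟩
    · cases hp with
      | notFree hf => exact (h.sem_eq hf v).subset
      | mu h₁ =>
        refine (iterate_le_iterate (φ.sem_cons_mono ρ v) (fun S => (ih h _).1 h₁) _ _).trans ?_
        -- Iterates from the empty set grow with their number, so the bound of a `μ` may itself
        -- contain the positive variable. Iterates from the whole domain shrink, which is why the
        -- bound of a `ν` may not.
        exact (φ.sem_cons_mono ρ' v).monotone_iterate_of_le_map (Set.empty_subset _)
          (t.sem_mono h.1)
      | nu h₁ ht =>
        rw [sem_iter, sem_iter, h.sem_itm_eq ht]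
        exact iterate_le_iterate (φ.sem_cons_mono ρ v) (fun S => (ih h _).1 h₁) _ _
    · cases hn with
      | notFree hf => exact (h.sem_eq hf v).superset
      | nu h₁ =>
        refine (iterate_le_iterate (φ.sem_cons_mono ρ' v) (fun S => (ih h _).2 h₁) _ _).trans ?_
        exact (φ.sem_cons_mono ρ v).antitone_iterate_of_map_le (Set.subset_univ _)
          (t.sem_mono h.1)
      | mu h₁ ht =>
        rw [sem_iter, sem_iter, h.sem_itm_eq ht]
        exact iterate_le_iterate (φ.sem_cons_mono ρ' v) (fun S => (ih h _).2 h₁) _ _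
  | ex φ ih =>
    refine ⟨fun hp => ?_, fun hn => ?_⟩
    · cases hp with
      | notFree hf => exact (h.sem_eq hf v).subset
      | ex h₁ => exact Set.iUnion_mono fun i => (ih (h.cons i) v).1 h₁
    · cases hn with
      -- Apart from non-occurrence, no rule makes a variable negative in an existential formula.
      | notFree hf => exact (h.sem_eq hf v).superset
  | all φ ih =>
    refine ⟨fun hp => ?_, fun hn => ?_⟩
    · cases hp with
      | notFree hf => exact (h.sem_eq hf v).subset
    · cases hn with
      | notFree hf => exact (h.sem_eq hf v).superset
      | all h₁ => exact Set.iInter_mono fun i => (ih (h.cons i) v).2 h₁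
  | imp ψ φ ih₁ ih₂ =>
    refine ⟨fun hp => ?_, fun hn => ?_⟩
    · cases hp with
      | notFree hf => exact (h.sem_eq hf v).subset
      | imp h₁ h₂ => exact semImp_mono ((ih₁ h _).2 h₁) ((ih₂ h _).1 h₂)
    · cases hn with
      | notFree hf => exact (h.sem_eq hf v).superset
      | imp h₁ h₂ => exact semImp_mono ((ih₁ h _).1 h₁) ((ih₂ h _).2 h₂)

theorem Pos.sem_monotone {Φ : List PTy} {A : PTy} {φ : Form Φ A} (h : Pos 0 φ) (ρ : ℕ → ℕ)
    (v : FVal Φ) : Monotone fun i => φ.sem (ivalCons i ρ) v :=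
  fun _ _ hij => (φ.sem_increaseAt (increaseAt_zero hij ρ) v).1 h

theorem Neg.sem_antitone {Φ : List PTy} {A : PTy} {φ : Form Φ A} (h : Neg 0 φ) (ρ : ℕ → ℕ)
    (v : FVal Φ) : Antitone fun i => φ.sem (ivalCons i ρ) v :=
  fun _ _ hij => (φ.sem_increaseAt (increaseAt_zero hij ρ) v).2 h

/-- Here `j` is the value of the outer of two nested existential variables, with the inner one fixed
at `i`. -/
theorem Pos.sem_monotone_ex {Φ : List PTy} {A : PTy} {φ : Form Φ A} (h : Pos 0 φ.ex) (i : ℕ)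
    (ρ : ℕ → ℕ) (v : FVal Φ) : Monotone fun j => φ.sem (ivalCons i (ivalCons j ρ)) v := by
  intro j j' hj
  have hi := (increaseAt_zero hj ρ).cons i
  cases h with
  | notFree hf => exact (hi.sem_eq hf v).subset
  | ex h => exact (φ.sem_increaseAt hi v).1 h

theorem Neg.sem_antitone_all {Φ : List PTy} {A : PTy} {φ : Form Φ A} (h : Neg 0 φ.all) (i : ℕ)
    (ρ : ℕ → ℕ) (v : FVal Φ) : Antitone fun j => φ.sem (ivalCons i (ivalCons j ρ)) v := by
  intro j j' hj
  have hi := (increaseAt_zero hj ρ).cons i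
  cases h with
  | notFree hf => exact (hi.sem_eq hf v).superset
  | all h => exact (φ.sem_increaseAt hi v).2 h

/-! ### Continuity of positive and negative formulae -/

/-- Monotonicity of `G` makes the `n`-th iterates an increasing sequence, so the one-step hypothesis
applies again. The index of `G` stands for a valuation of fixpoint variables in one use and for the
value of a quantified iteration variable in the other. -/
theorem iterate_subset_iUnion {α : Type*} {F : Set α → Set α} {G : ℕ → Set α → Set α}
    (hF : Monotone F) (hG : ∀ i, Monotone (G i)) (hGm : Monotone G)
    (h : ∀ S : ℕ → Set α, Monotone S → F (⋃ i, S i) ⊆ ⋃ i, G i (S i)) (s : Set α) (n : ℕ) :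
    F^[n] s ⊆ ⋃ i, (G i)^[n] s := by
  induction n with
  | zero => exact Set.subset_iUnion (fun _ : ℕ => s) 0
  | succ n ih =>
    simp only [Function.iterate_succ_apply']
    exact (hF ih).trans (h _ fun i j hij => iterate_le_iterate (hG i) (hGm hij) n s)

theorem iInter_subset_iterate {α : Type*} {F : Set α → Set α} {G : ℕ → Set α → Set α}
    (hF : Monotone F) (hG : ∀ i, Monotone (G i)) (hGm : Antitone G)
    (h : ∀ S : ℕ → Set α, Antitone S → ⋂ i, G i (S i) ⊆ F (⋂ i, S i)) (s : Set α) (n : ℕ) :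
    ⋂ i, (G i)^[n] s ⊆ F^[n] s := by
  induction n with
  | zero => exact Set.iInter_subset (fun _ : ℕ => s) 0
  | succ n ih =>
    simp only [Function.iterate_succ_apply']
    exact (h _ fun i j hij => iterate_le_iterate (hG j) (hGm hij) n s).trans (hF ih)

/-- Conjunctions work because the union is increasing, and iterations because they have finitely
many steps. Universal quantifiers, which could break continuity, are absent from the positive
language, and implications do not depend on `v`. -/
theorem InL.sem_iUnion_subset {Φ : List PTy} {A : PTy} {φ : Form Φ A} (hφ : InL .pos φ)
    (ρ : ℕ → ℕ) {v : ℕ → FVal Φ} (hv : Monotone v) :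
    φ.sem ρ (fun B X => ⋃ i, v i B X) ⊆ ⋃ i, φ.sem ρ (v i) := by
  induction φ generalizing ρ with
  | top | bot | star | imp => exact Set.subset_iUnion_of_subset 0 subset_rfl
  | var X => exact subset_rfl
  | and φ ψ ih₁ ih₂ =>
    cases hφ with
    | and h₁ h₂ =>
      refine (Set.inter_subset_inter (ih₁ h₁ ρ hv) (ih₂ h₂ ρ hv)).trans ?_
      exact (Set.iUnion_inter_of_monotone ((φ.sem_mono ρ).comp hv)
        ((ψ.sem_mono ρ).comp hv)).superset
  | or φ ψ ih₁ ih₂ =>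
    cases hφ with
    | or h₁ h₂ =>
      refine (Set.union_subset_union (ih₁ h₁ ρ hv) (ih₂ h₂ ρ hv)).trans ?_
      exact (Set.iUnion_union_distrib _ _).superset
  | mod m φ ih =>
    cases hφ with
    | mod h => exact (m.sem_mono (ih h ρ hv)).trans (m.sem_iUnion _).subset
  | iter b t φ ih =>
    cases hφ with
    | iter h =>
      simp only [Form.sem_iter]
      refine iterate_subset_iUnion (φ.sem_cons_mono ρ _) (fun i => φ.sem_cons_mono ρ (v i))
        (fun i j hij S => φ.sem_mono ρ (FVal.cons_mono le_rfl (hv hij))) ?_ _ _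
      intro S hS
      refine le_trans (le_of_eq ?_) (ih h ρ (v := fun i => (v i).cons (S i))
        fun i j hij => FVal.cons_mono (hS hij) (hv hij))
      congr 1
      funext B X
      cases X <;> rfl
  | ex φ ih =>
    cases hφ with
    | ex h =>
      refine Set.iUnion_subset fun i => (ih h _ hv).trans (Set.iUnion_mono fun j => ?_)
      exact Set.subset_iUnion (fun i => φ.sem (ivalCons i ρ) (v j)) i
  | all φ ih => cases hφ

/-- Dually, disjunctions need the intersection to be decreasing, and existential quantifiers are
absent. -/
theorem InL.iInter_sem_subset {Φ : List PTy} {A : PTy} {φ : Form Φ A} (hφ : InL .neg φ)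
    (ρ : ℕ → ℕ) {v : ℕ → FVal Φ} (hv : Antitone v) :
    ⋂ i, φ.sem ρ (v i) ⊆ φ.sem ρ (fun B X => ⋂ i, v i B X) := by
  induction φ generalizing ρ with
  | top | bot | star | imp => exact Set.iInter_subset_of_subset 0 subset_rfl
  | var X => exact subset_rfl
  | and φ ψ ih₁ ih₂ =>
    cases hφ with
    | and h₁ h₂ =>
      refine subset_trans ?_ (Set.inter_subset_inter (ih₁ h₁ ρ hv) (ih₂ h₂ ρ hv))
      exact (Set.iInter_inter_distrib _ _).subset
  | or φ ψ ih₁ ih₂ =>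
    cases hφ with
    | or h₁ h₂ =>
      refine subset_trans ?_ (Set.union_subset_union (ih₁ h₁ ρ hv) (ih₂ h₂ ρ hv))
      exact (Set.iInter_union_of_antitone ((φ.sem_mono ρ).comp_antitone hv)
        ((ψ.sem_mono ρ).comp_antitone hv)).subset
  | mod m φ ih =>
    cases hφ with
    | mod h => exact (m.sem_iInter _).superset.trans (m.sem_mono (ih h ρ hv))
  | iter b t φ ih =>
    cases hφ with
    | iter h =>
      simp only [Form.sem_iter]
      refine iInter_subset_iterate (φ.sem_cons_mono ρ _) (fun i => φ.sem_cons_mono ρ (v i))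
        (fun i j hij S => φ.sem_mono ρ (FVal.cons_mono le_rfl (hv hij))) ?_ _ _
      intro S hS
      refine le_trans (ih h ρ (v := fun i => (v i).cons (S i))
        fun i j hij => FVal.cons_mono (hS hij) (hv hij)) (le_of_eq ?_)
      congr 1
      funext B X
      cases X <;> rfl
  | ex φ ih => cases hφ
  | all φ ih =>
    cases hφ with
    | all h =>
      refine Set.subset_iInter fun i => subset_trans (Set.iInter_mono fun j => ?_) (ih h _ hv)
      exact Set.iInter_subset (fun i => φ.sem (ivalCons i ρ) (v j)) i

/-! ### Topological properties of formulae -/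

/-- The class of sets denoted by the formulae of a polarity. -/
def Sign.Denotes {A : PTy} : Sign → Set (Dom A) → Prop
  | .neutral => CompactOpen
  | .pos => ScottOpen
  | .neg => CompactSat

namespace Sign.Denotes

variable {A B : PTy} {s : Sign}

theorem of_compactOpen {S : Set (Dom A)} (h : CompactOpen S) : s.Denotes S := by
  cases s with
  | neutral => exact h
  | pos => exact h.scottOpen
  | neg => exact h.compactSat

theorem isUpperSet {S : Set (Dom A)} (h : s.Denotes S) : IsUpperSet S := by
  cases s with
  | neutral => exact h.1
  | pos => exact ScottOpen.isUpperSet h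
  | neg => exact CompactSat.isUpperSet h

theorem inter {S T : Set (Dom A)} (hS : s.Denotes S) (hT : s.Denotes T) : s.Denotes (S ∩ T) := by
  cases s with
  | neutral => exact CompactOpen.inter hS hT
  | pos => exact ScottOpen.inter hS hT
  | neg => exact CompactSat.inter hS hT

theorem union {S T : Set (Dom A)} (hS : s.Denotes S) (hT : s.Denotes T) : s.Denotes (S ∪ T) := by
  cases s with
  | neutral => exact CompactOpen.union hS hT
  | pos => exact ScottOpen.union hS hT
  | neg => exact CompactSat.union hS hT

theorem mod (m : Modality A B) {S : Set (Dom A)} (hS : s.Denotes S) : s.Denotes (m.sem S) := by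
  cases s with
  | neutral => exact m.compactOpen hS
  | pos => exact m.scottOpen hS
  | neg => exact m.compactSat hS

theorem semImp {S : Set (Dom B)} {T : Set (Dom A)} (hS : s.opp.Denotes S) (hT : s.Denotes T) :
    s.Denotes (semImp S T) := by
  cases s with
  | neutral => exact CompactOpen.semImp hS hT
  | pos => exact ScottOpen.semImp hS hT
  | neg => exact CompactSat.semImp hS hT

end Sign.Denotes

theorem compactOpen_star : CompactOpen (A := (.unit : PTy)) ({(⊤ : Bool)} : Set Bool) := by
  refine ⟨?_, 0, ?_⟩
  · rintro x y h rfl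
    exact (top_le_iff (α := Bool)).1 h
  · rintro x rfl
    rfl

/-- The polarities follow the closure properties: existentials occur only where unions are allowed,
universals only where intersections are, and the premise of an implication has the opposite
polarity. -/
theorem InL.sem_denotes {Φ : List PTy} {A : PTy} {s : Sign} {φ : Form Φ A} (h : InL s φ)
    (ρ : ℕ → ℕ) {v : FVal Φ} (hv : ∀ B X, s.Denotes (v B X)) : s.Denotes (φ.sem ρ v) := by
  induction h generalizing ρ with
  | top => exact .of_compactOpen compactOpen_univ
  | bot => exact .of_compactOpen compactOpen_empty
  | and _ _ ih₁ ih₂ => exact (ih₁ ρ hv).inter (ih₂ ρ hv)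
  | or _ _ ih₁ ih₂ => exact (ih₁ ρ hv).union (ih₂ ρ hv)
  | star => exact .of_compactOpen compactOpen_star
  | mod _ ih => exact (ih ρ hv).mod _
  | var => exact hv _ _
  | @iter Φ A s b t φ _ ih =>
    rw [Form.sem_iter]
    -- An iteration is a finite composition, so an inner induction on its number of steps suffices;
    -- its starting sets are compact open.
    generalize t.sem ρ = n
    induction n with
    | zero =>
      cases b with
      | mu => exact .of_compactOpen compactOpen_empty
      | nu => exact .of_compactOpen compactOpen_univ
    | succ n ihn =>
      rw [Function.iterate_succ_apply']
      refine ih ρ fun B X => ?_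
      cases X with
      | zero => exact ihn
      | succ X => exact hv _ X
  | ex _ _ ih => exact ScottOpen.iUnion fun i => ih _ hv
  | all _ _ ih => exact CompactSat.iInter fun i => ih _ hv
  | imp _ _ ih₁ ih₂ => exact (ih₁ ρ nofun).semImp (ih₂ ρ nofun)

theorem InL.sem_nil_denotes {A : PTy} {s : Sign} {φ : Form [] A} (h : InL s φ) (ρ : ℕ → ℕ) :
    s.Denotes (φ.sem ρ FVal.nil) := h.sem_denotes ρ nofun

theorem InMeet.inL {A : PTy} {φ : Form [] A} (h : InMeet φ) (s : Sign) : InL s φ := by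
  induction h generalizing s with
  | top => exact .top
  | bot => exact .bot
  | and _ _ ih₁ ih₂ => exact .and (ih₁ s) (ih₂ s)
  | star => exact .star
  | mod _ ih => exact .mod (ih s)
  | imp _ _ ih₁ ih₂ => exact .imp (ih₁ _) (ih₂ s)

theorem InMeet.compactOpen {A : PTy} {φ : Form [] A} (h : InMeet φ) (ρ : ℕ → ℕ) :
    CompactOpen (φ.sem ρ FVal.nil) := (h.inL .neutral).sem_nil_denotes ρ

-- Principal filters and the meet fragment.

theorem Modality.nonempty_of_sem {A B : PTy} (m : Modality A B) {S : Set (Dom A)}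
    (h : (m.sem S).Nonempty) : S.Nonempty := by
  obtain ⟨x, hx⟩ := h
  cases m with
  | proj₁ => exact ⟨_, hx⟩
  | proj₂ => exact ⟨_, hx⟩
  | inj₁ => exact hx.imp fun _ h => h.1
  | inj₂ => exact hx.imp fun _ h => h.1
  | fold => exact ⟨_, hx⟩

/-- The new generator is `a` padded with `⊥` for a projection, its image for an injection, and
`foldHom A a` for a fold, where the two isomorphisms are inverse to each other. -/
theorem Modality.exists_sem_Ici {A B : PTy} (m : Modality A B) (a : Dom A) :
    ∃ b, m.sem (Set.Ici a) = Set.Ici b := by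
  cases m with
  | @proj₁ A B =>
    exact ⟨((a, ⊥) : Dom A × Dom B), Set.ext fun x => ⟨fun h => ⟨h, bot_le⟩, fun h => h.1⟩⟩
  | @proj₂ B A =>
    exact ⟨((⊥, a) : Dom B × Dom A), Set.ext fun x => ⟨fun h => ⟨bot_le, h⟩, fun h => h.2⟩⟩
  | inj₁ =>
    refine ⟨Cpo.WSum.inl a, Set.ext fun x => ⟨?_, fun h => ?_⟩⟩
    · rintro ⟨y, hy, rfl⟩
      exact (Cpo.WSum.inl_le _ _).2 hy
    · obtain ⟨y, rfl⟩ := Cpo.WSum.inl_up _ _ h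
      exact ⟨y, (Cpo.WSum.inl_le _ _).1 h, rfl⟩
  | inj₂ =>
    refine ⟨Cpo.WSum.inr a, Set.ext fun x => ⟨?_, fun h => ?_⟩⟩
    · rintro ⟨y, hy, rfl⟩
      exact (Cpo.WSum.inr_le _ _).2 hy
    · obtain ⟨y, rfl⟩ := Cpo.WSum.inr_up _ _ h
      exact ⟨y, (Cpo.WSum.inr_le _ _).1 h, rfl⟩
  | @fold A =>
    refine ⟨foldHom A a, Set.ext fun x => ⟨fun h => ?_, fun h => ?_⟩⟩
    · exact ((foldHom A).mono h).trans_eq (fold_unfold A x)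
    · exact (unfold_fold A a).ge.trans ((unfoldHom A).mono h)

/-- Disjunction is the only former that would destroy principality, and the fragment has none. For a
conjunction, a common element bounds the two generators, which then have a supremum. For an
implication from the filter of `a` to the filter of `b`, the generator is the least function sending
`a` above `b`. -/
theorem InMeet.eq_Ici {A : PTy} {φ : Form [] A} (h : InMeet φ) (ρ : ℕ → ℕ)
    (hne : (φ.sem ρ FVal.nil).Nonempty) : ∃ a, φ.sem ρ FVal.nil = Set.Ici a := by
  induction h with
  | top => exact ⟨⊥, Set.Ici_bot.symm⟩
  | bot => exact hne.elim fun _ h => h.elim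
  | and _ _ ih₁ ih₂ =>
    obtain ⟨a, ha⟩ := ih₁ hne.left
    obtain ⟨b, hb⟩ := ih₂ hne.right
    simp only [Form.sem, ha, hb] at hne ⊢
    obtain ⟨c, hac, hbc⟩ := hne
    obtain ⟨d, hd⟩ := dom_boundedComplete _ {a, b} ⟨c, by
      rintro _ (rfl | rfl)
      · exact hac
      · exact hbc⟩
    refine ⟨d, subset_antisymm (fun x hx => hd.2 ?_) fun x hx => ⟨?_, ?_⟩⟩
    · rintro _ (rfl | rfl)
      · exact hx.1
      · exact hx.2
    · exact (hd.1 (Or.inl rfl)).trans hx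
    · exact (hd.1 (Or.inr rfl)).trans hx
  | star =>
    refine ⟨(⊤ : Bool), subset_antisymm ?_ ?_⟩
    · rintro x rfl
      exact Set.self_mem_Ici
    · intro x hx
      exact (top_le_iff (α := Bool)).1 hx
  | @mod A B m φ _ ih =>
    obtain ⟨a, ha⟩ := ih (m.nonempty_of_sem hne)
    obtain ⟨b, hb⟩ := m.exists_sem_Ici a
    exact ⟨b, (congrArg m.sem ha).trans hb⟩
  | @imp A B ψ φ hψ _ ih₁ ih₂ =>
    obtain ⟨f, hf⟩ := hne
    rcases (ψ.sem ρ FVal.nil).eq_empty_or_nonempty with he | hx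
    -- An unsatisfiable premise imposes no condition.
    · refine ⟨⊥, subset_antisymm (fun _ _ => Set.mem_Ici.2 bot_le) fun g _ x hx => ?_⟩
      rw [he] at hx
      exact hx.elim
    · obtain ⟨a, ha⟩ := ih₁ hx
      obtain ⟨x, hx⟩ := hx
      obtain ⟨b, hb⟩ := ih₂ ⟨_, hf x hx⟩
      obtain ⟨g, hg, hmin⟩ := exists_hom_of_bounded (fun _ : Unit => a) (fun _ => b)
        (fun _ => ha ▸ hψ.compactOpen ρ) (fun _ => ⟨b, fun _ _ => le_rfl⟩)
      refine ⟨(g : Hom (Dom B) (Dom A)), subset_antisymm (fun f hf => hmin f fun _ => ?_) ?_⟩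
      · have h := hf a (ha ▸ Set.self_mem_Ici)
        rwa [hb] at h
      · intro f hf x hx
        rw [ha] at hx
        rw [hb]
        exact (hg () x hx).trans (hf x)

end

section

/-! ### Soundness of deduction -/

theorem Modality.sem_inter {A B : PTy} (m : Modality A B) (S T : Set (Dom A)) :
    m.sem S ∩ m.sem T ⊆ m.sem (S ∩ T) := by
  simp only [Set.inter_eq_iInter, m.sem_iInter]
  exact (Set.iInter_congr (by rintro (_ | _) <;> rfl)).subset

theorem Modality.sem_union {A B : PTy} (m : Modality A B) (S T : Set (Dom A)) :
    m.sem (S ∪ T) ⊆ m.sem S ∪ m.sem T := by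
  simp only [Set.union_eq_iUnion, m.sem_iUnion]
  exact (Set.iUnion_congr (by rintro (_ | _) <;> rfl)).subset

/-- Two witnesses are merged into their maximum. The polarity conditions on both existentials make
`φ` monotone in the two variables. -/
theorem sem_ex_ex_subset {Φ : List PTy} {A : PTy} {φ : Form Φ A} {s : Sign} (h : InL s φ.ex.ex)
    (ρ : ℕ → ℕ) (v : FVal Φ) : φ.ex.ex.sem ρ v ⊆ (φ.inst (.var 0)).ex.sem ρ v := by
  intro x hx
  obtain ⟨i, hx⟩ := Set.mem_iUnion.1 hx
  obtain ⟨j, hx⟩ := Set.mem_iUnion.1 hx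
  refine Set.mem_iUnion.2 ⟨max i j, ?_⟩
  rw [Form.sem_inst]
  cases h with
  | ex h h₁ =>
    cases h with
    | ex _ h₀ =>
      exact h₁.sem_monotone_ex _ ρ v (le_max_left i j) (h₀.sem_monotone _ v (le_max_right i j) hx)

theorem sem_all_subset_all_all {Φ : List PTy} {A : PTy} {φ : Form Φ A} {s : Sign}
    (h : InL s φ.all.all) (ρ : ℕ → ℕ) (v : FVal Φ) :
    (φ.inst (.var 0)).all.sem ρ v ⊆ φ.all.all.sem ρ v := by
  intro x hx
  refine Set.mem_iInter.2 fun i => Set.mem_iInter.2 fun j => ?_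
  have hx := Set.mem_iInter.1 hx (max i j)
  rw [Form.sem_inst] at hx
  cases h with
  | all h h₁ =>
    cases h with
    | all _ h₀ =>
      exact h₁.sem_antitone_all _ ρ v (le_max_left i j) (h₀.sem_antitone _ v (le_max_right i j) hx)

theorem ITm.sem_shift (t : ITm) (i : ℕ) (ρ : ℕ → ℕ) :
    (t.subst fun k => .var (k + 1)).sem (ivalCons i ρ) = t.sem ρ := t.sem_subst _ _

/-- At each step, continuity of `φ` in its fixpoint variable gives an index `j` besides the
existential witness `i`; monotonicity in both replaces them by their maximum. -/
theorem sem_iter_ex_subset {Φ : List PTy} {A : PTy} {b : IterKind} {t : ITm}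
    {φ : Form (A :: Φ) A} {s : Sign} (h : InL s (Form.iter b t φ.ex)) (ρ : ℕ → ℕ) (v : FVal Φ) :
    (Form.iter b t φ.ex).sem ρ v ⊆ (Form.iter b (t.subst fun k => .var (k + 1)) φ).ex.sem ρ v := by
  cases h with
  | iter h =>
    cases h with
    | ex h h₀ =>
      refine subset_trans ?_
        (Set.iUnion_congr fun i => Form.sem_iter (ivalCons i ρ) v b _ φ).superset
      simp only [Form.sem_iter, ITm.sem_shift]
      refine iterate_subset_iUnion (φ.ex.sem_cons_mono ρ v)
        (fun i => φ.sem_cons_mono (ivalCons i ρ) v)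
        (fun i j hij S => h₀.sem_monotone ρ _ hij) ?_ _ _
      intro S hS
      refine Set.iUnion_subset fun i => ?_
      have hc := h.sem_iUnion_subset (ivalCons i ρ) (v := fun j => v.cons (S j))
        fun j k hjk => FVal.cons_mono (hS hjk) le_rfl
      -- The other variables are valued by constant families, so the extended valuation is a union
      -- of valuations.
      have e : v.cons (⋃ j, S j) = fun B X => ⋃ j, (v.cons (S j)) B X := by
        funext B X
        cases X with
        | zero => rfl
        | succ X => exact (Set.iUnion_const _).symm
      rw [e]
      refine hc.trans (Set.iUnion_subset fun j => ?_)
      refine Set.subset_iUnion_of_subset (max i j) ?_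
      exact (h₀.sem_monotone ρ _ (le_max_left i j)).trans
        (φ.sem_cons_mono _ v (hS (le_max_right i j)))

theorem sem_all_iter_subset {Φ : List PTy} {A : PTy} {b : IterKind} {t : ITm}
    {φ : Form (A :: Φ) A} {s : Sign} (h : InL s (Form.iter b t φ.all)) (ρ : ℕ → ℕ) (v : FVal Φ) :
    (Form.iter b (t.subst fun k => .var (k + 1)) φ).all.sem ρ v ⊆
      (Form.iter b t φ.all).sem ρ v := by
  cases h with
  | iter h =>
    cases h with
    | all h h₀ =>
      refine (Set.iInter_congr fun i => Form.sem_iter (ivalCons i ρ) v b _ φ).subset.trans ?_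
      simp only [Form.sem_iter, ITm.sem_shift]
      refine iInter_subset_iterate (φ.all.sem_cons_mono ρ v)
        (fun i => φ.sem_cons_mono (ivalCons i ρ) v)
        (fun i j hij S => h₀.sem_antitone ρ _ hij) ?_ _ _
      intro S hS
      refine Set.subset_iInter fun i => ?_
      have hc := h.iInter_sem_subset (ivalCons i ρ) (v := fun j => v.cons (S j))
        fun j k hjk => FVal.cons_mono (hS hjk) le_rfl
      have e : v.cons (⋂ j, S j) = fun B X => ⋂ j, (v.cons (S j)) B X := by
        funext B X
        cases X with
        | zero => rfl
        | succ X => exact (Set.iInter_const _).symm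
      rw [e]
      refine subset_trans (Set.subset_iInter fun j => ?_) hc
      refine Set.iInter_subset_of_subset (max i j) ?_
      exact (h₀.sem_antitone ρ _ (le_max_left i j)).trans
        (φ.sem_cons_mono _ v (hS (le_max_right i j)))

/-- A universal premise is negative, which forces the implication to be positive. The instances of
`ψ` are then descending compact saturated sets whose intersection lies in the open inverse image of
`φ` under `f`, so well-filteredness selects an instance. -/
theorem sem_all_imp_subset {Φ : List PTy} {A B : PTy} {ψ : Form [] B} {φ : Form [] A} {s : Sign}
    (h : InL s (Form.imp (Φ := Φ) ψ.all φ)) (ρ : ℕ → ℕ) (v : FVal Φ) :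
    (Form.imp ψ.all φ).sem ρ v ⊆ (Form.imp ψ φ.lift).ex.sem ρ v := by
  cases h with
  | imp h₁ h₂ =>
    cases s with
    | neutral => cases h₁
    | neg => cases h₁
    | pos =>
      cases h₁ with
      | all h₁ h₀ =>
        intro f hf
        obtain ⟨i, hi⟩ := exists_subset_of_iInter_subset
          (fun i => h₁.sem_nil_denotes (ivalCons i ρ)) (h₀.sem_antitone ρ _)
          (ScottOpen.preimage (h₂.sem_nil_denotes ρ) f) hf
        refine Set.mem_iUnion.2 ⟨i, fun x hx => ?_⟩
        rw [Form.sem_lift]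
        exact hi hx

/-- The neutral premise denotes a compact open set, and the instances of `φ` form an increasing
sequence, so compactness yields one index valid for all arguments. -/
theorem sem_imp_ex_subset {Φ : List PTy} {A B : PTy} {ψ : Form [] B} {φ : Form [] A} {s : Sign}
    (h : InL s (Form.imp (Φ := Φ) ψ φ.ex)) (hψ : InL .neutral ψ) (ρ : ℕ → ℕ) (v : FVal Φ) :
    (Form.imp ψ φ.ex).sem ρ v ⊆ (Form.imp ψ.lift φ).ex.sem ρ v := by
  cases h with
  | imp _ h₂ =>
    cases h₂ with
    | ex h₂ h₀ =>
      intro f hf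
      obtain ⟨i, hi⟩ := CompactOpen.exists_of_semImp_iUnion (hψ.sem_nil_denotes ρ)
        (fun i => (h₂.sem_nil_denotes (ivalCons i ρ)).isUpperSet) (h₀.sem_monotone ρ _) hf
      refine Set.mem_iUnion.2 ⟨i, fun x hx => ?_⟩
      rw [Form.sem_lift] at hx
      exact hi x hx

/-- The disjunct satisfied at the least point of `δ` is satisfied at every other point of `δ`,
because both disjuncts are upward closed. -/
theorem sem_imp_or_subset {Φ : List PTy} {A B : PTy} {δ : Form [] B} {φ₁ φ₂ : Form [] A}
    {s : Sign} (h : InL s (Form.imp (Φ := Φ) δ (φ₁.or φ₂))) (hδ : InMeet δ) (ρ : ℕ → ℕ)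
    (v : FVal Φ) :
    (Form.imp δ (φ₁.or φ₂)).sem ρ v ⊆ ((Form.imp δ φ₁).or (Form.imp δ φ₂)).sem ρ v := by
  cases h with
  | imp _ h =>
    cases h with
    | or h₁ h₂ =>
      intro f hf
      rcases (δ.sem ρ FVal.nil).eq_empty_or_nonempty with he | hne
      · refine Or.inl fun x hx => ?_
        rw [he] at hx
        exact hx.elim
      · obtain ⟨a, ha⟩ := hδ.eq_Ici ρ hne
        refine (hf a (ha ▸ Set.self_mem_Ici)).imp (fun h x hx => ?_) (fun h x hx => ?_)
        · rw [ha] at hx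
          exact (h₁.sem_nil_denotes ρ).isUpperSet (Hom.mono f hx) h
        · rw [ha] at hx
          exact (h₂.sem_nil_denotes ρ).isUpperSet (Hom.mono f hx) h

-- Satisfiability of consistent formulae, and the joint induction.

theorem Form.mem_sem_conj {Φ : List PTy} {A : PTy} {ρ : ℕ → ℕ} {v : FVal Φ} {l : List (Form Φ A)}
    {x : Dom A} : x ∈ (conj l).sem ρ v ↔ ∀ φ ∈ l, x ∈ φ.sem ρ v := by
  induction l with
  | nil => simp [conj, sem]
  | cons φ l ih => simp [conj, sem, ih]

theorem InMeet.conj {A : PTy} {l : List (Form [] A)} (h : ∀ φ ∈ l, InMeet φ) :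
    InMeet (Form.conj l) := by
  induction l with
  | nil => exact .top
  | cons φ l ih =>
    exact .and (h φ List.mem_cons_self) (ih fun ψ hψ => h ψ (List.mem_cons_of_mem _ hψ))

/-- With all `ψᵢ` and `φᵢ` principal filters, a function is sought with finitely many prescribed
lower bounds on values. At a point `x` the relevant bounds come from the `i` with `x` in `ψᵢ`; as
`x` witnesses the conjunction of these premises, their conclusions have a common element, which
bounds them. -/
theorem nonempty_sem_conj_imp {A B : PTy} (l : List (Form [] B × Form [] A)) (ρ : ℕ → ℕ)
    (h₁ : ∀ i ∈ l, InMeet i.1 ∧ (i.1.sem ρ FVal.nil).Nonempty)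
    (h₂ : ∀ i ∈ l, InMeet i.2 ∧ (i.2.sem ρ FVal.nil).Nonempty)
    (h : ∀ J : List (Form [] B × Form [] A), J.Sublist l →
      ((Form.conj (J.map Prod.fst)).sem ρ FVal.nil).Nonempty →
      ((Form.conj (J.map Prod.snd)).sem ρ FVal.nil).Nonempty) :
    ((Form.conj (l.map fun i => Form.imp i.1 i.2)).sem ρ FVal.nil).Nonempty := by
  have ha : ∀ i : {i // i ∈ l}, ∃ a, i.1.1.sem ρ FVal.nil = Set.Ici a := fun i =>
    (h₁ i.1 i.2).1.eq_Ici ρ (h₁ i.1 i.2).2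
  have hb : ∀ i : {i // i ∈ l}, ∃ a, i.1.2.sem ρ FVal.nil = Set.Ici a := fun i =>
    (h₂ i.1 i.2).1.eq_Ici ρ (h₂ i.1 i.2).2
  choose a ha using ha
  choose b hb using hb
  obtain ⟨f, hf, -⟩ := exists_hom_of_bounded a b
    (fun i => ha i ▸ (h₁ i.1 i.2).1.compactOpen ρ) (fun x => by
      classical
      let J := l.filter fun i => x ∈ i.1.sem ρ FVal.nil
      obtain ⟨c, hc⟩ := h J List.filter_sublist ⟨x, Form.mem_sem_conj.2 fun φ hφ => by
        obtain ⟨i, hi, rfl⟩ := List.mem_map.1 hφ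
        simpa using (List.mem_filter.1 hi).2⟩
      refine ⟨c, fun i hi => ?_⟩
      have hx : x ∈ i.1.1.sem ρ FVal.nil := by
        rw [ha i]
        exact hi
      have := Form.mem_sem_conj.1 hc i.1.2
        (List.mem_map.2 ⟨i.1, List.mem_filter.2 ⟨i.2, by simpa using hx⟩, rfl⟩)
      rwa [hb i] at this)
  refine ⟨(f : Hom (Dom B) (Dom A)), Form.mem_sem_conj.2 fun φ hφ => ?_⟩
  obtain ⟨i, hi, rfl⟩ := List.mem_map.1 hφ
  intro x hx
  have h₁ := ha ⟨i, hi⟩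
  have h₂ := hb ⟨i, hi⟩
  dsimp only at h₁ h₂
  rw [h₁] at hx
  rw [h₂]
  exact hf ⟨i, hi⟩ x hx

theorem Ded.sound {Φ : List PTy} {A : PTy} {ψ φ : Form Φ A} (h : Ded ψ φ) (ρ : ℕ → ℕ)
    (v : FVal Φ) : ψ.sem ρ v ⊆ φ.sem ρ v := by
  revert ρ v
  -- Consistency is strengthened to membership in the meet fragment together with satisfiability,
  -- because its implication rule needs principal filters.
  induction h using Ded.rec (motive_2 := fun δ _ =>
    InMeet δ ∧ ∀ ρ, (δ.sem ρ FVal.nil).Nonempty) with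
  | refl _ => exact fun _ _ => subset_rfl
  | cut _ _ _ ih₁ ih₂ => exact fun ρ v => (ih₁ ρ v).trans (ih₂ ρ v)
  | distr _ => exact fun _ _ => (Set.inter_union_distrib_left _ _ _).subset
  | andR _ _ _ ih₁ ih₂ => exact fun ρ v => Set.subset_inter (ih₁ ρ v) (ih₂ ρ v)
  | andL₁ _ _ ih => exact fun ρ v => Set.inter_subset_left.trans (ih ρ v)
  | andL₂ _ _ ih => exact fun ρ v => Set.inter_subset_right.trans (ih ρ v)
  | topR _ => exact fun _ _ => Set.subset_univ _
  | orR₁ _ _ ih => exact fun ρ v => (ih ρ v).trans Set.subset_union_left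
  | orR₂ _ _ ih => exact fun ρ v => (ih ρ v).trans Set.subset_union_right
  | orL _ _ _ ih₁ ih₂ => exact fun ρ v => Set.union_subset (ih₁ ρ v) (ih₂ ρ v)
  | botL _ => exact fun _ _ => Set.empty_subset _
  | inj _ =>
    rintro ρ v x ⟨⟨y, -, rfl⟩, ⟨z, -, h⟩⟩
    exact inl_ne_inr _ _ h.symm
  | modMono _ _ ih => exact fun ρ v => Modality.sem_mono _ (ih ρ v)
  | modAnd _ => exact fun _ _ => Modality.sem_inter _ _ _
  | @modTop Φ A B m _ hm =>
    intro ρ v x _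
    cases m with
    | proj₁ | proj₂ | fold => trivial
    | inj₁ | inj₂ => exact (hm trivial).elim
  | modAll _ => exact fun _ _ => (Modality.sem_iInter _ _).superset
  | modOr _ => exact fun _ _ => Modality.sem_union _ _ _
  | modBot _ =>
    intro ρ v x hx
    exact (Modality.nonempty_of_sem _ ⟨x, hx⟩).elim fun _ h => h
  | modEx _ => exact fun _ _ => (Modality.sem_iUnion _ _).subset
  | exR _ _ ih =>
    intro ρ v x hx
    have := ih ρ v hx
    rw [Form.sem_inst] at this
    exact Set.mem_iUnion.2 ⟨_, this⟩
  | exL _ _ ih =>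
    rintro ρ v x ⟨hθ, hx⟩
    obtain ⟨i, hi⟩ := Set.mem_iUnion.1 hx
    have := ih (ivalCons i ρ) v
    simp only [Form.sem, Form.sem_lift] at this
    exact this ⟨hθ, hi⟩
  -- The polarity conditions are read off the side of the sequent that carries both quantifiers: the
  -- left one here, the right one for universals.
  | exM h => exact sem_ex_ex_subset h.choose_spec.1
  | allL _ _ ih =>
    intro ρ v x hx
    refine ih ρ v ?_
    rw [Form.sem_inst]
    exact Set.mem_iInter.1 hx _
  | allR _ _ ih =>
    intro ρ v x hx
    by_cases hθ : x ∈ Form.sem ρ v ‹_›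
    · exact Or.inr hθ
    · refine Or.inl (Set.mem_iInter.2 fun i => ?_)
      have := ih (ivalCons i ρ) v
      simp only [Form.sem, Form.sem_lift] at this
      exact (this hx).resolve_right hθ
  | allM h => exact sem_all_subset_all_all h.choose_spec.2
  | iterEx h => exact sem_iter_ex_subset h.choose_spec.1
  | allIter h => exact sem_all_iter_subset h.choose_spec.2
  | muZero _ => exact fun _ _ => subset_rfl
  | muSuccL _ _ ih =>
    intro ρ v
    rw [Form.sem_instF, Form.sem_iter]
    simp only [ITm.sem, Function.iterate_succ_apply']
    exact Form.sem_cons_mono _ ρ v (ih ρ v)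
  | muSuccR _ =>
    intro ρ v
    rw [Form.sem_instF, Form.sem_iter, Form.sem_iter]
    simp only [ITm.sem, Function.iterate_succ_apply']
    exact subset_rfl
  | nuZero _ => exact fun _ _ => subset_rfl
  | nuSuccR _ _ ih =>
    intro ρ v
    rw [Form.sem_instF, Form.sem_iter]
    simp only [ITm.sem, Function.iterate_succ_apply']
    exact Form.sem_cons_mono _ ρ v (ih ρ v)
  | nuSuccL _ =>
    intro ρ v
    rw [Form.sem_instF, Form.sem_iter, Form.sem_iter]
    simp only [ITm.sem, Function.iterate_succ_apply']
    exact subset_rfl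
  | iterMono _ _ ih =>
    intro ρ v
    rw [Form.sem_iter, Form.sem_iter]
    exact iterate_le_iterate (Form.sem_cons_mono _ ρ v) (fun S => ih ρ _) _ _
  | impMono _ _ _ ih₁ ih₂ => exact fun ρ _ => semImp_mono (ih₁ ρ _) (ih₂ ρ _)
  | wf h => exact sem_all_imp_subset h.choose_spec.1
  | cc h hψ => exact sem_imp_ex_subset h.choose_spec.1 hψ
  | exImp _ =>
    intro ρ v f hf x hx
    obtain ⟨i, hi⟩ := Set.mem_iUnion.1 hx
    have := Set.mem_iInter.1 hf i x hi
    rwa [Form.sem_lift] at this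
  | impAll _ =>
    intro ρ v f hf x hx
    refine Set.mem_iInter.2 fun i => Set.mem_iInter.1 hf i x ?_
    rwa [Form.sem_lift]
  | impAnd _ => exact fun ρ v f hf x hx => ⟨hf.1 x hx, hf.2 x hx⟩
  | impTop _ => exact fun _ _ _ _ _ _ => trivial
  | orImp _ => exact fun ρ v f hf x hx => hx.elim (hf.1 x) (hf.2 x)
  | botImp _ => exact fun _ _ _ _ _ hx => hx.elim
  | impOr h hδ => exact sem_imp_or_subset h.choose_spec.1 hδ
  | impBot _ _ _ ih => exact fun ρ v f hf => (ih.2 ρ).elim fun x hx => hf x hx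
  | star => exact ⟨.star, fun _ => ⟨_, rfl⟩⟩
  | @fold A φ _ ih =>
    refine ⟨.mod ih.1, fun ρ => ?_⟩
    obtain ⟨x, hx⟩ := ih.2 ρ
    refine ⟨foldHom A x, ?_⟩
    change unfoldHom A (foldHom A x) ∈ φ.sem ρ FVal.nil
    rwa [unfold_fold]
  | @pair A B φ ψ _ _ ih₁ ih₂ =>
    refine ⟨.and (.mod ih₁.1) (.mod ih₂.1), fun ρ => ?_⟩
    obtain ⟨x, hx⟩ := ih₁.2 ρ
    obtain ⟨y, hy⟩ := ih₂.2 ρ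
    exact ⟨((x, y) : Dom A × Dom B), hx, hy⟩
  | inj₁ _ ih => exact ⟨.mod ih.1, fun ρ => (ih.2 ρ).image _⟩
  | inj₂ _ ih => exact ⟨.mod ih.1, fun ρ => (ih.2 ρ).image _⟩
  | top => exact ⟨.top, fun _ => Set.univ_nonempty⟩
  | ded _ _ hφ ih₁ ih₂ => exact ⟨hφ, fun ρ => (ih₁.2 ρ).mono (ih₂ ρ _)⟩
  | imp l inc _ _ _ _ ih₁ ih₂ ih₃ ih₄ =>
    refine ⟨.conj fun φ hφ => ?_, fun ρ => nonempty_sem_conj_imp l ρ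
      (fun i hi => ⟨(ih₁ i hi).1, (ih₁ i hi).2 ρ⟩) (fun i hi => ⟨(ih₂ i hi).1, (ih₂ i hi).2 ρ⟩) ?_⟩
    · obtain ⟨i, hi, rfl⟩ := List.mem_map.1 hφ
      exact .imp (ih₁ i hi).1 (ih₂ i hi).1
    · rintro J hJ ⟨x, hx⟩
      by_cases hinc : inc J
      · exact (ih₃ J hJ hinc ρ _ hx).elim
      · exact (ih₄ J hJ hinc).2 ρ

end

section

/-! ### Coherence of the interpretation of terms

As terms carry no type annotations, the same term may have many types. The interpretations of its
typing derivations are related by a logical relation between all pairs of types, which is equality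
on the diagonal. -/

/-- The action of disjoint unions with a new least element on relations. -/
def sumRel {X X' Y Y' : Cpo} (r : X → Y → Prop) (r' : X' → Y' → Prop) (z : Cpo.WSum X X')
    (w : Cpo.WSum Y Y') : Prop :=
  (z = ⊥ ∧ w = ⊥) ∨ (∃ x y, z = Cpo.WSum.inl x ∧ w = Cpo.WSum.inl y ∧ r x y) ∨
    ∃ x y, z = Cpo.WSum.inr x ∧ w = Cpo.WSum.inr y ∧ r' x y

/-- Types with different outermost formers are related only at `⊥`: a term such as `fix x. x` has
both types, and its denotations are bottom. Recursive types defer to the previous level, since mixed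
variance prevents a direct induction on unrolled types. -/
def stepRel {prev : ∀ {n : ℕ}, Ty n → Cpo} (r : ∀ {n : ℕ} (A B : Ty n), prev A → prev B → Prop) :
    {n : ℕ} → (A B : Ty n) → step prev A → step prev B → Prop
  | _, .unit, .unit => fun x y => x = y
  | _, .prod A A', .prod B B' => fun x y => stepRel r A B x.1 y.1 ∧ stepRel r A' B' x.2 y.2
  | _, .arrow A A', .arrow B B' => fun f g =>
    ∀ x y, stepRel r A B x y → stepRel r A' B' (Hom.toFun f x) (Hom.toFun g y)
  | _, .sum A A', .sum B B' => sumRel (stepRel r A B) (stepRel r A' B')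
  | _, .mu A, .mu B => r A.unroll B.unroll
  | _, _, _ => fun x y => x = ⊥ ∧ y = ⊥

def approxRel : (k : ℕ) → ∀ {n : ℕ} (A B : Ty n), approx k A → approx k B → Prop
  | 0, _, _, _ => fun _ _ => True
  | k + 1, _, A, B => stepRel (approxRel k) A B

theorem sumRel.map {X X' Y Y' Z Z' W W' : Cpo} {r : X → Y → Prop} {r' : X' → Y' → Prop}
    {s : Z → W → Prop} {s' : Z' → W' → Prop} {f : Hom X Z} {f' : Hom X' Z'} {g : Hom Y W}
    {g' : Hom Y' W'} (h : ∀ x y, r x y → s (f x) (g y)) (h' : ∀ x y, r' x y → s' (f' x) (g' y))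
    {z : Cpo.WSum X X'} {w : Cpo.WSum Y Y'} (hzw : sumRel r r' z w) :
    sumRel s s' (EP.sumMap f f' z) (EP.sumMap g g' w) := by
  rcases hzw with ⟨rfl, rfl⟩ | ⟨x, y, rfl, rfl, hxy⟩ | ⟨x, y, rfl, rfl, hxy⟩
  · exact Or.inl ⟨rfl, rfl⟩
  · exact Or.inr (Or.inl ⟨_, _, rfl, rfl, h x y hxy⟩)
  · exact Or.inr (Or.inr ⟨_, _, rfl, rfl, h' x y hxy⟩)

theorem stepRel_bot {prev : ∀ {n : ℕ}, Ty n → Cpo}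
    {r : ∀ {n : ℕ} (A B : Ty n), prev A → prev B → Prop}
    (h : ∀ {n : ℕ} (A B : Ty n), r A B ⊥ ⊥) {n : ℕ} (A B : Ty n) : stepRel r A B ⊥ ⊥ := by
  induction A with
  | unit | var => cases B <;> first | exact ⟨rfl, rfl⟩ | exact rfl
  | prod A A' ih ih' => cases B <;> first | exact ⟨rfl, rfl⟩ | exact ⟨ih _, ih' _⟩
  | arrow A A' _ ih' => cases B <;> first | exact ⟨rfl, rfl⟩ | exact fun _ _ _ => ih' _
  | sum A A' => cases B <;> first | exact ⟨rfl, rfl⟩ | exact Or.inl ⟨rfl, rfl⟩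
  | mu A => cases B <;> first | exact ⟨rfl, rfl⟩ | exact h _ _

theorem approxRel_bot : (k : ℕ) → ∀ {n : ℕ} (A B : Ty n), approxRel k A B ⊥ ⊥
  | 0, _, _, _ => trivial
  | k + 1, _, A, B => stepRel_bot (approxRel_bot k) A B

/-- Embeddings and projections must be treated together: at an arrow, each direction uses the other
one on arguments. -/
theorem stepRel_ep {prev prev' : ∀ {n : ℕ}, Ty n → Cpo}
    {r : ∀ {n : ℕ} (A B : Ty n), prev A → prev B → Prop}
    {r' : ∀ {n : ℕ} (A B : Ty n), prev' A → prev' B → Prop}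
    (c : ∀ {n : ℕ} (A : Ty n), EP (prev A) (prev' A))
    (he : ∀ {n : ℕ} (A B : Ty n) x y, r A B x y → r' A B ((c A).e x) ((c B).e y))
    (hp : ∀ {n : ℕ} (A B : Ty n) x y, r' A B x y → r A B ((c A).p x) ((c B).p y))
    {n : ℕ} (A B : Ty n) :
    (∀ x y, stepRel r A B x y → stepRel r' A B ((stepEP c A).e x) ((stepEP c B).e y)) ∧
    (∀ x y, stepRel r' A B x y → stepRel r A B ((stepEP c A).p x) ((stepEP c B).p y)) := by
  -- Pairs of types with different outermost formers only require that both maps be strict.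
  have mism : ∀ A B : Ty n,
      (∀ x y, x = ⊥ ∧ y = ⊥ → (stepEP c A).e x = ⊥ ∧ (stepEP c B).e y = ⊥) ∧
      (∀ x y, x = ⊥ ∧ y = ⊥ → (stepEP c A).p x = ⊥ ∧ (stepEP c B).p y = ⊥) := by
    refine fun A B => ⟨?_, ?_⟩
    · rintro _ _ ⟨rfl, rfl⟩
      exact ⟨EP.e_bot _, EP.e_bot _⟩
    · rintro _ _ ⟨rfl, rfl⟩
      exact ⟨EP.p_bot _, EP.p_bot _⟩
  induction A with
  | unit | var => cases B <;> first | exact mism _ _ | exact ⟨fun _ _ h => h, fun _ _ h => h⟩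
  | prod A A' ih ih' =>
    cases B with
    | prod B B' =>
      exact ⟨fun x y h => ⟨(ih B mism).1 _ _ h.1, (ih' B' mism).1 _ _ h.2⟩,
        fun x y h => ⟨(ih B mism).2 _ _ h.1, (ih' B' mism).2 _ _ h.2⟩⟩
    | _ => exact mism _ _
  | arrow A A' ih ih' =>
    cases B with
    | arrow B B' =>
      exact ⟨fun f g h x y hxy => (ih' B' mism).1 _ _ (h _ _ ((ih B mism).2 x y hxy)),
        fun f g h x y hxy => (ih' B' mism).2 _ _ (h _ _ ((ih B mism).1 x y hxy))⟩
    | _ => exact mism _ _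
  | sum A A' ih ih' =>
    cases B with
    | sum B B' =>
      exact ⟨fun x y h => sumRel.map (ih B mism).1 (ih' B' mism).1 h,
        fun x y h => sumRel.map (ih B mism).2 (ih' B' mism).2 h⟩
    | _ => exact mism _ _
  | mu A =>
    cases B with
    | mu B => exact ⟨he _ _, hp _ _⟩
    | _ => exact mism _ _

theorem approxRel_ep : (k : ℕ) → ∀ {n : ℕ} (A B : Ty n),
    (∀ x y, approxRel k A B x y → approxRel (k + 1) A B ((approxEP k A).e x) ((approxEP k B).e y)) ∧
    (∀ x y, approxRel (k + 1) A B x y → approxRel k A B ((approxEP k A).p x) ((approxEP k B).p y))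
  | 0, _, A, B => ⟨fun _ _ _ => approxRel_bot 1 A B, fun _ _ _ => trivial⟩
  | k + 1, _, A, B => stepRel_ep (approxEP k) (fun A B => (approxRel_ep k A B).1)
      (fun A B => (approxRel_ep k A B).2) A B

/-- Both directions are carried by the induction: at an arrow, reflexivity on arguments gives
extensional equality of related functions, and equality of related arguments gives reflexivity. -/
theorem stepRel_self {prev : ∀ {n : ℕ}, Ty n → Cpo}
    {r : ∀ {n : ℕ} (A B : Ty n), prev A → prev B → Prop}
    (h : ∀ {n : ℕ} (A : Ty n) x y, r A A x y ↔ x = y) {n : ℕ} (A : Ty n) (x y : step prev A) :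
    stepRel r A A x y ↔ x = y := by
  induction A with
  | var => exact ⟨fun h => h.1.trans h.2.symm, fun _ => ⟨rfl, rfl⟩⟩
  | unit => exact Iff.rfl
  | prod A A' ih ih' =>
    refine ⟨fun h => Prod.ext ((ih _ _).1 h.1) ((ih' _ _).1 h.2), ?_⟩
    rintro rfl
    exact ⟨(ih _ _).2 rfl, (ih' _ _).2 rfl⟩
  | arrow A A' ih ih' =>
    refine ⟨fun h => Hom.ext (funext fun x => (ih' _ _).1 (h x x ((ih _ _).2 rfl))), ?_⟩
    rintro rfl u v huv
    obtain rfl := (ih _ _).1 huv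
    exact (ih' _ _).2 rfl
  | sum A A' ih ih' =>
    constructor
    · rintro (⟨rfl, rfl⟩ | ⟨u, v, rfl, rfl, h⟩ | ⟨u, v, rfl, rfl, h⟩)
      · rfl
      · exact congrArg Cpo.WSum.inl ((ih _ _).1 h)
      · exact congrArg Cpo.WSum.inr ((ih' _ _).1 h)
    · rintro rfl
      rcases Cpo.WSum.cases x with rfl | ⟨u, rfl⟩ | ⟨u, rfl⟩
      · exact Or.inl ⟨rfl, rfl⟩
      · exact Or.inr (Or.inl ⟨u, u, rfl, rfl, (ih _ _).2 rfl⟩)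
      · exact Or.inr (Or.inr ⟨u, u, rfl, rfl, (ih' _ _).2 rfl⟩)
  | mu A => exact h _ _ _

theorem approxRel_self : (k : ℕ) → ∀ {n : ℕ} (A : Ty n) (x y : approx k A),
    approxRel k A A x y ↔ x = y
  | 0, _, _, _, _ => ⟨fun _ => rfl, fun _ => trivial⟩
  | k + 1, _, A, x, y => stepRel_self (approxRel_self k) A x y

-- The logical relation on the bilimits.

/-- The logical relation between the interpretations of two types. -/
def DomRel {n : ℕ} (A B : Ty n) (x : Dom A) (y : Dom B) : Prop :=
  ∀ k, approxRel (k + 1) A B ((approxDom k A).p x) ((approxDom k B).p y)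

namespace DomRel

variable {n : ℕ} {A B A' B' : Ty n}

theorem eq {x y : Dom A} (h : DomRel A A x y) : x = y := by
  refine (trunc_isLUB x).unique ?_
  have e : (fun k => trunc k A x) = fun k => trunc k A y :=
    funext fun k => congrArg (approxDom k A).e ((approxRel_self (k + 1) A _ _).1 (h k))
  rw [e]
  exact trunc_isLUB y

theorem bot : DomRel A B ⊥ ⊥ := by
  intro k
  rw [EP.p_bot, EP.p_bot]
  exact approxRel_bot _ _ _

theorem approxRel_of_le {x : Dom A} {y : Dom B} {j k : ℕ} (hjk : j ≤ k)
    (h : approxRel (k + 1) A B ((approxDom k A).p x) ((approxDom k B).p y)) :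
    approxRel (j + 1) A B ((approxDom j A).p x) ((approxDom j B).p y) := by
  induction hjk using Nat.decreasingInduction with
  | self => exact h
  | of_succ j _ ih =>
    rw [← (approxDom_comm j A).2, ← (approxDom_comm j B).2]
    exact (approxRel_ep (j + 1) A B).2 _ _ ih

theorem of_approxRel {k : ℕ} {x : approx (k + 1) A} {y : approx (k + 1) B}
    (h : approxRel (k + 1) A B x y) : DomRel A B ((approxDom k A).e x) ((approxDom k B).e y) := by
  -- Above level `k`, relatedness climbs along the embeddings; an arbitrary level `j` is then
  -- reached by projecting down from `k + j`.
  have up : ∀ (d k : ℕ) (x : approx (k + 1) A) (y : approx (k + 1) B), approxRel (k + 1) A B x y →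
      approxRel (k + d + 1) A B ((approxDom (k + d) A).p ((approxDom k A).e x))
        ((approxDom (k + d) B).p ((approxDom k B).e y)) := by
    intro d
    induction d with
    | zero =>
      intro k x y h
      change approxRel (k + 1) A B ((approxDom k A).p _) ((approxDom k B).p _)
      rw [EP.p_e, EP.p_e]
      exact h
    | succ d ih =>
      intro k x y h
      rw [← (approxDom_comm k A).1, ← (approxDom_comm k B).1,
        show k + (d + 1) = (k + 1) + d by omega]
      exact ih (k + 1) _ _ ((approxRel_ep (k + 1) A B).1 _ _ h)
  intro j
  exact approxRel_of_le (Nat.le_add_left j k) (up j k x y h)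

/-- Sequences attain the projections of their suprema. -/
theorem exists_proj_eq {x : ℕ → Dom A} (hx : Monotone x) {a : Dom A} (ha : IsLUB (Set.range x) a)
    (k : ℕ) : ∃ i, ∀ j, i ≤ j → (approxDom k A).p (x j) = (approxDom k A).p a := by
  obtain ⟨_, ⟨i, rfl⟩, hi⟩ := exists_trunc_eq (Set.range_nonempty x) hx.directed_le.directedOn_range
    ha k
  refine ⟨i, fun j hij => le_antisymm ((approxDom k A).p.mono (ha.1 ⟨j, rfl⟩)) ?_⟩
  have hp := congrArg (approxDom k A).p hi
  have e : ∀ z, (approxDom k A).p (trunc k A z) = (approxDom k A).p z := fun z =>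
    (approxDom k A).p_e _
  rw [e, e] at hp
  exact hp.ge.trans ((approxDom k A).p.mono (hx hij))

/-- A projection to a finite approximant is eventually constant along each sequence. Relatedness is
asked only eventually at each level, because truncated arguments are handled by related functions
one level at a time. -/
theorem of_isLUB {x : ℕ → Dom A} {y : ℕ → Dom B} (hx : Monotone x) (hy : Monotone y) {a : Dom A}
    {b : Dom B} (ha : IsLUB (Set.range x) a) (hb : IsLUB (Set.range y) b)
    (h : ∀ k, ∃ i, ∀ j, i ≤ j →
      approxRel (k + 1) A B ((approxDom k A).p (x j)) ((approxDom k B).p (y j))) :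
    DomRel A B a b := by
  intro k
  obtain ⟨i₁, h₁⟩ := exists_proj_eq hx ha k
  obtain ⟨i₂, h₂⟩ := exists_proj_eq hy hb k
  obtain ⟨i₃, h₃⟩ := h k
  have := h₃ (max i₁ (max i₂ i₃)) (by omega)
  rwa [h₁ _ (by omega), h₂ _ (by omega)] at this

theorem apply {f : Dom (.arrow A A')} {g : Dom (.arrow B B')}
    (h : DomRel (.arrow A A') (.arrow B B') f g) {x : Dom A} {y : Dom B} (hxy : DomRel A B x y) :
    DomRel A' B' (Hom.toFun f x) (Hom.toFun g y) := by
  have hx := trunc_mono_level x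
  have hy := trunc_mono_level y
  -- By continuity it is enough to apply `f` and `g` to truncations; the `j`-th level of `h` relates
  -- the values at the `j`-th truncations.
  refine of_isLUB (x := fun i => Hom.toFun f (trunc i A x))
    (y := fun i => Hom.toFun g (trunc i B y))
    ((Hom.mono f).comp hx) ((Hom.mono g).comp hy) ?_ ?_ fun k => ⟨k, fun j hkj => ?_⟩
  · have := Hom.cont f (Set.range_nonempty _) hx.directed_le.directedOn_range (trunc_isLUB x)
    rwa [← Set.range_comp] at this
  · have := Hom.cont g (Set.range_nonempty _) hy.directed_le.directedOn_range (trunc_isLUB y)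
    rwa [← Set.range_comp] at this
  · exact approxRel_of_le hkj (h j _ _ (hxy j))

theorem arrow {f : Dom (.arrow A A')} {g : Dom (.arrow B B')}
    (h : ∀ x y, DomRel A B x y → DomRel A' B' (Hom.toFun f x) (Hom.toFun g y)) :
    DomRel (.arrow A A') (.arrow B B') f g :=
  fun k _ _ hxy => h _ _ (of_approxRel hxy) k

theorem prod_iff {x : Dom (.prod A A')} {y : Dom (.prod B B')} :
    DomRel (.prod A A') (.prod B B') x y ↔
      DomRel A B (Prod.fst x) (Prod.fst y) ∧ DomRel A' B' (Prod.snd x) (Prod.snd y) :=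
  ⟨fun h => ⟨fun k => (h k).1, fun k => (h k).2⟩, fun h k => ⟨h.1 k, h.2 k⟩⟩

theorem inl {x : Dom A} {y : Dom B} (h : DomRel A B x y) :
    DomRel (.sum A A') (.sum B B') (Cpo.WSum.inl x) (Cpo.WSum.inl y) :=
  fun k => Or.inr (Or.inl ⟨_, _, rfl, rfl, h k⟩)

theorem inr {x : Dom A'} {y : Dom B'} (h : DomRel A' B' x y) :
    DomRel (.sum A A') (.sum B B') (Cpo.WSum.inr x) (Cpo.WSum.inr y) :=
  fun k => Or.inr (Or.inr ⟨_, _, rfl, rfl, h k⟩)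

/-- Projections act inside the summands and reflect bottom, so level `0` already decides which
summand both elements belong to; all levels together relate the components. -/
theorem sum_cases {z : Dom (.sum A A')} {w : Dom (.sum B B')}
    (h : DomRel (.sum A A') (.sum B B') z w) :
    sumRel (DomRel A B) (DomRel A' B') z w := by
  have bot_inl : ∀ {X Y : Cpo} (x : X), (⊥ : Cpo.WSum X Y) ≠ Cpo.WSum.inl x := fun _ h =>
    WithBot.bot_ne_coe h
  have bot_inr : ∀ {X Y : Cpo} (y : Y), (⊥ : Cpo.WSum X Y) ≠ Cpo.WSum.inr y := fun _ h =>
    WithBot.bot_ne_coe h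
  have hp : ∀ k, sumRel (approxRel (k + 1) A B) (approxRel (k + 1) A' B')
      (EP.sumMap (approxDom k A).p (approxDom k A').p z)
      (EP.sumMap (approxDom k B).p (approxDom k B').p w) := h
  rcases Cpo.WSum.cases z with rfl | ⟨x, rfl⟩ | ⟨x, rfl⟩
  · rcases Cpo.WSum.cases w with rfl | ⟨y, rfl⟩ | ⟨y, rfl⟩
    · exact Or.inl ⟨rfl, rfl⟩
    · rcases hp 0 with ⟨-, e⟩ | ⟨_, _, e, -, -⟩ | ⟨_, _, e, -, -⟩
      · exact absurd e.symm (bot_inl _)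
      · exact absurd e (bot_inl _)
      · exact absurd e (bot_inr _)
    · rcases hp 0 with ⟨-, e⟩ | ⟨_, _, e, -, -⟩ | ⟨_, _, e, -, -⟩
      · exact absurd e.symm (bot_inr _)
      · exact absurd e (bot_inl _)
      · exact absurd e (bot_inr _)
  · have hx : ∀ k, ∃ y', EP.sumMap (approxDom k B).p (approxDom k B').p w = Cpo.WSum.inl y' ∧
        approxRel (k + 1) A B ((approxDom k A).p x) y' := by
      intro k
      rcases hp k with ⟨e, -⟩ | ⟨x', y', e, e', hxy⟩ | ⟨_, _, e, -, -⟩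
      · exact absurd e.symm (bot_inl _)
      · exact ⟨y', e', (inl_injective e : (approxDom k A).p x = x') ▸ hxy⟩
      · exact absurd e (inl_ne_inr _ _)
    rcases Cpo.WSum.cases w with rfl | ⟨y, rfl⟩ | ⟨y, rfl⟩
    · obtain ⟨y', e, -⟩ := hx 0
      exact absurd e (bot_inl _)
    · refine Or.inr (Or.inl ⟨x, y, rfl, rfl, fun k => ?_⟩)
      obtain ⟨y', e, hxy⟩ := hx k
      exact (inl_injective e : (approxDom k B).p y = y') ▸ hxy
    · obtain ⟨y', e, -⟩ := hx 0
      exact absurd e.symm (inl_ne_inr _ _)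
  · have hx : ∀ k, ∃ y', EP.sumMap (approxDom k B).p (approxDom k B').p w = Cpo.WSum.inr y' ∧
        approxRel (k + 1) A' B' ((approxDom k A').p x) y' := by
      intro k
      rcases hp k with ⟨e, -⟩ | ⟨_, _, e, -, -⟩ | ⟨x', y', e, e', hxy⟩
      · exact absurd e.symm (bot_inr _)
      · exact absurd e.symm (inl_ne_inr _ _)
      · exact ⟨y', e', (inr_injective e : (approxDom k A').p x = x') ▸ hxy⟩
    rcases Cpo.WSum.cases w with rfl | ⟨y, rfl⟩ | ⟨y, rfl⟩
    · obtain ⟨y', e, -⟩ := hx 0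
      exact absurd e (bot_inr _)
    · obtain ⟨y', e, -⟩ := hx 0
      exact absurd e (inl_ne_inr _ _)
    · refine Or.inr (Or.inr ⟨x, y, rfl, rfl, fun k => ?_⟩)
      obtain ⟨y', e, hxy⟩ := hx k
      exact (inr_injective e : (approxDom k B').p y = y') ▸ hxy

theorem unfold {A B : Ty (n + 1)} {x : Dom (.mu A)} {y : Dom (.mu B)}
    (h : DomRel (.mu A) (.mu B) x y) :
    DomRel A.unroll B.unroll (unfoldHom A x) (unfoldHom B y) := by
  intro k
  have hA : (approxDom k A.unroll).p (unfoldHom A x) = (approxDom (k + 1) (.mu A)).p x :=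
    Chain.Cocone.p_map (unrollCocone A) (domCocone A.unroll) (k + 1) x
  have hB : (approxDom k B.unroll).p (unfoldHom B y) = (approxDom (k + 1) (.mu B)).p y :=
    Chain.Cocone.p_map (unrollCocone B) (domCocone B.unroll) (k + 1) y
  rw [hA, hB]
  exact h (k + 1)

theorem fold {A B : Ty (n + 1)} {x : Dom A.unroll} {y : Dom B.unroll}
    (h : DomRel A.unroll B.unroll x y) :
    DomRel (.mu A) (.mu B) (foldHom A x) (foldHom B y) := by
  intro k
  have hA : (approxDom k (.mu A)).p (foldHom A x) = ((domCocone A.unroll).ep k).p x :=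
    Chain.Cocone.p_map (domCocone A.unroll) (unrollCocone A) k x
  have hB : (approxDom k (.mu B)).p (foldHom B y) = ((domCocone B.unroll).ep k).p y :=
    Chain.Cocone.p_map (domCocone B.unroll) (unrollCocone B) k y
  rw [hA, hB]
  -- The lowest approximant of `mu A` in this indexing corresponds to the one-point approximant of
  -- its unrolling, where all is related.
  cases k with
  | zero => trivial
  | succ k => exact h k

end DomRel

-- Least fixpoints and the fundamental lemma.

theorem Hom.fix_mono_iterate {X : Cpo} (f : Hom X X) : Monotone fun n : ℕ => f.toFun^[n] ⊥ :=
  Monotone.monotone_iterate_of_le_map (Hom.mono f) bot_le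

theorem Hom.fix_isLUB {X : Cpo} (f : Hom X X) :
    IsLUB (Set.range fun n : ℕ => f.toFun^[n] ⊥) (Hom.fix X f) :=
  f.fix_mono_iterate.directed_le.directedOn_range.isLUB_sSup

theorem Hom.fix_eq {X : Cpo} (f : Hom X X) : f (Hom.fix X f) = Hom.fix X f := by
  refine (f.cont (Set.range_nonempty _) f.fix_mono_iterate.directed_le.directedOn_range
    f.fix_isLUB).unique ⟨?_, fun b hb => f.fix_isLUB.2 ?_⟩
  · rintro _ ⟨_, ⟨n, rfl⟩, rfl⟩
    exact f.fix_isLUB.1 ⟨n + 1, Function.iterate_succ_apply' _ _ _⟩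
  · rintro _ ⟨n, rfl⟩
    refine (f.fix_mono_iterate (Nat.le_succ n)).trans (hb ⟨_, ⟨n, rfl⟩, ?_⟩)
    exact (Function.iterate_succ_apply' _ _ _).symm

/-- The iterates from `⊥` are related step by step, and the relation is closed under suprema of such
pairs of sequences. -/
theorem DomRel.fix {A B : PTy} {f : Hom (Dom A) (Dom A)} {g : Hom (Dom B) (Dom B)}
    (h : ∀ x y, DomRel A B x y → DomRel A B (f x) (g y)) :
    DomRel A B (Hom.fix _ f) (Hom.fix _ g) := by
  refine of_isLUB f.fix_mono_iterate g.fix_mono_iterate f.fix_isLUB g.fix_isLUB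
    fun k => ⟨0, fun j _ => ?_⟩
  have : ∀ j : ℕ, DomRel A B (f.toFun^[j] ⊥) (g.toFun^[j] ⊥) := by
    intro j
    induction j with
    | zero => exact bot
    | succ j ih =>
      rw [Function.iterate_succ_apply', Function.iterate_succ_apply']
      exact h _ _ ih
  exact this j k

/-- The logical relation on contexts. -/
def CtxRel : (L L' : List PTy) → CtxDom L → CtxDom L' → Prop
  | [], [] => fun _ _ => True
  | A :: L, B :: L' => fun u u' => CtxRel L L' (Prod.fst u) (Prod.fst u') ∧
      DomRel A B (Prod.snd u) (Prod.snd u')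
  | _, _ => fun _ _ => False

theorem CtxRel.lookup {L L' : List PTy} {i : ℕ} {A B : PTy} (x : Lookup L i A) (y : Lookup L' i B)
    {u : CtxDom L} {u' : CtxDom L'} (h : CtxRel L L' u u') : DomRel A B (x.sem u) (y.sem u') := by
  induction x generalizing L' with
  | zero =>
    cases y with
    | zero => exact h.2
  | succ x ih =>
    cases y with
    | succ y => exact ih y h.1

/-- The fundamental lemma of the logical relation. Contexts and types are allowed to differ, because
two derivations of one judgement may, for instance, choose different argument types in an
application; the term forces their last rules to agree. -/
theorem PTyping.sem_rel {L L' : List PTy} {M : Tm} {A B : PTy} (d : PTyping L M A)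
    (d' : PTyping L' M B) {u : CtxDom L} {u' : CtxDom L'} (h : CtxRel L L' u u') :
    DomRel A B (d.sem u) (d'.sem u') := by
  induction d generalizing L' B with
  | var x =>
    cases d' with
    | var y => exact h.lookup x y
  | lam d ih =>
    cases d' with
    | lam d' => exact DomRel.arrow fun x y hxy => ih d' (u := (u, x)) (u' := (u', y)) ⟨h, hxy⟩
  | app d₁ d₂ ih₁ ih₂ =>
    cases d' with
    | app d₁' d₂' => exact (ih₁ d₁' h).apply (ih₂ d₂' h)
  | pair d₁ d₂ ih₁ ih₂ =>
    cases d' with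
    | pair d₁' d₂' => exact DomRel.prod_iff.2 ⟨ih₁ d₁' h, ih₂ d₂' h⟩
  | proj₁ d ih =>
    cases d' with
    | proj₁ d' => exact (DomRel.prod_iff.1 (ih d' h)).1
  | proj₂ d ih =>
    cases d' with
    | proj₂ d' => exact (DomRel.prod_iff.1 (ih d' h)).2
  | star =>
    cases d' with
    | star => exact fun k => rfl
  | fix d ih =>
    cases d' with
    | fix d' => exact DomRel.fix fun x y hxy => ih d' (u := (u, x)) (u' := (u', y)) ⟨h, hxy⟩
  | fold d ih =>
    cases d' with
    | fold d' => exact (ih d' h).fold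
  | unfold d ih =>
    cases d' with
    | unfold d' => exact (ih d' h).unfold
  | inj₁ d ih =>
    cases d' with
    | inj₁ d' => exact (ih d' h).inl
  | inj₂ d ih =>
    cases d' with
    | inj₂ d' => exact (ih d' h).inr
  | case d d₁ d₂ ih ih₁ ih₂ =>
    cases d' with
    | case d' d₁' d₂' =>
      change DomRel _ _
        (Hom.copairFun (Hom.curry d₁.sem u).toFun (Hom.curry d₂.sem u).toFun (d.sem u))
        (Hom.copairFun (Hom.curry d₁'.sem u').toFun (Hom.curry d₂'.sem u').toFun (d'.sem u'))
      rcases (ih d' h).sum_cases with ⟨e, e'⟩ | ⟨x, y, e, e', hxy⟩ | ⟨x, y, e, e', hxy⟩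
      · rw [e, e']
        exact DomRel.bot
      · rw [e, e']
        exact ih₁ d₁' (u := (u, x)) (u' := (u', y)) ⟨h, hxy⟩
      · rw [e, e']
        exact ih₂ d₂' (u := (u, x)) (u' := (u', y)) ⟨h, hxy⟩

theorem DomRel.refl {A : PTy} (x : Dom A) : DomRel A A x x :=
  fun k => (approxRel_self (k + 1) A _ _).2 rfl

theorem CtxRel.refl : (L : List PTy) → (u : CtxDom L) → CtxRel L L u u
  | [], _ => trivial
  | _ :: L, u => ⟨CtxRel.refl L (Prod.fst u), DomRel.refl (Prod.snd u)⟩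

/-- The interpretation of a typing judgement does not depend on its derivation. -/
theorem PTyping.sem_eq {L : List PTy} {M : Tm} {A : PTy} (d d' : PTyping L M A) (u : CtxDom L) :
    d.sem u = d'.sem u := (d.sem_rel d' (CtxRel.refl L u)).eq

end

section

/-! ### Soundness of typing -/

theorem Sub.sound {A : PTy} {T U : RT A} (h : Sub T U) (ρ : ℕ → ℕ) : T.sem ρ ⊆ U.sem ρ := by
  induction h with
  | refl => exact subset_rfl
  | trans _ _ ih₁ ih₂ => exact ih₁.trans ih₂
  | under => exact Set.subset_univ _
  | top => exact subset_rfl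
  | ded _ _ h => exact h.sound ρ _
  | prod _ _ ih₁ ih₂ => exact fun x hx => ⟨ih₁ hx.1, ih₂ hx.2⟩
  | arrow _ _ ih₁ ih₂ => exact semImp_mono ih₁ ih₂
  | pureProd => exact fun _ _ => ⟨trivial, trivial⟩
  | pureArrow => exact fun _ _ _ _ => trivial
  | reftProd | prodReft | reftArrow | arrowReft => exact subset_rfl

-- Satisfaction of refinement contexts, and the induction on typing.

/-- The tuple `u` in a context `L` of pure types satisfies the refinement context `Γ`, with
underlying pure context `L`. -/
inductive Sat (ρ : ℕ → ℕ) : RCtx → (L : List PTy) → CtxDom L → Prop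
  | nil (u : CtxDom []) : Sat ρ [] [] u
  | cons {Γ : RCtx} {L : List PTy} {A : PTy} {T : RT A} (u : CtxDom L) (x : Dom A) :
      Sat ρ Γ L u → x ∈ T.sem ρ → Sat ρ (⟨A, T⟩ :: Γ) (A :: L) (u, x)

theorem sat_of_mem {ρ : ℕ → ℕ} : (Γ : RCtx) → (u : CtxDom Γ.under) → u ∈ RCtx.sem ρ Γ →
    Sat ρ Γ Γ.under u
  | [], u, _ => .nil u
  | ⟨_, _⟩ :: Γ, u, h => .cons (Prod.fst u) (Prod.snd u) (sat_of_mem Γ _ h.1) h.2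

theorem Sat.lookup {ρ : ℕ → ℕ} {Γ : RCtx} {L : List PTy} {u : CtxDom L} (h : Sat ρ Γ L u) {i : ℕ}
    {A : PTy} {T : RT A} (x : Lookup Γ i ⟨A, T⟩) (y : Lookup L i A) : y.sem u ∈ T.sem ρ := by
  induction h generalizing i with
  | nil => cases x
  | cons u a _ ha ih =>
    cases x with
    | zero =>
      cases y with
      | zero => exact ha
    | succ x =>
      cases y with
      | succ y => exact ih x y

theorem Lookup.under {Γ : RCtx} {i : ℕ} {a : Σ A, RT A} (x : Lookup Γ i a) :
    Nonempty (Lookup Γ.under i a.1) := by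
  induction x with
  | zero => exact ⟨.zero⟩
  | succ _ ih => exact ih.map .succ

theorem CtxSub.sat {ρ : ℕ → ℕ} {Γ Γ' : RCtx} (h : CtxSub Γ' Γ) {L : List PTy} {u : CtxDom L}
    (hu : Sat ρ Γ' L u) : Sat ρ Γ L u := by
  induction h generalizing L with
  | nil => exact hu
  | cons hs _ ih =>
    cases hu with
    | cons u x hu hx => exact .cons u x (ih hu) (hs.sound ρ hx)

theorem CtxSub.under_eq {Γ Γ' : RCtx} (h : CtxSub Γ' Γ) : Γ'.under = Γ.under := by
  induction h with
  | nil => rfl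
  | cons _ _ ih => exact congrArg (List.cons _) ih

theorem RCtx.under_append_cons (Δ Γ : RCtx) {B : PTy} (T U : RT B) :
    RCtx.under (Δ ++ ⟨B, T⟩ :: Γ) = RCtx.under (Δ ++ ⟨B, U⟩ :: Γ) := by
  simp [RCtx.under]

theorem Sat.or {ρ : ℕ → ℕ} {Γ Δ : RCtx} {B : PTy} {ψ₁ ψ₂ : Form [] B} {h₁ : IsFormula ψ₁}
    {h₂ : IsFormula ψ₂} {h : IsFormula (ψ₁.or ψ₂)} {L : List PTy} {u : CtxDom L}
    (hu : Sat ρ (Δ ++ ⟨B, .reft _ h⟩ :: Γ) L u) :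
    Sat ρ (Δ ++ ⟨B, .reft ψ₁ h₁⟩ :: Γ) L u ∨ Sat ρ (Δ ++ ⟨B, .reft ψ₂ h₂⟩ :: Γ) L u := by
  induction Δ generalizing L with
  | nil =>
    cases hu with
    | cons u x hu hx => exact hx.imp (.cons u x hu) (.cons u x hu)
  | cons a Δ ih =>
    cases hu with
    | cons u x hu hx => exact (ih hu).imp (.cons u x · hx) (.cons u x · hx)

theorem Sat.false_of_bot {ρ : ℕ → ℕ} {Γ Δ : RCtx} {B : PTy} {h : IsFormula (A := B) .bot}
    {L : List PTy} {u : CtxDom L} (hu : Sat ρ (Δ ++ ⟨B, .reft .bot h⟩ :: Γ) L u) : False := by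
  induction Δ generalizing L with
  | nil =>
    cases hu with
    | cons u x hu hx => exact hx
  | cons a Δ ih =>
    cases hu with
    | cons u x hu hx => exact ih hu

/-- One good derivation suffices, by independence of the derivation. Keeping `L` as a variable equal
to `Γ.under` avoids transports in the rules that change the refinements of a context but not its
pure types. -/
theorem Typing.exists_pure {Γ : RCtx} {M : Tm} {A : PTy} {T : RT A} (h : Typing Γ M T)
    {L : List PTy} (hL : Γ.under = L) :
    ∃ d : PTyping L M A, ∀ ρ u, Sat ρ Γ L u → d.sem u ∈ T.sem ρ := by
  induction h generalizing L with
  | var x =>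
    subst hL
    obtain ⟨y⟩ := x.under
    exact ⟨.var y, fun ρ u hu => hu.lookup x y⟩
  | lam _ ih =>
    obtain ⟨d, hd⟩ := ih (congrArg (List.cons _) hL)
    exact ⟨.lam d, fun ρ u hu x hx => hd ρ (u, x) (.cons u x hu hx)⟩
  | app _ _ ih₁ ih₂ =>
    obtain ⟨d₁, h₁⟩ := ih₁ hL
    obtain ⟨d₂, h₂⟩ := ih₂ hL
    exact ⟨.app d₁ d₂, fun ρ u hu => h₁ ρ u hu _ (h₂ ρ u hu)⟩
  | pair _ _ ih₁ ih₂ =>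
    obtain ⟨d₁, h₁⟩ := ih₁ hL
    obtain ⟨d₂, h₂⟩ := ih₂ hL
    exact ⟨.pair d₁ d₂, fun ρ u hu => ⟨h₁ ρ u hu, h₂ ρ u hu⟩⟩
  | proj₁ _ ih =>
    obtain ⟨d, hd⟩ := ih hL
    exact ⟨.proj₁ d, fun ρ u hu => (hd ρ u hu).1⟩
  | proj₂ _ ih =>
    obtain ⟨d, hd⟩ := ih hL
    exact ⟨.proj₂ d, fun ρ u hu => (hd ρ u hu).2⟩
  | star => exact ⟨.star, fun _ _ _ => trivial⟩
  | fix _ ih =>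
    obtain ⟨d, -⟩ := ih (congrArg (List.cons _) hL)
    exact ⟨.fix d, fun _ _ _ => trivial⟩
  | fold _ ih =>
    obtain ⟨d, -⟩ := ih hL
    exact ⟨.fold d, fun _ _ _ => trivial⟩
  | unfold _ ih =>
    obtain ⟨d, -⟩ := ih hL
    exact ⟨.unfold d, fun _ _ _ => trivial⟩
  | inj₁ _ ih =>
    obtain ⟨d, -⟩ := ih hL
    exact ⟨.inj₁ d, fun _ _ _ => trivial⟩
  | inj₂ _ ih =>
    obtain ⟨d, -⟩ := ih hL
    exact ⟨.inj₂ d, fun _ _ _ => trivial⟩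
  | case _ _ _ ih ih₁ ih₂ =>
    obtain ⟨d, -⟩ := ih hL
    obtain ⟨d₁, -⟩ := ih₁ (congrArg (List.cons _) hL)
    obtain ⟨d₂, -⟩ := ih₂ (congrArg (List.cons _) hL)
    exact ⟨.case d d₁ d₂, fun _ _ _ => trivial⟩
  | starReft => exact ⟨.star, fun _ _ _ => rfl⟩
  | pairReft₁ _ _ _ _ ih₁ ih₂ =>
    obtain ⟨d₁, h₁⟩ := ih₁ hL
    obtain ⟨d₂, -⟩ := ih₂ hL
    exact ⟨.pair d₁ d₂, fun ρ u hu => h₁ ρ u hu⟩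
  | pairReft₂ _ _ _ _ ih₁ ih₂ =>
    obtain ⟨d₁, -⟩ := ih₁ hL
    obtain ⟨d₂, h₂⟩ := ih₂ hL
    exact ⟨.pair d₁ d₂, fun ρ u hu => h₂ ρ u hu⟩
  | projReft₁ _ _ _ ih =>
    obtain ⟨d, hd⟩ := ih hL
    exact ⟨.proj₁ d, fun ρ u hu => hd ρ u hu⟩
  | projReft₂ _ _ _ ih =>
    obtain ⟨d, hd⟩ := ih hL
    exact ⟨.proj₂ d, fun ρ u hu => hd ρ u hu⟩
  | @foldReft _ _ A φ _ _ _ ih =>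
    obtain ⟨d, hd⟩ := ih hL
    refine ⟨.fold d, fun ρ u hu => ?_⟩
    change unfoldHom A (foldHom A (d.sem u)) ∈ φ.sem ρ FVal.nil
    rw [unfold_fold]
    exact hd ρ u hu
  | unfoldReft _ _ _ ih =>
    obtain ⟨d, hd⟩ := ih hL
    exact ⟨.unfold d, fun ρ u hu => hd ρ u hu⟩
  | injReft₁ _ _ _ ih =>
    obtain ⟨d, hd⟩ := ih hL
    exact ⟨.inj₁ d, fun ρ u hu => ⟨_, hd ρ u hu, rfl⟩⟩
  | injReft₂ _ _ _ ih =>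
    obtain ⟨d, hd⟩ := ih hL
    exact ⟨.inj₂ d, fun ρ u hu => ⟨_, hd ρ u hu, rfl⟩⟩
  | @caseReft₁ _ _ _ _ _ _ _ T _ _ _ _ _ hN ih ih₁ =>
    subst hL
    obtain ⟨d, hd⟩ := ih rfl
    obtain ⟨d₁, h₁⟩ := ih₁ rfl
    obtain ⟨d₂⟩ := hN
    refine ⟨.case d d₁ d₂, fun ρ u hu => ?_⟩
    obtain ⟨x, hx, e⟩ := hd ρ u hu
    change Hom.copairFun (Hom.curry d₁.sem u).toFun (Hom.curry d₂.sem u).toFun (d.sem u) ∈ T.sem ρ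
    -- The scrutinee is a first injection, so only the first branch is evaluated; the second needs
    -- no more than a pure typing.
    rw [← e]
    exact h₁ ρ (u, x) (.cons u x hu hx)
  | @caseReft₂ _ _ _ _ _ _ _ T _ _ _ _ hN _ ih ih₂ =>
    subst hL
    obtain ⟨d, hd⟩ := ih rfl
    obtain ⟨d₁⟩ := hN
    obtain ⟨d₂, h₂⟩ := ih₂ rfl
    refine ⟨.case d d₁ d₂, fun ρ u hu => ?_⟩
    obtain ⟨x, hx, e⟩ := hd ρ u hu
    change Hom.copairFun (Hom.curry d₁.sem u).toFun (Hom.curry d₂.sem u).toFun (d.sem u) ∈ T.sem ρ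
    rw [← e]
    exact h₂ ρ (u, x) (.cons u x hu hx)
  | @fixReft _ _ A ψ φ _ _ _ _ ih₁ ih₂ =>
    obtain ⟨d₁, h₁⟩ := ih₁ hL
    obtain ⟨d₂, h₂⟩ := ih₂ (congrArg (List.cons _) hL)
    refine ⟨.fix d₂, fun ρ u hu => ?_⟩
    have hψ := h₁ ρ u hu
    -- The two premises may type the body differently. Coherence moves the invariant `ψ` to the
    -- fixpoint built from `d₂`; applying `d₂` to that fixpoint lands in `φ` and returns the same
    -- point.
    rw [d₁.sem_eq (.fix d₂)] at hψ
    have hφ := h₂ ρ (u, _) (.cons u _ hu hψ)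
    have e : d₂.sem (u, (PTyping.fix d₂).sem u) = (PTyping.fix d₂).sem u :=
      Hom.fix_eq (Hom.curry d₂.sem u)
    rwa [e] at hφ
  | and _ _ _ _ _ ih₁ ih₂ =>
    obtain ⟨d₁, h₁⟩ := ih₁ hL
    obtain ⟨d₂, h₂⟩ := ih₂ hL
    -- The premises yield two derivations for `M`, identified by coherence.
    exact ⟨d₁, fun ρ u hu => ⟨h₁ ρ u hu, d₁.sem_eq d₂ u ▸ h₂ ρ u hu⟩⟩
  | or _ _ _ _ _ ih₁ ih₂ =>
    obtain ⟨d₁, h₁⟩ := ih₁ ((RCtx.under_append_cons _ _ _ _).trans hL)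
    obtain ⟨d₂, h₂⟩ := ih₂ ((RCtx.under_append_cons _ _ _ _).trans hL)
    refine ⟨d₁, fun ρ u hu => hu.or.elim (h₁ ρ u) (fun hu => d₁.sem_eq d₂ u ▸ h₂ ρ u hu)⟩
  | bot _ hM =>
    subst hL
    obtain ⟨d⟩ := hM
    exact ⟨d, fun ρ u hu => hu.false_of_bot.elim⟩
  | sub hΓ _ hT ih =>
    obtain ⟨d, hd⟩ := ih (hΓ.under_eq.symm.trans hL)
    exact ⟨d, fun ρ u hu => hT.sound ρ (hd ρ u (hΓ.sat hu))⟩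

end

end

end FPC

theorem mainTheorem3 (Γ : FPC.RCtx) (M : FPC.Tm) {A : FPC.PTy} (T : FPC.RT A)
    (h : FPC.Typing Γ M T) : FPC.Sound Γ M T := by
  obtain ⟨d, hd⟩ := h.exists_pure rfl
  refine ⟨⟨d⟩, fun d' ρ u hu => ?_⟩
  -- Coherence passes from the constructed derivation to an arbitrary one.
  rw [d'.sem_eq d]
  exact hd ρ u (FPC.sat_of_mem Γ u hu)
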